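/- Notation. Let $m$ be a positive integer, $R=\begin{pmatrix}0&-1&0\\1&0&0\\0&0&0\end{pmatrix}$, $\hat\jmath=(0,1,0)^T$, $\hat k=(0,0,1)^T$, and $h_1(r)=\frac{2}{r^m+r^{-m}}$, $h_3(r)=\frac{r^m-r^{-m}}{r^m+r^{-m}}$, $h=(h_1,0,h_3)^T$. Write $L^2=L^2((0,\infty),r\,dr)$. Let $\mathcal E(u)=\frac12\int_{\mathbb R^2}|\nabla u|^2dx$, and let $\Sigma_m$ be the set of maps $u:\mathbb R^2\to\mathbb S^2\subset\mathbb R^3$ of the form $u=e^{m\theta R}v(r)$ in polar coordinates, with $\mathcal E(u)<\infty$, $v(0)=-\hat k$ and $v(\infty)=\hat k$ (then $v$ is continuous on $[0,\infty)$ and locally absolutely continuous on $(0,\infty)$). Let $I\subset\mathbb R$ be a nondegenerate interval. A solution of the Schrödinger flow $u_t=u\times\Delta u$ in $C(I;\Sigma_m)$ is a family $u(t)=e^{m\theta R}v(r,t)\in\Sigma_m$, $t\in I$, continuous in $t$ for the distance $\|\nabla(u-\tilde u)\|_{L^2(\mathbb R^2)}$, such that $$\int_I\int_{\mathbb R^2}\Big\{u\cdot\phi_t-\sum_{j=1}^2(u\times\partial_ju)\cdot\partial_j\phi\Big\}\,dx\,dt=0$$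 for all $\phi\in C^1(\mathbb R\times\mathbb R^2;\mathbb R^3)$ with compact support in $\mathrm{int}(I)\times\mathbb R^2$. Given such a solution and functions $s:I\to(0,\infty)$, $\alpha:I\to\mathbb R$, write $$v(r,t)=e^{\alpha(t)R}\,[\,h(\rho)+\xi(\rho,t)\,],\qquad \rho=r/s(t),\qquad \xi=z_1\hat\jmath+z_2\,(h\times\hat\jmath)+\gamma h,\qquad z=z_1+iz_2,$$ and $\|z\|_X^2=\int_0^\infty\big(|z_\rho|^2+|z|^2/\rho^2\big)\rho\,d\rho$. For each $t$ let $e(\cdot,t)$ be a unit tangent field along $v(\cdot,t)$ (so $|e|=1$, $e\cdot v=0$), locally absolutely continuous in $r\in(0,\infty)$, with $e_r-(e_r\cdot v)v=0$ a.e., and let the Hasimoto variable $q=q_1+iq_2$ be given by $$v_r-\tfrac mr\,v\times(Rv)=q_1\,e+q_2\,(v\times e).$$ Corollary 2.4. Let $m>3$. There are constants $\delta>0$ and $C>0$, depending only on $m$, such that the following holds for every nondegenerate interval $I$ and every solution $u\in C(I;\Sigma_m)$ of the Schrödinger flow. If $s:I\to(0,\infty)$ and $\alpha:I\to\mathbb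 R$ are continuous and, for all $t\in I$, $$\int_0^\infty z(\rho,t)\,h_1(\rho)\,\rho\,d\rho=0\qquad\text{and}\qquad\|z(t)\|_X\le\delta,$$ then $s$ and $\alpha$ are differentiable on $I$ (one-sidedly at end points of $I$ that belong to $I$), and for all $t\in I$ $$\left|\frac{\dot s(t)}{s(t)}\right|+|\dot\alpha(t)|\le C\,\Big\|\frac{q(t)}{r}\Big\|_{L^2}^2,$$ where the right-hand side may be $+\infty$. -/

import Mathlib

open MeasureTheory Set Filter Topology
open scoped Matrix ENNReal

namespace SchrodingerMap

noncomputable section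

/-! ### Vectors of `ℝ³`, the plane, and equivariant maps

Vectors of `ℝ³` are functions `Fin 3 → ℝ`; lengths and angles are always taken with the
dot product `⬝ᵥ`, never with the sup norm. The plane `ℝ²` is `ℂ` (Euclidean norm, Lebesgue
measure); polar coordinates of `x` are `‖x‖` and `x.arg`. -/

abbrev R3 : Type := Fin 3 → ℝ

/-- The generator `R` of the rotations about the third axis. -/
def rotGen : Matrix (Fin 3) (Fin 3) ℝ :=
  !![0, -1, 0; 1, 0, 0; 0, 0, 0]

/-- The rotation `e^{aR}`. -/
def rot (a : ℝ) : Matrix (Fin 3) (Fin 3) ℝ :=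
  !![Real.cos a, -Real.sin a, 0; Real.sin a, Real.cos a, 0; 0, 0, 1]

/-- The unit vectors in the second and third coordinate directions. -/
def jHat : R3 := ![0, 1, 0]

def kHat : R3 := ![0, 0, 1]

/-- The `m`-equivariant map `u(r, θ) = e^{mθR} v(r)` with profile `v`. -/
def equivariantMap (m : ℕ) (v : ℝ → R3) (x : ℂ) : R3 :=
  rot (m * x.arg) *ᵥ v ‖x‖

/-- The two coordinate directions of the plane. -/
def dir (j : Fin 2) : ℂ := ![1, Complex.I] j

/-- The partial derivative `∂_j u`. It is applied to maps that are differentiable almost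
everywhere, with absolutely continuous profile, for which it is also the weak derivative. -/
def pd (j : Fin 2) (u : ℂ → R3) (x : ℂ) : R3 := fderiv ℝ u x (dir j)

/-- The energy `½ ∫_{ℝ²} |∇u|²`. -/
def energy (u : ℂ → R3) : ℝ≥0∞ :=
  (1 / 2) * ∫⁻ x : ℂ, ENNReal.ofReal (∑ j : Fin 2, pd j u x ⬝ᵥ pd j u x)

/-- `v` is the profile of a map `e^{mθR} v(r)` in the class `Σ_m`: it takes values in the
unit sphere, it is locally absolutely continuous on `(0, ∞)` (that is, it is the continuous
representative of a weakly differentiable function), the map has finite energy, and `v` runs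
from the south pole at `r = 0` to the north pole at `r = ∞`. -/
structure IsSigmaProfile (m : ℕ) (v : ℝ → R3) : Prop where
  unit : ∀ r, 0 ≤ r → v r ⬝ᵥ v r = 1
  absCont : ∀ a b, 0 < a → a ≤ b → AbsolutelyContinuousOnInterval v a b
  finite_energy : energy (equivariantMap m v) < ∞
  at_zero : v 0 = -kHat
  tendsto_zero : Tendsto v (𝓝[>] 0) (𝓝 (-kHat))
  tendsto_infty : Tendsto v atTop (𝓝 kHat)

/-! ### The Schrödinger flow -/

/-- `u` is a weak solution of `u_t = u × Δu` on `ℝ² × I`, continuous in time with respect to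
the energy (`Ḣ¹`) distance: for all `φ ∈ C¹` with values in `ℝ³` and with compact support in
`interior I × ℝ²`, `∬ (u · φ_t - ∑_j (u × ∂_j u) · ∂_j φ) dx dt = 0`. -/
structure IsWeakSchrodingerFlow (I : Set ℝ) (u : ℝ → ℂ → R3) : Prop where
  continuous_energy : ∀ t ∈ I,
    Tendsto (fun τ => energy (fun x => u τ x - u t x)) (𝓝[I] t) (𝓝 0)
  weak_form : ∀ φ : ℝ × ℂ → R3, ContDiff ℝ 1 φ → HasCompactSupport φ →
    tsupport φ ⊆ interior I ×ˢ (univ : Set ℂ) →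
    ∫ t in interior I, ∫ x : ℂ,
      (u t x ⬝ᵥ fderiv ℝ φ (t, x) (1, 0)
        - ∑ j : Fin 2, (u t x ⨯₃ pd j (u t) x) ⬝ᵥ fderiv ℝ φ (t, x) (0, dir j)) = 0

/-! ### Harmonic maps and the splitting -/

/-- `h₁(r) = 2 / (r^m + r^{-m})`, written so as to make sense at `r = 0` too. -/
def h1 (m : ℕ) (r : ℝ) : ℝ := 2 * r ^ m / (r ^ (2 * m) + 1)

/-- `h₃(r) = (r^m - r^{-m}) / (r^m + r^{-m})`, written so as to make sense at `r = 0` too. -/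
def h3 (m : ℕ) (r : ℝ) : ℝ := (r ^ (2 * m) - 1) / (r ^ (2 * m) + 1)

/-- The profile `h` of the harmonic map `e^{mθR} h(r)`. -/
def harm (m : ℕ) (r : ℝ) : R3 := ![h1 m r, 0, h3 m r]

/-- The perturbation `ξ` in `v(r) = e^{αR} [h(ρ) + ξ(ρ)]`, `ρ = r / s`. -/
def pert (m : ℕ) (s α : ℝ) (v : ℝ → R3) (ρ : ℝ) : R3 :=
  rot (-α) *ᵥ v (s * ρ) - harm m ρ

/-- The complex coordinate `z = z₁ + i z₂` of the part of `ξ` tangent to the sphere at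
`h(ρ)`, in the orthonormal basis `ĵ`, `h(ρ) × ĵ`: `ξ = z₁ ĵ + z₂ (h × ĵ) + γ h`. -/
def zCoord (m : ℕ) (s α : ℝ) (v : ℝ → R3) (ρ : ℝ) : ℂ :=
  ⟨pert m s α v ρ ⬝ᵥ jHat, pert m s α v ρ ⬝ᵥ (harm m ρ ⨯₃ jHat)⟩

/-- The norm `‖z‖_X = (∫₀^∞ (|z_ρ|² + |z|²/ρ²) ρ dρ)^{1/2}`. -/
def xNorm (z : ℝ → ℂ) : ℝ≥0∞ :=
  (∫⁻ ρ in Ioi (0 : ℝ), ENNReal.ofReal ((‖deriv z ρ‖ ^ 2 + ‖z ρ‖ ^ 2 / ρ ^ 2) * ρ)) ^ (1 / 2 : ℝ)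

/-! ### The Hasimoto variable -/

/-- The vector field `W = v_r - (m/r) v × (R v)` along `v`. -/
def deviation (m : ℕ) (v : ℝ → R3) (r : ℝ) : R3 :=
  deriv v r - (m / r) • (v r ⨯₃ (rotGen *ᵥ v r))

/-- `e` is a unit tangent field along `v` with vanishing covariant derivative
`D_r e = e_r - (e_r · v) v`. -/
structure IsGaugeFrame (v e : ℝ → R3) : Prop where
  unit : ∀ r, 0 < r → e r ⬝ᵥ e r = 1
  tangent : ∀ r, 0 < r → e r ⬝ᵥ v r = 0
  absCont : ∀ a b, 0 < a → a ≤ b → AbsolutelyContinuousOnInterval e a b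
  parallel : ∀ᵐ r ∂(volume.restrict (Ioi (0 : ℝ))),
    deriv e r - (deriv e r ⬝ᵥ v r) • v r = 0

/-- The Hasimoto variable `q = q₁ + i q₂`, where `W = q₁ e + q₂ (v × e)`. -/
def hasimoto (m : ℕ) (v e : ℝ → R3) (r : ℝ) : ℂ :=
  ⟨deviation m v r ⬝ᵥ e r, deviation m v r ⬝ᵥ (v r ⨯₃ e r)⟩

/-- `‖q/r‖²` in `L²((0, ∞), r dr)`. -/
def sqNormDivR (q : ℝ → ℂ) : ℝ≥0∞ :=
  ∫⁻ r in Ioi (0 : ℝ), ENNReal.ofReal (‖q r‖ ^ 2 / r ^ 2 * r)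

end

end SchrodingerMap

namespace SchrodingerMap

/-! ### Linear algebra in `ℝ³` -/

/-! Let V be the profile rotated back by α and rescaled by s, and let W be its `deviation` V_r -
(m/r) V × RV. W vanishes on the harmonic profile h, and |W| is the modulus of the Hasimoto variable
of V. The orthogonality condition says that v(t) is orthogonal to the two kernels h₁ĵ and h₁(h × ĵ),
rotated and dilated by α(t) and s(t). Since s and α are only continuous, the chain rule is not
available. Instead, the increment of the condition between two times is split in two. The part where
the kernels move is linear in the increments of s and α, with convergent coefficients
(`IsKernel.exists_increment`). The part where v moves is differentiable in time, with derivative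
minus the flux, by the weak equation (`hasDerivWithinAt_pairing`). Hence the difference quotients of
s and α solve a 2×2 linear system, and Cramer's rule (`hasDerivWithinAt_of_linear_system`) gives
both differentiability and a formula. At V = h the matrix is antidiagonal and invertible, so for
small δ the solution is bounded by the two fluxes (`abs_cramer_le`), up to the factor s⁻² that also
appears when ‖q/r‖² is rescaled.

The fluxes are quadratically small. Adding an exact derivative turns the flux through a kernel K,
with E = rK_r, into ∫ W · (E × V - mRK) dr (`flux_eq_integral_deviation`). For V = h the bracket is
a multiple of h, because K belongs to the kernel of the linearized problem. As W ⟂ V, what remains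
is bilinear in W and ξ = V - h, and the decay of h₁ bounds it by ∫ |W|²/r + ∫ |ξ|²/r³
(`IsClose.abs_flux_le`).

It remains to bound ξ by W. The tangential coordinates of ξ satisfy L₀z = (component of W) +
(quadratic terms), where L₀ = ∂_r + (m/r)h₃ = h₁ ∂_r h₁⁻¹. A weighted Hardy inequality (`hardy_h1`)
controls z - z(1)h₁. Orthogonality to h₁ then controls z(1) by Cauchy-Schwarz (`sq_apply_one_le`),
at the price of the finiteness of ∫ h₁² r⁵ dr; this is where m > 3 enters. Smallness of δ absorbs
the quadratic terms (`exists_coercive`, `exists_integral_coord_le`).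

When ‖q/r‖ is infinite the inequality is empty, but differentiability persists: the fluxes are
finite for every finite-energy profile. -/

lemma dot3 (x y : R3) : x ⬝ᵥ y = x 0 * y 0 + x 1 * y 1 + x 2 * y 2 := by
  simp [dotProduct, Fin.sum_univ_three]

lemma rot_mulVec (a : ℝ) (x : R3) : rot a *ᵥ x =
    ![Real.cos a * x 0 - Real.sin a * x 1, Real.sin a * x 0 + Real.cos a * x 1, x 2] := by
  ext i
  fin_cases i <;> simp [rot, Matrix.mulVec, Matrix.vecHead, Matrix.vecTail, sub_eq_add_neg]

lemma rotGen_mulVec (x : R3) : rotGen *ᵥ x = ![-x 1, x 0, 0] := by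
  ext i
  fin_cases i <;> simp [rotGen, Matrix.mulVec, Matrix.vecHead, Matrix.vecTail]

lemma cross3 (x y : R3) : x ⨯₃ y =
    ![x 1 * y 2 - x 2 * y 1, x 2 * y 0 - x 0 * y 2, x 0 * y 1 - x 1 * y 0] := by
  rw [cross_apply]

lemma rot_dot_rot (a : ℝ) (x y : R3) : (rot a *ᵥ x) ⬝ᵥ (rot a *ᵥ y) = x ⬝ᵥ y := by
  simp only [rot_mulVec, dot3, Matrix.cons_val]
  linear_combination (x 0 * y 0 + x 1 * y 1) * Real.sin_sq_add_cos_sq a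

lemma rot_add_mulVec (a b : ℝ) (x : R3) : rot (a + b) *ᵥ x = rot a *ᵥ (rot b *ᵥ x) := by
  ext i
  fin_cases i <;> simp [rot_mulVec, Real.cos_add, Real.sin_add] <;> ring

lemma rot_zero_mulVec (x : R3) : rot 0 *ᵥ x = x := by
  ext i
  fin_cases i <;> simp [rot_mulVec]

lemma rot_neg_cancel (a : ℝ) (x : R3) : rot a *ᵥ (rot (-a) *ᵥ x) = x := by
  rw [← rot_add_mulVec, add_neg_cancel, rot_zero_mulVec]

lemma rot_neg_cancel' (a : ℝ) (x : R3) : rot (-a) *ᵥ (rot a *ᵥ x) = x := by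
  rw [← rot_add_mulVec, neg_add_cancel, rot_zero_mulVec]

lemma rot_rotGen (a : ℝ) (x : R3) : rotGen *ᵥ (rot a *ᵥ x) = rot a *ᵥ (rotGen *ᵥ x) := by
  ext i
  fin_cases i <;> simp [rot_mulVec, rotGen_mulVec] <;> ring

lemma rot_cross_rot (a : ℝ) (x y : R3) :
    (rot a *ᵥ x) ⨯₃ (rot a *ᵥ y) = rot a *ᵥ (x ⨯₃ y) := by
  ext i
  fin_cases i
  · simp [rot_mulVec, cross3]; ring
  · simp [rot_mulVec, cross3]; ring
  · simp [rot_mulVec, cross3]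
    linear_combination (x 0 * y 1 - x 1 * y 0) * Real.sin_sq_add_cos_sq a

lemma abs_apply_le_norm (x : R3) (i : Fin 3) : |x i| ≤ ‖x‖ := norm_le_pi_norm x i

lemma abs_dot_le (x y : R3) : |x ⬝ᵥ y| ≤ 3 * (‖x‖ * ‖y‖) := by
  have h : ∀ i, |x i * y i| ≤ ‖x‖ * ‖y‖ := fun i => by
    rw [abs_mul]
    exact mul_le_mul (abs_apply_le_norm x i) (abs_apply_le_norm y i) (abs_nonneg _) (norm_nonneg _)
  rw [dot3]
  have := abs_add_three (x 0 * y 0) (x 1 * y 1) (x 2 * y 2)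
  linarith [h 0, h 1, h 2]

lemma norm_cross_le (x y : R3) : ‖x ⨯₃ y‖ ≤ 2 * (‖x‖ * ‖y‖) := by
  have h : ∀ i j, |x i * y j| ≤ ‖x‖ * ‖y‖ := fun i j => by
    rw [abs_mul]
    exact mul_le_mul (abs_apply_le_norm x i) (abs_apply_le_norm y j) (abs_nonneg _) (norm_nonneg _)
  have h' : ∀ i j k l, |x i * y j - x k * y l| ≤ 2 * (‖x‖ * ‖y‖) := fun i j k l =>
    (abs_sub _ _).trans (by linarith [h i j, h k l])
  rw [pi_norm_le_iff_of_nonneg (by positivity), cross3]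
  intro i
  fin_cases i <;> exact h' _ _ _ _

lemma norm_rotGen_le (x : R3) : ‖rotGen *ᵥ x‖ ≤ ‖x‖ := by
  rw [pi_norm_le_iff_of_nonneg (by positivity), rotGen_mulVec]
  intro i
  fin_cases i
  · simpa using abs_apply_le_norm x 1
  · exact abs_apply_le_norm x 0
  · simp

lemma norm_rot_le (a : ℝ) (x : R3) : ‖rot a *ᵥ x‖ ≤ 2 * ‖x‖ := by
  have h : ∀ c i, |c| ≤ 1 → |c * x i| ≤ ‖x‖ := fun c i hc => by
    rw [abs_mul]
    calc |c| * |x i| ≤ 1 * ‖x‖ :=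
          mul_le_mul hc (abs_apply_le_norm x i) (abs_nonneg _) zero_le_one
      _ = ‖x‖ := one_mul _
  have hc := Real.abs_cos_le_one a
  have hs := Real.abs_sin_le_one a
  rw [pi_norm_le_iff_of_nonneg (by positivity), rot_mulVec]
  intro i
  fin_cases i
  · exact (abs_sub _ _).trans (by linarith [h _ 0 hc, h _ 1 hs])
  · exact (abs_add_le _ _).trans (by linarith [h _ 0 hs, h _ 1 hc])
  · exact (abs_apply_le_norm x 2).trans (by linarith [norm_nonneg x])

lemma norm_sq_le_dot (x : R3) : ‖x‖ ^ 2 ≤ x ⬝ᵥ x := by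
  have h0 : 0 ≤ x ⬝ᵥ x := by
    rw [dot3]
    nlinarith [mul_self_nonneg (x 0), mul_self_nonneg (x 1), mul_self_nonneg (x 2)]
  have : ‖x‖ ≤ Real.sqrt (x ⬝ᵥ x) := by
    rw [pi_norm_le_iff_of_nonneg (Real.sqrt_nonneg _)]
    intro i
    rw [Real.norm_eq_abs, ← Real.sqrt_sq_eq_abs]
    apply Real.sqrt_le_sqrt
    rw [dot3]
    fin_cases i <;> simp <;> nlinarith [mul_self_nonneg (x 0), mul_self_nonneg (x 1),
      mul_self_nonneg (x 2)]
  calc ‖x‖ ^ 2 ≤ Real.sqrt (x ⬝ᵥ x) ^ 2 := pow_le_pow_left₀ (norm_nonneg _) this 2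
    _ = x ⬝ᵥ x := Real.sq_sqrt h0

lemma dot_self_nonneg (x : R3) : 0 ≤ x ⬝ᵥ x := (sq_nonneg ‖x‖).trans (norm_sq_le_dot x)

lemma norm_le_one_of_unit {x : R3} (hx : x ⬝ᵥ x = 1) : ‖x‖ ≤ 1 := by
  have := norm_sq_le_dot x
  rw [hx] at this
  nlinarith [norm_nonneg x]

/-! ### Differentiation of rotated fields -/

lemma hasFDerivAt_rot {E : Type*} [NormedAddCommGroup E] [NormedSpace ℝ E] {a : E → ℝ}
    {W : E → R3} {A : E →L[ℝ] ℝ} {W' : E →L[ℝ] R3} {x : E} (ha : HasFDerivAt a A x)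
    (hW : HasFDerivAt W W' x) :
    HasFDerivAt (fun y => rot (a y) *ᵥ W y)
      (A.smulRight (rot (a x) *ᵥ (rotGen *ᵥ W x)) +
        (LinearMap.toContinuousLinearMap (Matrix.mulVecLin (rot (a x)))).comp W') x := by
  rw [hasFDerivAt_pi'] at hW ⊢
  have hc := ha.cos
  have hs := ha.sin
  intro i
  fin_cases i
  · have := (hc.mul (hW 0)).sub (hs.mul (hW 1))
    simp only [rot_mulVec]
    refine this.congr_fderiv ?_
    ext d
    simp [rot_mulVec, rotGen_mulVec]
    ring
  · have := (hs.mul (hW 0)).add (hc.mul (hW 1))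
    simp only [rot_mulVec]
    refine this.congr_fderiv ?_
    ext d
    simp [rot_mulVec, rotGen_mulVec]
    ring
  · have := hW 2
    simp only [rot_mulVec]
    refine this.congr_fderiv ?_
    ext d
    simp [rot_mulVec, rotGen_mulVec]

lemma hasDerivAt_rot {a : ℝ → ℝ} {W : ℝ → R3} {a' : ℝ} {W' : R3} {t : ℝ} (ha : HasDerivAt a a' t)
    (hW : HasDerivAt W W' t) :
    HasDerivAt (fun y => rot (a y) *ᵥ W y)
      (a' • rot (a t) *ᵥ (rotGen *ᵥ W t) + rot (a t) *ᵥ W') t := by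
  have := (hasFDerivAt_rot ha.hasFDerivAt hW.hasFDerivAt).hasDerivAt
  simpa using this

/-! ### Partial derivatives of equivariant maps in polar coordinates. -/

/-- Because m is an integer, the rotation depends on the angle only modulo 2π. This allows the
principal argument, which jumps on the negative axis, to be replaced by a smooth branch near any
nonzero point. -/
lemma rot_int_mul_two_pi (m : ℕ) (a : ℝ) (n : ℤ) : rot (m * (a + n * (2 * Real.pi))) =
    rot (m * a) := by
  have : m * (a + n * (2 * Real.pi)) = m * a + ((m * n : ℤ) : ℝ) * (2 * Real.pi) := by
    push_cast; ring
  simp only [rot, this, Real.cos_add_int_mul_two_pi, Real.sin_add_int_mul_two_pi]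

/-- Near a nonzero point, an equivariant map is given by a smooth branch of the angle. -/
lemma equivariantMap_eq_branch (m : ℕ) (w : ℝ → R3) {x y : ℂ} (hx : x ≠ 0) (hy : y ≠ 0) :
    equivariantMap m w y = rot (m * (x.arg + (Complex.log (y / x)).im)) *ᵥ w ‖y‖ := by
  have h := Complex.arg_mul_coe_angle hx (div_ne_zero hy hx)
  rw [mul_div_cancel₀ y hx, ← Real.Angle.coe_add, Real.Angle.angle_eq_iff_two_pi_dvd_sub] at h
  obtain ⟨k, hk⟩ := h
  have : y.arg = (x.arg + (y / x).arg) + k * (2 * Real.pi) := by linarith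
  rw [equivariantMap, this, rot_int_mul_two_pi, Complex.log_im]

lemma eventually_equivariantMap_eq_branch (m : ℕ) (w : ℝ → R3) {x : ℂ} (hx : x ≠ 0) :
    equivariantMap m w =ᶠ[𝓝 x]
      fun y => rot (m * (x.arg + (Complex.log (y / x)).im)) *ᵥ w ‖y‖ := by
  filter_upwards [isOpen_ne.mem_nhds hx] with y hy
  exact equivariantMap_eq_branch m w hx hy

lemma pd_equivariantMap (m : ℕ) {w : ℝ → R3} {x : ℂ} (hx : x ≠ 0)
    (hw : DifferentiableAt ℝ w ‖x‖) (j : Fin 2) :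
    pd j (equivariantMap m w) x = rot (m * x.arg) *ᵥ
      (((x.re * (dir j).re + x.im * (dir j).im) / ‖x‖) • deriv w ‖x‖ +
        (m * (dir j / x).im) • (rotGen *ᵥ w ‖x‖)) := by
  have hn : HasFDerivAt (fun y : ℂ => ‖y‖) (fderiv ℝ (fun y : ℂ => ‖y‖) x) x :=
    ((contDiffAt_norm ℝ hx (n := 1)).differentiableAt one_ne_zero).hasFDerivAt
  have hnd : fderiv ℝ (fun y : ℂ => ‖y‖) x (dir j) =
      (x.re * (dir j).re + x.im * (dir j).im) / ‖x‖ := by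
    -- The gradient of the norm is found by differentiating ‖y‖² in two ways.
    have h2 : HasFDerivAt (fun y : ℂ => ‖y‖ ^ 2) (2 • innerSL ℝ x) x :=
      (hasStrictFDerivAt_norm_sq x).hasFDerivAt
    have h3 := hn.pow 2
    have h4 := congrArg (fun L : ℂ →L[ℝ] ℝ => L (dir j)) (h2.unique h3)
    simp [Complex.inner] at h4
    have : ‖x‖ ≠ 0 := norm_ne_zero_iff.2 hx
    field_simp
    linarith
  have hl : HasFDerivAt (fun y : ℂ => (Complex.log (y / x)).im)
      (Complex.imCLM.comp ((ContinuousLinearMap.toSpanSingleton ℂ (x⁻¹ : ℂ)).restrictScalars ℝ)) x := by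
    have h1 : HasDerivAt (fun y : ℂ => Complex.log (y / x)) (x⁻¹) x := by
      have := ((hasDerivAt_id x).div_const x).clog (by simp [hx])
      simpa [hx] using this
    have h2 := h1.hasFDerivAt.restrictScalars ℝ
    exact Complex.imCLM.hasFDerivAt.comp x h2
  have ha : HasFDerivAt (fun y : ℂ => (m : ℝ) * (x.arg + (Complex.log (y / x)).im)) _ x :=
    (hl.const_add x.arg).const_mul (m : ℝ)
  have hW := hw.hasDerivAt.hasFDerivAt.comp x hn
  have := hasFDerivAt_rot ha hW
  rw [pd, (eventually_equivariantMap_eq_branch m w hx).fderiv_eq]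
  erw [this.fderiv]
  rw [Matrix.mulVec_add, Matrix.mulVec_smul, Matrix.mulVec_smul, ← hnd, add_comm]
  simp [hx, div_eq_mul_inv]


lemma pd_equivariantMap_explicit (m : ℕ) {w : ℝ → R3} {x : ℂ} (hx : x ≠ 0)
    (hw : DifferentiableAt ℝ w ‖x‖) :
    pd 0 (equivariantMap m w) x = rot (m * x.arg) *ᵥ ((x.re / ‖x‖) • deriv w ‖x‖ +
        (m / ‖x‖ * (-(x.im / ‖x‖))) • (rotGen *ᵥ w ‖x‖)) ∧
    pd 1 (equivariantMap m w) x = rot (m * x.arg) *ᵥ ((x.im / ‖x‖) • deriv w ‖x‖ +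
        (m / ‖x‖ * (x.re / ‖x‖)) • (rotGen *ᵥ w ‖x‖)) := by
  have hn : ‖x‖ ≠ 0 := norm_ne_zero_iff.2 hx
  rw [pd_equivariantMap m hx hw, pd_equivariantMap m hx hw]
  have h0 : (dir 0 / x).im = -x.im / ‖x‖ ^ 2 := by
    simp [dir, Complex.normSq_eq_norm_sq, neg_div]
  have h1 : (dir 1 / x).im = x.re / ‖x‖ ^ 2 := by
    simp [dir, Complex.div_im, Complex.normSq_eq_norm_sq]
  rw [h0, h1]
  constructor
  · congr 3
    · simp [dir]
    · field_simp
  · congr 3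
    · simp [dir]
    · field_simp

lemma re_sq_add_im_sq_div_norm {x : ℂ} (hx : x ≠ 0) : (x.re / ‖x‖) ^ 2 + (x.im / ‖x‖) ^ 2 = 1 := by
  have hn : ‖x‖ ≠ 0 := norm_ne_zero_iff.2 hx
  have := Complex.normSq_eq_norm_sq x
  rw [Complex.normSq_apply] at this
  field_simp
  linarith

/-- The coefficients of the radial and angular derivatives in the two coordinate directions form an
orthogonal matrix (c, -s; s, c), so the mixed terms cancel in the sum. -/
lemma sum_pd_dot_pd (m : ℕ) {w : ℝ → R3} {x : ℂ} (hx : x ≠ 0)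
    (hw : DifferentiableAt ℝ w ‖x‖) :
    ∑ j : Fin 2, pd j (equivariantMap m w) x ⬝ᵥ pd j (equivariantMap m w) x =
      deriv w ‖x‖ ⬝ᵥ deriv w ‖x‖ + (m / ‖x‖) ^ 2 * (w ‖x‖ 0 ^ 2 + w ‖x‖ 1 ^ 2) := by
  obtain ⟨h0, h1⟩ := pd_equivariantMap_explicit m hx hw
  have hc := re_sq_add_im_sq_div_norm hx
  rw [Fin.sum_univ_two, h0, h1, rot_dot_rot, rot_dot_rot]
  generalize x.re / ‖x‖ = c at hc ⊢
  generalize x.im / ‖x‖ = s at hc ⊢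
  generalize (m : ℝ) / ‖x‖ = p
  simp only [dot3, rotGen_mulVec, Pi.add_apply, Pi.smul_apply, smul_eq_mul, Matrix.cons_val]
  linear_combination (deriv w ‖x‖ 0 ^ 2 + deriv w ‖x‖ 1 ^ 2 + deriv w ‖x‖ 2 ^ 2 +
    p ^ 2 * (w ‖x‖ 0 ^ 2 + w ‖x‖ 1 ^ 2)) * hc

/-- The radial density of the pairing of the flux of the Schrödinger flow with a test field. -/
noncomputable def fluxDensity (m : ℕ) (v w : ℝ → R3) (r : ℝ) : ℝ :=
  (v r ⨯₃ deriv v r) ⬝ᵥ deriv w r + (m / r) ^ 2 * ((v r ⨯₃ (rotGen *ᵥ v r)) ⬝ᵥ (rotGen *ᵥ w r))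

/-- As in `sum_pd_dot_pd`, the mixed radial-angular terms cancel between the two directions. The
common rotation drops out since it preserves both products, so a radial quantity is left. -/
lemma sum_cross_pd_dot_pd (m : ℕ) {v w : ℝ → R3} {x : ℂ} (hx : x ≠ 0)
    (hv : DifferentiableAt ℝ v ‖x‖) (hw : DifferentiableAt ℝ w ‖x‖) :
    ∑ j : Fin 2, (equivariantMap m v x ⨯₃ pd j (equivariantMap m v) x) ⬝ᵥ
      pd j (equivariantMap m w) x = fluxDensity m v w ‖x‖ := by
  obtain ⟨h0, h1⟩ := pd_equivariantMap_explicit m hx hv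
  obtain ⟨k0, k1⟩ := pd_equivariantMap_explicit m hx hw
  have hc := re_sq_add_im_sq_div_norm hx
  rw [Fin.sum_univ_two, h0, h1, k0, k1, equivariantMap, rot_cross_rot, rot_cross_rot, rot_dot_rot,
    rot_dot_rot, fluxDensity]
  generalize x.re / ‖x‖ = c at hc ⊢
  generalize x.im / ‖x‖ = s at hc ⊢
  generalize (m : ℝ) / ‖x‖ = p
  generalize rotGen *ᵥ w ‖x‖ = Rw
  generalize rotGen *ᵥ v ‖x‖ = Rv
  generalize deriv w ‖x‖ = w'
  generalize deriv v ‖x‖ = v'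
  generalize v ‖x‖ = V
  have e : ∀ a b a' b' : ℝ, (V ⨯₃ (a • v' + b • Rv)) ⬝ᵥ (a' • w' + b' • Rw) =
      a * a' * ((V ⨯₃ v') ⬝ᵥ w') + a * b' * ((V ⨯₃ v') ⬝ᵥ Rw) + b * a' * ((V ⨯₃ Rv) ⬝ᵥ w') +
        b * b' * ((V ⨯₃ Rv) ⬝ᵥ Rw) := by
    intro a b a' b'
    rw [map_add, map_smul, map_smul]
    simp only [add_dotProduct, dotProduct_add, smul_dotProduct, dotProduct_smul, smul_eq_mul]
    ring
  rw [e, e]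
  linear_combination ((V ⨯₃ v') ⬝ᵥ w' + p ^ 2 * ((V ⨯₃ Rv) ⬝ᵥ Rw)) * hc

lemma equivariantMap_dot (m : ℕ) (v w : ℝ → R3) (x : ℂ) :
    equivariantMap m v x ⬝ᵥ equivariantMap m w x = v ‖x‖ ⬝ᵥ w ‖x‖ := by
  rw [equivariantMap, equivariantMap, rot_dot_rot]

lemma equivariantMap_sub (m : ℕ) (v w : ℝ → R3) :
    (fun x => equivariantMap m v x - equivariantMap m w x) =
      equivariantMap m (fun r => v r - w r) := by
  ext1 x
  rw [equivariantMap, equivariantMap, equivariantMap, Matrix.mulVec_sub]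

/-- The angle has no continuous branch at the origin; vanishing of the profile near 0 is what gives
regularity there. -/
lemma contDiff_equivariantMap (m : ℕ) {w : ℝ → R3} (hw : ContDiff ℝ 1 w) {a : ℝ} (ha : 0 < a)
    (hs : ∀ r < a, w r = 0) : ContDiff ℝ 1 (equivariantMap m w) := by
  rw [contDiff_iff_contDiffAt]
  intro x
  by_cases hx : x = 0
  · subst hx
    have : equivariantMap m w =ᶠ[𝓝 0] fun _ => 0 := by
      filter_upwards [Metric.ball_mem_nhds (0 : ℂ) ha] with y hy
      rw [equivariantMap, hs _ (by simpa using hy), Matrix.mulVec_zero]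
    exact contDiffAt_const.congr_of_eventuallyEq this
  · have hn : ContDiffAt ℝ 1 (fun y : ℂ => ‖y‖) x := contDiffAt_norm ℝ hx
    have hl : ContDiffAt ℝ 1 (fun y : ℂ => (m : ℝ) * (x.arg + (Complex.log (y / x)).im)) x := by
      have h1 : ContDiffAt ℂ 1 (fun y : ℂ => Complex.log (y / x)) x :=
        (Complex.contDiffAt_log (by simp [hx])).comp x (contDiffAt_id.div_const x)
      have h2 : ContDiffAt ℝ 1 (fun y : ℂ => (Complex.log (y / x)).im) x :=
        Complex.imCLM.contDiff.contDiffAt.comp x (h1.restrict_scalars ℝ)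
      exact contDiffAt_const.mul (contDiffAt_const.add h2)
    have hW : ContDiffAt ℝ 1 (fun y : ℂ => w ‖y‖) x := hw.contDiffAt.comp x hn
    rw [contDiffAt_pi] at hW
    refine ContDiffAt.congr_of_eventuallyEq ?_ (eventually_equivariantMap_eq_branch m w hx)
    rw [contDiffAt_pi]
    intro i
    simp only [rot_mulVec]
    fin_cases i
    · exact (hl.cos.mul (hW 0)).sub (hl.sin.mul (hW 1))
    · exact (hl.sin.mul (hW 0)).add (hl.cos.mul (hW 1))
    · exact hW 2

/-! ### Integrals of radial functions on the plane -/

lemma lintegral_radial {g : ℝ → ℝ≥0∞} (hg : AEMeasurable g (volume.restrict (Ioi (0 : ℝ)))) :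
    ∫⁻ x : ℂ, g ‖x‖ = ENNReal.ofReal (2 * Real.pi) * ∫⁻ r in Ioi (0 : ℝ), ENNReal.ofReal r * g r := by
  rw [← Complex.lintegral_comp_polarCoord_symm]
  have : ∫⁻ p in polarCoord.target, ENNReal.ofReal p.1 • g ‖Complex.polarCoord.symm p‖ =
      ∫⁻ p in Ioi (0 : ℝ) ×ˢ Ioo (-Real.pi) Real.pi, (ENNReal.ofReal p.1 * g p.1) * 1 := by
    rw [polarCoord_target]
    refine setLIntegral_congr_fun (measurableSet_Ioi.prod measurableSet_Ioo) fun p hp => ?_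
    have h : 0 < p.1 := hp.1
    simp only [Complex.norm_polarCoord_symm, abs_of_pos h, smul_eq_mul, mul_one]
  rw [this, Measure.volume_eq_prod, ← Measure.prod_restrict,
    lintegral_prod_mul (f := fun r => ENNReal.ofReal r * g r) (g := fun _ => 1)
      (by fun_prop) (by fun_prop), mul_comm]
  congr 1
  simp [← two_mul]

/-- Integration in polar coordinates of the indicator of a measurable null set of radii shows that
the set of points with such radii is null in the plane. -/
lemma ae_norm_of_ae {P : ℝ → Prop} (h : ∀ᵐ r ∂(volume.restrict (Ioi (0 : ℝ))), P r) :
    ∀ᵐ x : ℂ, P ‖x‖ := by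
  obtain ⟨N, hN, hNm, hN0⟩ := exists_measurable_superset_of_null (ae_iff.1 h)
  have h1 := lintegral_radial (g := N.indicator 1)
    ((measurable_one.indicator hNm).aemeasurable)
  have h2 : ∫⁻ r in Ioi (0 : ℝ), ENNReal.ofReal r * N.indicator 1 r = 0 := by
    rw [lintegral_eq_zero_iff (by fun_prop)]
    have : ∀ᵐ r ∂(volume.restrict (Ioi (0 : ℝ))), r ∉ N := measure_eq_zero_iff_ae_notMem.1 hN0
    filter_upwards [this] with r hr
    simp [hr]
  rw [h2, mul_zero, lintegral_eq_zero_iff (by fun_prop)] at h1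
  filter_upwards [h1] with x hx
  by_contra hP
  have : ‖x‖ ∈ N := hN hP
  simp [this] at hx

lemma integral_radial (f : ℝ → ℝ) :
    ∫ x : ℂ, f ‖x‖ = 2 * Real.pi * ∫ r in Ioi (0 : ℝ), f r * r := by
  rw [integral_fun_norm_addHaar]
  simp [Measure.real, mul_comm, mul_assoc, mul_left_comm]

/-! ### Locally absolutely continuous functions on the half line -/

/-- Local absolute continuity on `(0, ∞)`. -/
def LocAC {E : Type*} [PseudoMetricSpace E] (f : ℝ → E) : Prop :=
  ∀ a b, 0 < a → a ≤ b → AbsolutelyContinuousOnInterval f a b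

/-- The half line is exhausted by the countably many intervals [1/(n+1), n+1]. -/
lemma ae_Ioi_of_Icc {P : ℝ → Prop}
    (h : ∀ a b, 0 < a → a ≤ b → ∀ᵐ x : ℝ, x ∈ uIcc a b → P x) :
    ∀ᵐ r ∂(volume.restrict (Ioi (0 : ℝ))), P r := by
  rw [ae_restrict_iff' measurableSet_Ioi]
  have : ∀ᵐ x : ℝ, ∀ n : ℕ, x ∈ uIcc (1 / ((n : ℝ) + 1)) (n + 1) → P x := by
    rw [ae_all_iff]
    intro n
    refine h _ _ (by positivity) ?_
    have hn : (0 : ℝ) ≤ n := n.cast_nonneg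
    exact (div_le_one (by positivity)).2 (by linarith) |>.trans (by linarith)
  filter_upwards [this] with x hx hx0
  obtain ⟨n, hn⟩ := exists_nat_gt x
  obtain ⟨k, hk⟩ := exists_nat_one_div_lt (show 0 < x from hx0)
  refine hx (max n k) ?_
  have h1 : (n : ℝ) ≤ (max n k : ℕ) := by exact_mod_cast le_max_left _ _
  have h2 : (k : ℝ) ≤ (max n k : ℕ) := by exact_mod_cast le_max_right _ _
  refine Icc_subset_uIcc ⟨?_, by linarith⟩
  refine le_trans ?_ hk.le
  exact one_div_le_one_div_of_le (by positivity) (by linarith)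

namespace LocAC

variable {E : Type*} [NormedAddCommGroup E]

lemma continuousOn {f : ℝ → E} (hf : LocAC f) : ContinuousOn f (Ioi 0) := by
  intro x hx
  have hx' : 0 < x := hx
  have h1 : x / 2 ≤ x + 1 := by linarith
  have h2 : ContinuousOn f (Icc (x / 2) (x + 1)) := by
    rw [← uIcc_of_le h1]
    exact (hf _ _ (half_pos hx') h1).continuousOn
  have h3 : Icc (x / 2) (x + 1) ∈ 𝓝 x := Icc_mem_nhds (by linarith) (by linarith)
  exact (h2.continuousAt h3).continuousWithinAt

lemma continuousOn_Icc {f : ℝ → E} (hf : LocAC f) {a b : ℝ} (ha : 0 < a) :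
    ContinuousOn f (Icc a b) :=
  hf.continuousOn.mono fun _ hx => lt_of_lt_of_le ha hx.1

lemma apply {v : ℝ → R3} (hv : LocAC v) (i : Fin 3) : LocAC fun r => v r i := by
  intro a b ha hab
  have := (absolutelyContinuousOnInterval_iff _ _ _).1 (hv a b ha hab)
  rw [absolutelyContinuousOnInterval_iff]
  intro ε hε
  obtain ⟨δ, hδ, h⟩ := this ε hε
  refine ⟨δ, hδ, fun e he hs => lt_of_le_of_lt ?_ (h e he hs)⟩
  exact Finset.sum_le_sum fun k _ => dist_le_pi_dist _ _ i

lemma sub {f g : ℝ → ℝ} (hf : LocAC f) (hg : LocAC g) : LocAC fun r => f r - g r :=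
  fun a b ha hab => (hf a b ha hab).sub (hg a b ha hab)

lemma sub_pi {f g : ℝ → R3} (hf : LocAC f) (hg : LocAC g) : LocAC fun r => f r - g r :=
  fun a b ha hab => (hf a b ha hab).sub (hg a b ha hab)

lemma mul {f g : ℝ → ℝ} (hf : LocAC f) (hg : LocAC g) : LocAC fun r => f r * g r :=
  fun a b ha hab => (hf a b ha hab).mul (hg a b ha hab)

lemma const_mul {f : ℝ → ℝ} (c : ℝ) (hf : LocAC f) : LocAC fun r => c * f r :=
  fun a b ha hab => (hf a b ha hab).const_mul c

lemma of_contDiffOn {E : Type*} [NormedAddCommGroup E] [NormedSpace ℝ E] {f : ℝ → E}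
    (hf : ContDiffOn ℝ 1 f (Ioi 0)) : LocAC f := fun a b ha hab =>
  ContDiffOn.absolutelyContinuousOnInterval
    (hf.mono fun x hx => by rw [uIcc_of_le hab] at hx; exact lt_of_lt_of_le ha hx.1)

lemma comp_mul_left {f : ℝ → E} (hf : LocAC f) {s : ℝ} (hs : 0 < s) :
    LocAC fun r => f (s * r) := by
  intro a b ha hab
  have := (absolutelyContinuousOnInterval_iff _ _ _).1
    (hf (s * a) (s * b) (by positivity) (by gcongr))
  rw [absolutelyContinuousOnInterval_iff]
  intro ε hε
  obtain ⟨δ, hδ, h⟩ := this ε hε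
  refine ⟨δ / s, by positivity, fun e he hsum => ?_⟩
  refine h (e.1, fun i => (s * (e.2 i).1, s * (e.2 i).2)) ⟨?_, ?_⟩ ?_
  · intro i hi
    have := he.1 i hi
    rw [uIcc_of_le hab, mem_Icc, mem_Icc] at this
    rw [uIcc_of_le (by gcongr), mem_Icc, mem_Icc]
    obtain ⟨⟨h1, h2⟩, h3, h4⟩ := this
    exact ⟨⟨mul_le_mul_of_nonneg_left h1 hs.le, mul_le_mul_of_nonneg_left h2 hs.le⟩,
      mul_le_mul_of_nonneg_left h3 hs.le, mul_le_mul_of_nonneg_left h4 hs.le⟩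
  · intro i hi j hj hij
    have := he.2 hi hj hij
    rw [Function.onFun, Set.disjoint_left] at this ⊢
    have key : ∀ {x y u : ℝ}, u ∈ uIoc (s * x) (s * y) → u / s ∈ uIoc x y := by
      intro x y u hu
      rw [mem_uIoc] at hu ⊢
      rw [lt_div_iff₀ hs, div_le_iff₀ hs, lt_div_iff₀ hs, div_le_iff₀ hs]
      simpa only [mul_comm] using hu
    exact fun u hu hu' => this (key hu) (key hu')
  · have : ∀ i, dist (s * (e.2 i).1) (s * (e.2 i).2) = s * dist (e.2 i).1 (e.2 i).2 := by
      intro i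
      rw [Real.dist_eq, Real.dist_eq, ← mul_sub, abs_mul, abs_of_pos hs]
    simp only [this]
    rw [← Finset.mul_sum]
    rwa [lt_div_iff₀ hs, mul_comm] at hsum

lemma ae_differentiableAt {f : ℝ → ℝ} (hf : LocAC f) :
    ∀ᵐ r ∂(volume.restrict (Ioi (0 : ℝ))), DifferentiableAt ℝ f r :=
  ae_Ioi_of_Icc fun a b ha hab => (hf a b ha hab).ae_differentiableAt

lemma ae_differentiableAt_pi {v : ℝ → R3} (hv : LocAC v) :
    ∀ᵐ r ∂(volume.restrict (Ioi (0 : ℝ))), DifferentiableAt ℝ v r := by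
  have := fun i => (hv.apply i).ae_differentiableAt
  rw [← ae_all_iff] at this
  filter_upwards [this] with r hr
  exact differentiableAt_pi.2 hr

lemma aestronglyMeasurable {E : Type*} [NormedAddCommGroup E] [SecondCountableTopology E]
    {f : ℝ → E} (hf : LocAC f) :
    AEStronglyMeasurable f (volume.restrict (Ioi (0 : ℝ))) :=
  hf.continuousOn.aestronglyMeasurable measurableSet_Ioi

lemma integral_deriv {f : ℝ → ℝ} (hf : LocAC f) {a b : ℝ} (ha : 0 < a) (hab : a ≤ b) :
    ∫ x in a..b, deriv f x = f b - f a := (hf a b ha hab).integral_deriv_eq_sub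

lemma intervalIntegrable_deriv {f : ℝ → ℝ} (hf : LocAC f) {a b : ℝ} (ha : 0 < a) (hab : a ≤ b) :
    IntervalIntegrable (deriv f) volume a b := (hf a b ha hab).intervalIntegrable_deriv

/-- A locally absolutely continuous function vanishing at both ends of the half line has a
derivative of mean zero. -/
lemma integral_Ioi_deriv_eq_zero {f : ℝ → ℝ} (hf : LocAC f) (h0 : Tendsto f (𝓝[>] 0) (𝓝 0))
    (hi : Tendsto f atTop (𝓝 0)) (hint : IntegrableOn (deriv f) (Ioi 0)) :
    ∫ r in Ioi (0 : ℝ), deriv f r = 0 := by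
  have ha : Tendsto (fun n : ℕ => 1 / ((n : ℝ) + 1)) atTop (𝓝 0) :=
    tendsto_one_div_add_atTop_nhds_zero_nat
  have ha' : Tendsto (fun n : ℕ => 1 / ((n : ℝ) + 1)) atTop (𝓝[>] 0) :=
    tendsto_nhdsWithin_iff.2 ⟨ha, Eventually.of_forall fun n => by
      show (0 : ℝ) < 1 / ((n : ℝ) + 1); positivity⟩
  have hb : Tendsto (fun n : ℕ => (n : ℝ) + 1) atTop atTop :=
    tendsto_atTop_add_const_right _ _ tendsto_natCast_atTop_atTop
  have hcov := aecover_Ioi_of_Ioi (μ := volume) (A := (0 : ℝ)) ha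
  have h1 : Tendsto (fun n : ℕ => ∫ x in (1 / ((n : ℝ) + 1))..((n : ℝ) + 1), deriv f x) atTop
      (𝓝 (∫ r in Ioi (0 : ℝ), deriv f r)) := by
    have h2 : Tendsto (fun n : ℕ => ∫ x in Ioc 0 ((n : ℝ) + 1), deriv f x) atTop
        (𝓝 (∫ r in Ioi (0 : ℝ), deriv f r)) := by
      have := intervalIntegral_tendsto_integral_Ioi 0 hint hb
      refine this.congr fun n => ?_
      rw [intervalIntegral.integral_of_le (by positivity)]
    -- Integrability up to 0 makes the primitive continuous there, so the piece next to the origin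
    -- contributes nothing in the limit.
    have h3 : Tendsto (fun n : ℕ => ∫ x in (0 : ℝ)..(1 / ((n : ℝ) + 1)), deriv f x) atTop (𝓝 0) := by
      have hii : IntegrableOn (deriv f) (Icc 0 1) := by
        rw [integrableOn_Icc_iff_integrableOn_Ioc]
        exact hint.mono_set Ioc_subset_Ioi_self
      have hc : ContinuousWithinAt (fun x => ∫ t in (0 : ℝ)..x, deriv f t) (Icc 0 1) 0 :=
        intervalIntegral.continuousOn_primitive_interval (by rwa [uIcc_of_le zero_le_one]) 0
          (by simp) |>.mono (by rw [uIcc_of_le zero_le_one])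
      have h4 : Tendsto (fun x => ∫ t in (0 : ℝ)..x, deriv f t) (𝓝[Icc 0 1] 0) (𝓝 0) := by
        have := hc.tendsto
        rwa [intervalIntegral.integral_same] at this
      refine h4.comp (tendsto_nhdsWithin_iff.2 ⟨ha, Eventually.of_forall fun n => ⟨by positivity, ?_⟩⟩)
      exact (div_le_one (by positivity)).2 (by linarith [(n.cast_nonneg : (0 : ℝ) ≤ n)])
    have h5 := h2.sub h3
    rw [sub_zero] at h5
    refine h5.congr fun n => ?_
    have hn : (0 : ℝ) ≤ n := n.cast_nonneg
    have hle : 1 / ((n : ℝ) + 1) ≤ (n : ℝ) + 1 :=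
      ((div_le_one (by positivity)).2 (by linarith)).trans (by linarith)
    have hI : ∀ a b : ℝ, 0 ≤ a → 0 ≤ b → IntervalIntegrable (deriv f) volume a b := fun a b ha hb =>
      intervalIntegrable_iff.2 (hint.mono_set fun x hx => lt_of_le_of_lt (le_min ha hb) hx.1)
    rw [← intervalIntegral.integral_of_le (by positivity),
      ← intervalIntegral.integral_add_adjacent_intervals (hI 0 (1 / ((n : ℝ) + 1)) le_rfl
        (by positivity)) (hI _ _ (by positivity) (by positivity))]
    ring
  have h6 : Tendsto (fun n : ℕ => f ((n : ℝ) + 1) - f (1 / ((n : ℝ) + 1))) atTop (𝓝 (0 - 0)) :=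
    (hi.comp hb).sub (h0.comp ha')
  rw [sub_zero] at h6
  refine tendsto_nhds_unique h1 (h6.congr fun n => ?_)
  have hn : (0 : ℝ) ≤ n := n.cast_nonneg
  exact (hf.integral_deriv (by positivity)
    (((div_le_one (by positivity)).2 (by linarith)).trans (by linarith))).symm

/-- A function vanishing at the origin is bounded by its scale invariant energy. -/
lemma sq_le_integral {f : ℝ → ℝ} (hf : LocAC f) (h0 : Tendsto f (𝓝[>] 0) (𝓝 0))
    {g : ℝ → ℝ} (hg : IntegrableOn g (Ioi 0))
    (hfg : ∀ᵐ r ∂(volume.restrict (Ioi (0 : ℝ))), deriv f r ^ 2 * r + f r ^ 2 / r ≤ g r)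
    {r : ℝ} (hr : 0 < r) : f r ^ 2 ≤ ∫ x in Ioi (0 : ℝ), g x := by
  have hg0 : ∀ᵐ x ∂(volume.restrict (Ioi (0 : ℝ))), 0 ≤ g x := by
    filter_upwards [hfg, ae_restrict_mem measurableSet_Ioi] with x hx (hx0 : 0 < x)
    exact le_trans (by positivity) hx
  have h1 : ∀ ε, 0 < ε → ε ≤ r → f r ^ 2 ≤ f ε ^ 2 + ∫ x in Ioi (0 : ℝ), g x := by
    intro ε hε hεr
    have h2 := (hf ε r hε hεr).integral_deriv_mul_eq_sub (hf ε r hε hεr)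
    have h3 : ∫ x in ε..r, (deriv f x * f x + f x * deriv f x) ≤ ∫ x in ε..r, g x := by
      refine intervalIntegral.integral_mono_ae_restrict hεr ?_ ?_ ?_
      · have hd := (hf ε r hε hεr).intervalIntegrable_deriv
        have hc := (hf ε r hε hεr).continuousOn
        exact (hd.mul_continuousOn hc).add (hd.continuousOn_mul hc)
      · rw [intervalIntegrable_iff, uIoc_of_le hεr]
        exact hg.mono_set fun x hx => hε.trans hx.1
      · have hsub : Icc ε r ⊆ Ioi 0 := fun x hx => hε.trans_le hx.1
        filter_upwards [ae_restrict_of_ae_restrict_of_subset hsub hfg,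
          ae_restrict_mem measurableSet_Icc] with x hx hxm
        have hx0 : 0 < x := hsub hxm
        refine le_trans ?_ hx
        -- Completing the square: (f²)' = 2ff' is at most f'²x + f²/x.
        have : deriv f x ^ 2 * x + f x ^ 2 / x - (deriv f x * f x + f x * deriv f x) =
            (deriv f x * x - f x) ^ 2 / x := by field_simp; ring
        have h : 0 ≤ (deriv f x * x - f x) ^ 2 / x := by positivity
        linarith
    have h4 : ∫ x in ε..r, g x ≤ ∫ x in Ioi (0 : ℝ), g x := by
      rw [intervalIntegral.integral_of_le hεr]
      exact setIntegral_mono_set hg hg0 (Eventually.of_forall fun x hx => hε.trans hx.1)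
    nlinarith [h2]
  have h5 : Tendsto (fun ε => f ε ^ 2 + ∫ x in Ioi (0 : ℝ), g x) (𝓝[>] 0)
      (𝓝 (0 ^ 2 + ∫ x in Ioi (0 : ℝ), g x)) := (h0.pow 2).add_const _
  have h6 := ge_of_tendsto h5 (b := f r ^ 2) (by
    filter_upwards [Ioc_mem_nhdsGT hr] with ε hε
    exact h1 ε hε.1 hε.2)
  simpa using h6

/-- The oscillation of a function is controlled by its Dirichlet energy. -/
lemma abs_sub_le_of_integral_le {f : ℝ → ℝ} (hf : LocAC f) {g : ℝ → ℝ}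
    (hg : IntegrableOn g (Ioi 0))
    (hfg : ∀ᵐ r ∂(volume.restrict (Ioi (0 : ℝ))), deriv f r ^ 2 * r ≤ g r)
    {η : ℝ} (hη : 0 < η) (hgη : ∫ x in Ioi (0 : ℝ), g x ≤ η ^ 2) {a b : ℝ} (ha : 0 < a)
    (hab : a ≤ b) : |f b - f a| ≤ η * (b / a) := by
  have hg0 : ∀ᵐ x ∂(volume.restrict (Ioi (0 : ℝ))), 0 ≤ g x := by
    filter_upwards [hfg, ae_restrict_mem measurableSet_Ioi] with x hx (hx0 : 0 < x)
    exact le_trans (by positivity) hx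
  have hgi : IntervalIntegrable g volume a b := by
    rw [intervalIntegrable_iff, uIoc_of_le hab]
    exact hg.mono_set fun x hx => ha.trans hx.1
  have hsub : Icc a b ⊆ Ioi 0 := fun x hx => ha.trans_le hx.1
  rw [← hf.integral_deriv ha hab]
  calc |∫ x in a..b, deriv f x| ≤ ∫ x in a..b, |deriv f x| :=
        intervalIntegral.abs_integral_le_integral_abs hab
    _ ≤ ∫ x in a..b, (η⁻¹ * g x + η / a) := by
        refine intervalIntegral.integral_mono_ae_restrict hab
          (hf.intervalIntegrable_deriv ha hab).abs
          ((hgi.const_mul _).add intervalIntegrable_const) ?_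
        filter_upwards [ae_restrict_of_ae_restrict_of_subset hsub hfg,
          ae_restrict_mem measurableSet_Icc] with x hx hxm
        have hx0 : 0 < x := hsub hxm
        -- Young's inequality weighted by η. Over [a, b] the first term contributes at most η and
        -- the second at most η(b/a - 1), which add up to η b/a.
        have h1 : |deriv f x| ≤ η⁻¹ * (deriv f x ^ 2 * x) + η / x := by
          have h2 : η⁻¹ * (deriv f x ^ 2 * x) + η / x - |deriv f x| =
              ((|deriv f x| * x - η / 2) ^ 2 + 3 / 4 * η ^ 2) / (η * x) := by
            rw [← sq_abs (deriv f x)]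
            field_simp
            ring
          have : 0 ≤ ((|deriv f x| * x - η / 2) ^ 2 + 3 / 4 * η ^ 2) / (η * x) := by positivity
          linarith
        have h2 : η / x ≤ η / a := div_le_div_of_nonneg_left hη.le ha hxm.1
        have h3 : η⁻¹ * (deriv f x ^ 2 * x) ≤ η⁻¹ * g x := by gcongr
        linarith
    _ = η⁻¹ * (∫ x in a..b, g x) + (b - a) * (η / a) := by
        rw [intervalIntegral.integral_add (hgi.const_mul _) intervalIntegrable_const,
          intervalIntegral.integral_const_mul, intervalIntegral.integral_const, smul_eq_mul]
    _ ≤ η⁻¹ * η ^ 2 + (b - a) * (η / a) := by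
        gcongr
        refine le_trans ?_ hgη
        rw [intervalIntegral.integral_of_le hab]
        exact setIntegral_mono_set hg hg0 (Eventually.of_forall fun x hx => ha.trans hx.1)
    _ = η * (b / a) := by field_simp; ring

end LocAC

/-! ### The energy of an equivariant map -/

/-- The radial energy density. -/
noncomputable def radialDensity (m : ℕ) (w : ℝ → R3) (r : ℝ) : ℝ :=
  (deriv w r ⬝ᵥ deriv w r + (m / r) ^ 2 * (w r 0 ^ 2 + w r 1 ^ 2)) * r

/-- The radial energy. -/
noncomputable def radialEnergy (m : ℕ) (w : ℝ → R3) : ℝ :=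
  ∫ r in Ioi (0 : ℝ), radialDensity m w r

lemma radialDensity_nonneg (m : ℕ) (w : ℝ → R3) {r : ℝ} (hr : 0 < r) : 0 ≤ radialDensity m w r := by
  have := dot_self_nonneg (deriv w r)
  unfold radialDensity
  positivity

lemma measurable_dot_deriv (w : ℝ → R3) : Measurable fun r => deriv w r ⬝ᵥ deriv w r := by
  have h := measurable_deriv w
  have h' : ∀ i, Measurable fun r => deriv w r i := fun i => (measurable_pi_apply i).comp h
  simp only [dot3]
  exact (((h' 0).mul (h' 0)).add ((h' 1).mul (h' 1))).add ((h' 2).mul (h' 2))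

lemma aemeasurable_radialDensity (m : ℕ) {w : ℝ → R3} (hw : LocAC w) :
    AEMeasurable (radialDensity m w) (volume.restrict (Ioi (0 : ℝ))) := by
  have h' : ∀ i, AEMeasurable (fun r => w r i) (volume.restrict (Ioi (0 : ℝ))) := fun i =>
    (hw.apply i).aestronglyMeasurable.aemeasurable
  have := measurable_dot_deriv w
  unfold radialDensity
  have h0 := h' 0
  have h1 := h' 1
  fun_prop

lemma energy_equivariantMap (m : ℕ) {w : ℝ → R3} (hw : LocAC w) :
    energy (equivariantMap m w) =
      ENNReal.ofReal Real.pi * ∫⁻ r in Ioi (0 : ℝ), ENNReal.ofReal (radialDensity m w r) := by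
  have h1 : ∫⁻ x : ℂ, ENNReal.ofReal (∑ j : Fin 2, pd j (equivariantMap m w) x ⬝ᵥ
      pd j (equivariantMap m w) x) = ∫⁻ x : ℂ, ENNReal.ofReal (radialDensity m w ‖x‖ / ‖x‖) := by
    refine lintegral_congr_ae ?_
    have hne : ∀ᵐ x : ℂ, x ≠ 0 := by
      simp [ae_iff, measure_singleton]
    filter_upwards [ae_norm_of_ae hw.ae_differentiableAt_pi, hne] with x hx hx0
    rw [sum_pd_dot_pd m hx0 hx, radialDensity, mul_div_cancel_right₀ _ (norm_ne_zero_iff.2 hx0)]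
  have hm := aemeasurable_radialDensity m hw
  rw [energy, h1, lintegral_radial (g := fun r => ENNReal.ofReal (radialDensity m w r / r))
    (by fun_prop), ← mul_assoc]
  congr 1
  · rw [ENNReal.ofReal_mul (by norm_num), ← mul_assoc]
    simp [ENNReal.inv_mul_cancel]
  · refine setLIntegral_congr_fun measurableSet_Ioi fun r (hr : 0 < r) => ?_
    rw [← ENNReal.ofReal_mul hr.le, mul_div_cancel₀ _ hr.ne']

lemma radialEnergy_eq_toReal (m : ℕ) {w : ℝ → R3} (hw : LocAC w) :
    radialEnergy m w = (energy (equivariantMap m w)).toReal / Real.pi := by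
  rw [energy_equivariantMap m hw, ENNReal.toReal_mul, ENNReal.toReal_ofReal Real.pi_pos.le,
    mul_div_cancel_left₀ _ Real.pi_ne_zero, radialEnergy, integral_eq_lintegral_of_nonneg_ae]
  · exact (ae_restrict_iff' measurableSet_Ioi).2
      (Eventually.of_forall fun r hr => radialDensity_nonneg m w hr)
  · exact (aemeasurable_radialDensity m hw).aestronglyMeasurable

lemma integrableOn_radialDensity (m : ℕ) {w : ℝ → R3} (hw : LocAC w)
    (hE : energy (equivariantMap m w) < ∞) : IntegrableOn (radialDensity m w) (Ioi 0) := by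
  refine ⟨(aemeasurable_radialDensity m hw).aestronglyMeasurable, ?_⟩
  rw [hasFiniteIntegral_iff_ofReal ((ae_restrict_iff' measurableSet_Ioi).2
      (Eventually.of_forall fun r hr => radialDensity_nonneg m w hr))]
  rw [energy_equivariantMap m hw] at hE
  exact ENNReal.lt_top_of_mul_ne_top_right hE.ne (by simp [Real.pi_pos])

lemma norm_deriv_sq_le_radialDensity (m : ℕ) (w : ℝ → R3) {r : ℝ} (hr : 0 < r) :
    ‖deriv w r‖ ^ 2 * r ≤ radialDensity m w r := by
  have := norm_sq_le_dot (deriv w r)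
  unfold radialDensity
  gcongr
  have : 0 ≤ (m / r) ^ 2 * (w r 0 ^ 2 + w r 1 ^ 2) := by positivity
  linarith

lemma integrableOn_norm_deriv_sq (m : ℕ) {w : ℝ → R3}
    (hE : IntegrableOn (radialDensity m w) (Ioi 0)) :
    IntegrableOn (fun r => ‖deriv w r‖ ^ 2 * r) (Ioi 0) := by
  refine hE.mono' ?_ ?_
  · have := measurable_deriv w
    exact (by fun_prop : Measurable fun r => ‖deriv w r‖ ^ 2 * r).aestronglyMeasurable
  · refine (ae_restrict_iff' measurableSet_Ioi).2 (Eventually.of_forall fun r (hr : 0 < r) => ?_)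
    rw [Real.norm_eq_abs, abs_of_nonneg (by positivity)]
    exact norm_deriv_sq_le_radialDensity m w hr

/-! ### Convergence of profiles -/

lemma ae_deriv_apply {w : ℝ → R3} (hw : LocAC w) :
    ∀ᵐ r ∂(volume.restrict (Ioi (0 : ℝ))), ∀ i, deriv (fun x => w x i) r = deriv w r i := by
  filter_upwards [hw.ae_differentiableAt_pi] with r hr i
  exact (hasDerivAt_pi.1 hr.hasDerivAt i).deriv

lemma IsSigmaProfile.locAC {m : ℕ} {v : ℝ → R3} (hv : IsSigmaProfile m v) : LocAC v := hv.absCont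

/-- Convergence in energy of profiles implies pointwise convergence, quantitatively. -/
lemma IsSigmaProfile.exists_norm_sub_le {m : ℕ} (hm : 1 ≤ m) {v : ℝ → R3}
    (hv : IsSigmaProfile m v) {r : ℝ} (hr : 0 < r) :
    ∃ C : ℝ, 0 < C ∧ ∀ u : ℝ → R3, IsSigmaProfile m u →
      IntegrableOn (radialDensity m fun x => u x - v x) (Ioi 0) → ∀ η : ℝ, 0 < η →
      radialEnergy m (fun x => u x - v x) ≤ η ^ 2 → ‖u r - v r‖ ≤ C * η := by
  have hk := ((continuous_apply (2 : Fin 3)).tendsto _).comp hv.tendsto_zero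
  have hk' := ((continuous_apply (2 : Fin 3)).tendsto _).comp hv.tendsto_infty
  have e1 : (-kHat) 2 = -1 := by simp [kHat]
  have e2 : kHat 2 = 1 := by simp [kHat]
  rw [e1] at hk
  rw [e2] at hk'
  -- The boundary values at 0 and ∞ provide radii a ≤ b at which the third component of v lies below
  -- -1/2 and above 1/2. They depend on v only, and so does the constant built from them.
  obtain ⟨a, ha2, ha1 : 0 < a, ha⟩ := ((hk.eventually (gt_mem_nhds (by norm_num : (-1 : ℝ) < -1 / 2))).and
    ((eventually_mem_nhdsWithin).and (Ioc_mem_nhdsGT (zero_lt_one (α := ℝ))))).exists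
  obtain ⟨b, hb1, hb⟩ := ((hk'.eventually (lt_mem_nhds (by norm_num : (1 : ℝ) / 2 < 1))).and
    (eventually_ge_atTop a)).exists
  simp only [Function.comp_apply] at ha2 hb1
  have hm' : (1 : ℝ) ≤ m := by exact_mod_cast hm
  have hb0 : 0 < b := ha1.trans_le hb
  have hmax : 0 < max (r / a) (a / r) := lt_max_of_lt_left (by positivity)
  have hba : 0 < b / a := by positivity
  refine ⟨4 + 3 * (b / a) + max (r / a) (a / r), by positivity, fun u hu hint η hη hE => ?_⟩
  have hw := hu.locAC.sub_pi hv.locAC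
  set w : ℝ → R3 := fun x => u x - v x with hwdef
  have hw0 : Tendsto w (𝓝[>] 0) (𝓝 0) := by
    have := hu.tendsto_zero.sub hv.tendsto_zero
    rwa [sub_self] at this
  have hvn : ∀ x, 0 < x → ‖v x‖ ≤ 1 := fun x hx => norm_le_one_of_unit (hv.unit x hx.le)
  have hun : ∀ x, 0 < x → ‖u x‖ ≤ 1 := fun x hx => norm_le_one_of_unit (hu.unit x hx.le)
  have hdot : ∀ x, 0 < x → ∀ i : Fin 3, deriv w x i ^ 2 ≤ deriv w x ⬝ᵥ deriv w x := by
    intro x hx i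
    rw [dot3]
    fin_cases i <;> simp <;> nlinarith [mul_self_nonneg (deriv w x 0),
      mul_self_nonneg (deriv w x 1), mul_self_nonneg (deriv w x 2)]
  have hhor : ∀ i : Fin 3, i ≠ 2 → ∀ x, 0 < x → |w x i| ≤ η := by
    intro i hi x hx
    have h1 := (hw.apply i).sq_le_integral (((continuous_apply i).tendsto _).comp hw0) hint
      (by
        filter_upwards [ae_deriv_apply hw, ae_restrict_mem measurableSet_Ioi] with y hy (hy0 : 0 < y)
        rw [hy i, radialDensity, add_mul]
        refine add_le_add (mul_le_mul_of_nonneg_right (hdot y hy0 i) hy0.le) ?_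
        have e : (m / y) ^ 2 * (w y 0 ^ 2 + w y 1 ^ 2) * y =
            m ^ 2 * (w y 0 ^ 2 + w y 1 ^ 2) / y := by field_simp
        rw [e]
        gcongr
        have hm2 : (1 : ℝ) ≤ m ^ 2 := one_le_pow₀ hm'
        have : w y i ^ 2 ≤ w y 0 ^ 2 + w y 1 ^ 2 := by
          fin_cases i
          · simp; positivity
          · simp; positivity
          · exact absurd rfl hi
        nlinarith [sq_nonneg (w y 0), sq_nonneg (w y 1)]) hx
    exact abs_le_of_sq_le_sq (h1.trans hE) hη.le
  have hosc : ∀ x y, 0 < x → x ≤ y → |w y 2 - w x 2| ≤ η * (y / x) := by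
    intro x y hx hxy
    refine (hw.apply 2).abs_sub_le_of_integral_le hint ?_ hη hE hx hxy
    filter_upwards [ae_deriv_apply hw, ae_restrict_mem measurableSet_Ioi] with y hy (hy0 : 0 < y)
    rw [hy 2, radialDensity]
    have : 0 ≤ (m / y) ^ 2 * (w y 0 ^ 2 + w y 1 ^ 2) := by positivity
    exact mul_le_mul_of_nonneg_right (by linarith [hdot y hy0 2]) hy0.le
  -- Since u and v are both unit vectors, the product w₃(2v₃ + w₃) is controlled by the horizontal
  -- components. This forces w₃ to be close to 0 or to -2v₃, and the second alternative has to be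
  -- excluded.
  have hprod : ∀ x, 0 < x → |w x 2 * (2 * v x 2 + w x 2)| ≤ 4 * η := by
    intro x hx
    have h1 := hu.unit x hx.le
    have h2 := hv.unit x hx.le
    rw [dot3] at h1 h2
    have e : w x 2 * (2 * v x 2 + w x 2) =
        -(w x 0 * (v x 0 + u x 0)) - w x 1 * (v x 1 + u x 1) := by
      simp only [hwdef, Pi.sub_apply]
      linear_combination h1 - h2
    have hb : ∀ i : Fin 3, i ≠ 2 → |w x i * (v x i + u x i)| ≤ 2 * η := by
      intro i hi
      rw [abs_mul]
      have h3 : |v x i + u x i| ≤ 2 := (abs_add_le _ _).trans (by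
        linarith [(abs_apply_le_norm (v x) i).trans (hvn x hx),
          (abs_apply_le_norm (u x) i).trans (hun x hx)])
      nlinarith [hhor i hi x hx, abs_nonneg (w x i), abs_nonneg (v x i + u x i)]
    rw [e]
    refine (abs_sub _ _).trans ?_
    rw [abs_neg]
    linarith [hb 0 (by decide), hb 1 (by decide)]
  have hwle : ∀ x, 0 < x → |w x 2| ≤ 2 := by
    intro x hx
    refine (abs_sub _ _).trans ?_
    linarith [(abs_apply_le_norm (v x) 2).trans (hvn x hx),
      (abs_apply_le_norm (u x) 2).trans (hun x hx)]
  have hc : |w a 2| ≤ η * (4 + 3 * (b / a)) := by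
    have h1 := hosc a b ha1 hb
    have h2 := hprod a ha1
    have h3 := hprod b hb0
    have h4 : |(w b 2 - w a 2) * (2 * v b 2 + w a 2 + w b 2)| ≤ η * (b / a) * 6 := by
      rw [abs_mul]
      refine mul_le_mul h1 ?_ (abs_nonneg _) (by positivity)
      refine (abs_add_three _ _ _).trans ?_
      rw [abs_mul, abs_two]
      linarith [(abs_apply_le_norm (v b) 2).trans (hvn b hb0), hwle a ha1, hwle b hb0]
    -- Comparison of the product at a and at b: w₃ changes little between them, whereas v₃ increases
    -- by more than 1. The identity therefore isolates w₃(a) with a factor bounded below, which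
    -- rules out the root -2v₃.
    have h5 : w a 2 * (2 * (v b 2 - v a 2)) = w b 2 * (2 * v b 2 + w b 2) -
        w a 2 * (2 * v a 2 + w a 2) - (w b 2 - w a 2) * (2 * v b 2 + w a 2 + w b 2) := by ring
    have h6 : |w a 2 * (2 * (v b 2 - v a 2))| ≤ 8 * η + η * (b / a) * 6 := by
      rw [h5]
      refine (abs_sub _ _).trans (le_trans (add_le_add_left (abs_sub _ _) _) ?_)
      linarith
    rw [abs_mul, abs_of_nonneg (by linarith : 0 ≤ 2 * (v b 2 - v a 2))] at h6
    nlinarith [abs_nonneg (w a 2)]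
  have h2r : |w r 2| ≤ (4 + 3 * (b / a) + max (r / a) (a / r)) * η := by
    have h1 : |w r 2 - w a 2| ≤ η * max (r / a) (a / r) := by
      rcases le_total a r with h | h
      · exact (hosc a r ha1 h).trans (by gcongr; exact le_max_left _ _)
      · rw [abs_sub_comm]
        exact (hosc r a hr h).trans (by gcongr; exact le_max_right _ _)
    have h2 : |w r 2| ≤ |w r 2 - w a 2| + |w a 2| := by
      have := abs_add_le (w r 2 - w a 2) (w a 2)
      rwa [sub_add_cancel] at this
    linarith
  have hone : η ≤ (4 + 3 * (b / a) + max (r / a) (a / r)) * η := by nlinarith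
  rw [pi_norm_le_iff_of_nonneg (by positivity)]
  intro i
  fin_cases i
  · exact (hhor 0 (by decide) r hr).trans hone
  · exact (hhor 1 (by decide) r hr).trans hone
  · exact h2r

/-- A family of profiles that is continuous for the energy distance. -/
structure IsEnergyContinuous (m : ℕ) (I : Set ℝ) (v : ℝ → ℝ → R3) : Prop where
  profile : ∀ t ∈ I, IsSigmaProfile m (v t)
  tendsto_energy : ∀ t ∈ I,
    Tendsto (fun τ => energy (equivariantMap m fun r => v τ r - v t r)) (𝓝[I] t) (𝓝 0)

namespace IsEnergyContinuous

variable {m : ℕ} {I : Set ℝ} {v : ℝ → ℝ → R3}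

lemma eventually_radialEnergy_le (hv : IsEnergyContinuous m I v) {t : ℝ} (ht : t ∈ I) {η : ℝ}
    (hη : 0 < η) : ∀ᶠ τ in 𝓝[I] t,
      IntegrableOn (radialDensity m fun r => v τ r - v t r) (Ioi 0) ∧
      radialEnergy m (fun r => v τ r - v t r) ≤ η ^ 2 := by
  have h1 := (hv.tendsto_energy t ht).eventually (gt_mem_nhds (ENNReal.zero_lt_top))
  have h2 : Tendsto (fun τ => (energy (equivariantMap m fun r => v τ r - v t r)).toReal / Real.pi)
      (𝓝[I] t) (𝓝 0) := by
    have := ((ENNReal.tendsto_toReal ENNReal.zero_ne_top).comp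
      (hv.tendsto_energy t ht)).div_const Real.pi
    simpa using this
  filter_upwards [h1, h2.eventually (gt_mem_nhds (by positivity : (0 : ℝ) < η ^ 2)),
    self_mem_nhdsWithin] with τ h3 h4 hτ
  have hac := (hv.profile τ hτ).locAC.sub_pi (hv.profile t ht).locAC
  exact ⟨integrableOn_radialDensity m hac h3, by rw [radialEnergy_eq_toReal m hac]; exact h4.le⟩

lemma tendsto_apply (hm : 1 ≤ m) (hv : IsEnergyContinuous m I v) {t : ℝ} (ht : t ∈ I) {r : ℝ}
    (hr : 0 < r) : Tendsto (fun τ => v τ r) (𝓝[I] t) (𝓝 (v t r)) := by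
  obtain ⟨C, hC, h⟩ := (hv.profile t ht).exists_norm_sub_le hm hr
  rw [Metric.tendsto_nhds]
  intro ε hε
  filter_upwards [hv.eventually_radialEnergy_le ht (by positivity : 0 < ε / (2 * C)),
    self_mem_nhdsWithin] with τ h1 hτ
  rw [dist_eq_norm]
  refine lt_of_le_of_lt (h (v τ) (hv.profile τ hτ) h1.1 _ (by positivity) h1.2) ?_
  field_simp
  linarith

end IsEnergyContinuous

/-! ### Bounds for `h₁` -/

lemma pow_le_pow_add_one {r : ℝ} (hr : 0 ≤ r) {j n : ℕ} (hj : j ≤ n) : r ^ j ≤ r ^ n + 1 := by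
  rcases le_total r 1 with h | h
  · have := pow_le_one₀ hr h (n := j)
    have := pow_nonneg hr n
    linarith
  · have := pow_le_pow_right₀ h hj
    linarith

lemma h1_pos (m : ℕ) {r : ℝ} (hr : 0 < r) : 0 < h1 m r := by unfold h1; positivity

lemma h1_nonneg (m : ℕ) {r : ℝ} (hr : 0 ≤ r) : 0 ≤ h1 m r := by unfold h1; positivity

lemma h1_sq_add_h3_sq (m : ℕ) {r : ℝ} (hr : 0 ≤ r) : h1 m r ^ 2 + h3 m r ^ 2 = 1 := by
  have : r ^ (2 * m) + 1 ≠ 0 := by positivity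
  unfold h1 h3
  field_simp
  ring

lemma h1_le_one (m : ℕ) {r : ℝ} (hr : 0 ≤ r) : h1 m r ≤ 1 := by
  nlinarith [h1_sq_add_h3_sq m hr, sq_nonneg (h3 m r), sq_nonneg (h1 m r - 1)]

lemma abs_h3_le_one (m : ℕ) {r : ℝ} (hr : 0 ≤ r) : |h3 m r| ≤ 1 :=
  abs_le_one_iff_mul_self_le_one.2 (by nlinarith [h1_sq_add_h3_sq m hr, sq_nonneg (h1 m r)])

lemma continuous_h1 (m : ℕ) : Continuous (h1 m) := by
  unfold h1
  refine Continuous.div (by fun_prop) (by fun_prop) fun r => ?_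
  have : 0 ≤ r ^ (2 * m) := by rw [pow_mul]; positivity
  positivity

lemma continuous_h3 (m : ℕ) : Continuous (h3 m) := by
  unfold h3
  refine Continuous.div (by fun_prop) (by fun_prop) fun r => ?_
  have : 0 ≤ r ^ (2 * m) := by rw [pow_mul]; positivity
  positivity

lemma h1_mul_pow_le {m j : ℕ} (hj : m + j ≤ 2 * m) {r : ℝ} (hr : 0 < r) : h1 m r * r ^ j ≤ 2 := by
  have h := pow_le_pow_add_one hr.le hj
  have hp : 0 < r ^ (2 * m) + 1 := by positivity
  rw [h1, div_mul_eq_mul_div, div_le_iff₀ hp, mul_assoc, ← pow_add]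
  linarith

lemma h1_div_pow_le {m j : ℕ} (hj : j ≤ m) {r : ℝ} (hr : 0 < r) : h1 m r / r ^ j ≤ 2 := by
  have h := pow_le_pow_add_one hr.le (show m - j ≤ 2 * m by omega)
  have hp : 0 < r ^ (2 * m) + 1 := by positivity
  have e : r ^ m = r ^ (m - j) * r ^ j := by rw [← pow_add, Nat.sub_add_cancel hj]
  rw [h1, e, div_div, ← mul_assoc, mul_div_mul_right _ _ (by positivity), div_le_iff₀ hp]
  linarith

/-- The majorant 1/(1 + r²) reduces every integrability question about powers of h₁ to pointwise
bounds on products of h₁ with powers of r. -/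
lemma integrableOn_of_abs_le {f : ℝ → ℝ}
    (hf : AEStronglyMeasurable f (volume.restrict (Ioi (0 : ℝ)))) (C : ℝ)
    (h : ∀ r, 0 < r → |f r| * (1 + r ^ 2) ≤ C) : IntegrableOn f (Ioi 0) := by
  refine Integrable.mono' (integrable_inv_one_add_sq.const_mul C).integrableOn hf ?_
  refine (ae_restrict_iff' measurableSet_Ioi).2 (Eventually.of_forall fun r hr => ?_)
  rw [Real.norm_eq_abs, ← div_eq_mul_inv, le_div_iff₀ (by positivity)]
  exact h r hr

lemma integrableOn_h1_mul {m : ℕ} (hm : 3 ≤ m) : IntegrableOn (fun r => h1 m r * r) (Ioi 0) := by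
  have hc := continuous_h1 m
  refine integrableOn_of_abs_le (by fun_prop) 4 fun r hr => ?_
  have h0 := h1_pos m hr
  rw [abs_of_pos (by positivity)]
  have k1 := h1_mul_pow_le (m := m) (j := 1) (by omega) hr
  have k3 := h1_mul_pow_le (m := m) (j := 3) (by omega) hr
  nlinarith

lemma integrableOn_h1_div {m : ℕ} (hm : 1 ≤ m) : IntegrableOn (fun r => h1 m r / r) (Ioi 0) := by
  have hc := continuous_h1 m
  have : Measurable fun r => h1 m r / r := hc.measurable.div measurable_id
  refine integrableOn_of_abs_le this.aestronglyMeasurable 4 fun r hr => ?_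
  have h0 := h1_pos m hr
  rw [abs_of_pos (by positivity)]
  have k1 := h1_div_pow_le (m := m) (j := 1) (by omega) hr
  have k3 := h1_mul_pow_le (m := m) (j := 1) (by omega) hr
  have e : h1 m r / r * (1 + r ^ 2) = h1 m r / r ^ 1 + h1 m r * r ^ 1 := by field_simp
  rw [e]
  linarith

/-! ### Pairing with test profiles -/

/-- Test profiles decaying like `h₁`, with quantitative constant. -/
structure Decays (m : ℕ) (C : ℝ) (w : ℝ → R3) : Prop where
  contDiffOn : ContDiffOn ℝ 1 w (Ioi 0)
  norm_le : ∀ r, 0 < r → ‖w r‖ ≤ C * h1 m r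
  norm_deriv_le : ∀ r, 0 < r → ‖deriv w r‖ ≤ C * (h1 m r / r)

lemma Decays.nonneg {m : ℕ} {C : ℝ} {w : ℝ → R3} (hw : Decays m C w) : 0 ≤ C := by
  by_contra h
  have h1 := hw.norm_le 1 one_pos
  nlinarith [norm_nonneg (w 1), h1_pos m one_pos]

lemma Decays.locAC {m : ℕ} {C : ℝ} {w : ℝ → R3} (hw : Decays m C w) : LocAC w :=
  LocAC.of_contDiffOn hw.contDiffOn

/-- The pairing `∫ v · w r dr`. -/
noncomputable def pairing (v w : ℝ → R3) : ℝ := ∫ r in Ioi (0 : ℝ), (v r ⬝ᵥ w r) * r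

/-- The flux of the profile `V`, with `p` in place of the derivative of `V`. -/
noncomputable def mixedDensity (m : ℕ) (V p w : ℝ → R3) (r : ℝ) : ℝ :=
  (V r ⨯₃ p r) ⬝ᵥ deriv w r + (m / r) ^ 2 * ((V r ⨯₃ (rotGen *ᵥ V r)) ⬝ᵥ (rotGen *ᵥ w r))

/-- The radial form of the flux term in the weak formulation. -/
noncomputable def flux (m : ℕ) (v w : ℝ → R3) : ℝ :=
  ∫ r in Ioi (0 : ℝ), fluxDensity m v w r * r

lemma continuous_dot : Continuous fun p : R3 × R3 => p.1 ⬝ᵥ p.2 := by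
  simp only [dot3]
  fun_prop

lemma continuous_cross : Continuous fun p : R3 × R3 => p.1 ⨯₃ p.2 := by
  simp only [cross3]
  refine continuous_pi fun i => ?_
  fin_cases i <;> simp <;> fun_prop

lemma continuous_rotGen : Continuous fun x : R3 => rotGen *ᵥ x := by
  simp only [rotGen_mulVec]
  refine continuous_pi fun i => ?_
  fin_cases i <;> simp <;> fun_prop

lemma aestronglyMeasurable_dot {μ : Measure ℝ} {f g : ℝ → R3} (hf : AEStronglyMeasurable f μ)
    (hg : AEStronglyMeasurable g μ) : AEStronglyMeasurable (fun r => f r ⬝ᵥ g r) μ :=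
  continuous_dot.comp_aestronglyMeasurable (hf.prodMk hg)

lemma aestronglyMeasurable_cross {μ : Measure ℝ} {f g : ℝ → R3} (hf : AEStronglyMeasurable f μ)
    (hg : AEStronglyMeasurable g μ) : AEStronglyMeasurable (fun r => f r ⨯₃ g r) μ :=
  continuous_cross.comp_aestronglyMeasurable (hf.prodMk hg)

lemma aestronglyMeasurable_rotGen {μ : Measure ℝ} {f : ℝ → R3} (hf : AEStronglyMeasurable f μ) :
    AEStronglyMeasurable (fun r => rotGen *ᵥ f r) μ :=
  continuous_rotGen.comp_aestronglyMeasurable hf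

lemma aestronglyMeasurable_deriv' {μ : Measure ℝ} (f : ℝ → R3) :
    AEStronglyMeasurable (deriv f) μ :=
  (measurable_deriv f).aestronglyMeasurable

lemma abs_pairing_integrand_le {m : ℕ} {C : ℝ} {x y : R3} {r : ℝ} (hr : 0 < r) (hx : ‖x‖ ≤ 1)
    (hy : ‖y‖ ≤ C * h1 m r) : ‖(x ⬝ᵥ y) * r‖ ≤ 3 * C * (h1 m r * r) := by
  rw [Real.norm_eq_abs, abs_mul, abs_of_pos hr, ← mul_assoc, mul_assoc 3]
  gcongr
  refine (abs_dot_le x y).trans ?_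
  have : ‖x‖ * ‖y‖ ≤ 1 * (C * h1 m r) := mul_le_mul hx hy (norm_nonneg _) zero_le_one
  linarith

lemma integrableOn_pairing {m : ℕ} (hm : 3 ≤ m) {V w : ℝ → R3} {C : ℝ}
    (hVm : AEStronglyMeasurable V (volume.restrict (Ioi (0 : ℝ))))
    (hwm : AEStronglyMeasurable w (volume.restrict (Ioi (0 : ℝ))))
    (hV : ∀ r, 0 < r → ‖V r‖ ≤ 1) (hw : ∀ r, 0 < r → ‖w r‖ ≤ C * h1 m r) :
    IntegrableOn (fun r => (V r ⬝ᵥ w r) * r) (Ioi 0) := by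
  refine Integrable.mono' ((integrableOn_h1_mul hm).const_mul (3 * C))
    ((aestronglyMeasurable_dot hVm hwm).mul (by fun_prop)) ?_
  refine (ae_restrict_iff' measurableSet_Ioi).2 (Eventually.of_forall fun r hr => ?_)
  exact abs_pairing_integrand_le hr (hV r hr) (hw r hr)

lemma tendsto_pairing {m : ℕ} (hm : 3 ≤ m) {ι : Type*} {l : Filter ι} [l.IsCountablyGenerated]
    {V w : ι → ℝ → R3} {V0 w0 : ℝ → R3} {C : ℝ}
    (hVm : ∀ᶠ i in l, AEStronglyMeasurable (V i) (volume.restrict (Ioi (0 : ℝ))))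
    (hwm : ∀ᶠ i in l, AEStronglyMeasurable (w i) (volume.restrict (Ioi (0 : ℝ))))
    (hVb : ∀ᶠ i in l, ∀ r, 0 < r → ‖V i r‖ ≤ 1)
    (hwb : ∀ᶠ i in l, ∀ r, 0 < r → ‖w i r‖ ≤ C * h1 m r)
    (hV : ∀ r, 0 < r → Tendsto (fun i => V i r) l (𝓝 (V0 r)))
    (hw : ∀ r, 0 < r → Tendsto (fun i => w i r) l (𝓝 (w0 r))) :
    Tendsto (fun i => pairing (V i) (w i)) l (𝓝 (pairing V0 w0)) := by
  refine tendsto_integral_filter_of_dominated_convergence (fun r => 3 * C * (h1 m r * r))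
    ?_ ?_ ((integrableOn_h1_mul hm).const_mul (3 * C)) ?_
  · filter_upwards [hVm, hwm] with i h1 h2
    exact (aestronglyMeasurable_dot h1 h2).mul (by fun_prop)
  · filter_upwards [hVb, hwb] with i h1 h2
    refine (ae_restrict_iff' measurableSet_Ioi).2 (Eventually.of_forall fun r hr => ?_)
    exact abs_pairing_integrand_le hr (h1 r hr) (h2 r hr)
  · refine (ae_restrict_iff' measurableSet_Ioi).2 (Eventually.of_forall fun r hr => ?_)
    exact ((continuous_dot.tendsto (V0 r, w0 r)).comp
      ((hV r hr).prodMk_nhds (hw r hr))).mul_const r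

/-! ### Bounds and continuity of the flux -/

lemma abs_cross_dot_le (x p q : R3) (hx : ‖x‖ ≤ 1) : |(x ⨯₃ p) ⬝ᵥ q| ≤ 6 * (‖p‖ * ‖q‖) := by
  refine (abs_dot_le _ _).trans ?_
  have h1 := norm_cross_le x p
  have h2 : ‖x‖ * ‖p‖ ≤ 1 * ‖p‖ := mul_le_mul_of_nonneg_right hx (norm_nonneg _)
  have h3 : ‖x ⨯₃ p‖ * ‖q‖ ≤ 2 * ‖p‖ * ‖q‖ := by
    gcongr
    linarith
  linarith

/-- Young's inequality separates p, which is only square integrable, from q, which decays. One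
factor h₁ ≤ 1 is discarded. The free parameter η makes the whole bound of order η when the weighted
L² norm of p is at most η, which is how `continuousOn_flux` uses it. -/
lemma abs_cross_dot_mul_le {m : ℕ} {C : ℝ} {x p q : R3} {r η : ℝ} (hr : 0 < r)
    (hη : 0 < η) (hx : ‖x‖ ≤ 1) (hq : ‖q‖ ≤ C * (h1 m r / r)) :
    |((x ⨯₃ p) ⬝ᵥ q) * r| ≤ 3 * η⁻¹ * (‖p‖ ^ 2 * r) + 3 * η * C ^ 2 * (h1 m r / r) := by
  rw [abs_mul, abs_of_pos hr]
  have k1 := abs_cross_dot_le x p q hx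
  have h2 : 6 * (‖p‖ * ‖q‖) * r ≤ 3 * η⁻¹ * (‖p‖ ^ 2 * r) + 3 * η * (‖q‖ ^ 2 * r) := by
    have e : 3 * η⁻¹ * (‖p‖ ^ 2 * r) + 3 * η * (‖q‖ ^ 2 * r) - 6 * (‖p‖ * ‖q‖) * r =
        3 * η⁻¹ * (‖p‖ - η * ‖q‖) ^ 2 * r := by field_simp; ring
    have : 0 ≤ 3 * η⁻¹ * (‖p‖ - η * ‖q‖) ^ 2 * r := by positivity
    linarith
  have h3 : ‖q‖ ^ 2 * r ≤ C ^ 2 * (h1 m r / r) := by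
    have h4 := h1_le_one m hr.le
    have h5 := h1_pos m hr
    calc ‖q‖ ^ 2 * r ≤ (C * (h1 m r / r)) ^ 2 * r := by gcongr
      _ = C ^ 2 * (h1 m r / r) * h1 m r := by field_simp
      _ ≤ C ^ 2 * (h1 m r / r) * 1 := by gcongr
      _ = _ := mul_one _
  calc |(x ⨯₃ p) ⬝ᵥ q| * r ≤ 6 * (‖p‖ * ‖q‖) * r := by gcongr
    _ ≤ _ := h2
    _ ≤ 3 * η⁻¹ * (‖p‖ ^ 2 * r) + 3 * η * (C ^ 2 * (h1 m r / r)) := by gcongr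
    _ = _ := by ring

lemma abs_angular_mul_le {m : ℕ} {C : ℝ} {x y : R3} {r : ℝ} (hr : 0 < r) (hx : ‖x‖ ≤ 1)
    (hy : ‖y‖ ≤ C * h1 m r) :
    |(m / r) ^ 2 * ((x ⨯₃ (rotGen *ᵥ x)) ⬝ᵥ (rotGen *ᵥ y)) * r| ≤
      6 * m ^ 2 * C * (h1 m r / r) := by
  have h2 : |(x ⨯₃ (rotGen *ᵥ x)) ⬝ᵥ (rotGen *ᵥ y)| ≤ 6 * (C * h1 m r) := by
    refine (abs_cross_dot_le _ _ _ hx).trans ?_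
    have := mul_le_mul ((norm_rotGen_le x).trans hx) ((norm_rotGen_le y).trans hy)
      (norm_nonneg _) zero_le_one
    linarith
  rw [abs_mul, abs_mul, abs_of_pos hr, abs_of_nonneg (by positivity)]
  calc (m / r) ^ 2 * |(x ⨯₃ (rotGen *ᵥ x)) ⬝ᵥ (rotGen *ᵥ y)| * r
      ≤ (m / r) ^ 2 * (6 * (C * h1 m r)) * r := by gcongr
    _ = _ := by field_simp

/-- Constant in the bound of the flux. -/
noncomputable def fluxConst (m : ℕ) (C : ℝ) : ℝ := 3 * C ^ 2 + 6 * m ^ 2 * C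

lemma abs_mixedDensity_mul_le {m : ℕ} {C : ℝ} {V p w : ℝ → R3} (hw : Decays m C w) {r : ℝ}
    (hr : 0 < r) (hV : ‖V r‖ ≤ 1) :
    ‖mixedDensity m V p w r * r‖ ≤ 3 * (‖p r‖ ^ 2 * r) + fluxConst m C * (h1 m r / r) := by
  have h1 := abs_cross_dot_mul_le (p := p r) hr one_pos hV (hw.norm_deriv_le r hr)
  have h2 := abs_angular_mul_le hr hV (hw.norm_le r hr)
  rw [mixedDensity, add_mul, fluxConst, add_mul, Real.norm_eq_abs]
  refine (abs_add_le _ _).trans ?_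
  rw [inv_one, mul_one] at h1
  linarith

lemma aestronglyMeasurable_mixedDensity (m : ℕ) {V p w : ℝ → R3}
    (hV : AEStronglyMeasurable V (volume.restrict (Ioi (0 : ℝ))))
    (hp : AEStronglyMeasurable p (volume.restrict (Ioi (0 : ℝ))))
    (hw : AEStronglyMeasurable w (volume.restrict (Ioi (0 : ℝ)))) :
    AEStronglyMeasurable (fun r => mixedDensity m V p w r * r)
      (volume.restrict (Ioi (0 : ℝ))) := by
  have h1 := aestronglyMeasurable_dot (aestronglyMeasurable_cross hV hp)
    (aestronglyMeasurable_deriv' w)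
  have h2 := aestronglyMeasurable_dot
    (aestronglyMeasurable_cross hV (aestronglyMeasurable_rotGen hV)) (aestronglyMeasurable_rotGen hw)
  have h3 : AEStronglyMeasurable (fun r : ℝ => ((m : ℝ) / r) ^ 2)
      (volume.restrict (Ioi (0 : ℝ))) :=
    (by fun_prop : Measurable fun r : ℝ => ((m : ℝ) / r) ^ 2).aestronglyMeasurable
  exact (h1.add (h3.mul h2)).mul (by fun_prop)

lemma integrableOn_mixedDensity {m : ℕ} (hm : 1 ≤ m) {C : ℝ} {V p w : ℝ → R3} (hw : Decays m C w)
    (hVm : AEStronglyMeasurable V (volume.restrict (Ioi (0 : ℝ))))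
    (hpm : AEStronglyMeasurable p (volume.restrict (Ioi (0 : ℝ))))
    (hV : ∀ r, 0 < r → ‖V r‖ ≤ 1) (hp : IntegrableOn (fun r => ‖p r‖ ^ 2 * r) (Ioi 0)) :
    IntegrableOn (fun r => mixedDensity m V p w r * r) (Ioi 0) := by
  refine Integrable.mono' ((hp.const_mul 3).add
    ((integrableOn_h1_div hm).const_mul (fluxConst m C)))
    (aestronglyMeasurable_mixedDensity m hVm hpm hw.locAC.aestronglyMeasurable) ?_
  refine (ae_restrict_iff' measurableSet_Ioi).2 (Eventually.of_forall fun r hr => ?_)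
  exact abs_mixedDensity_mul_le hw hr (hV r hr)

lemma abs_integral_mixedDensity_le {m : ℕ} (hm : 1 ≤ m) {C : ℝ} {V p w : ℝ → R3}
    (hw : Decays m C w)
    (hV : ∀ r, 0 < r → ‖V r‖ ≤ 1) (hp : IntegrableOn (fun r => ‖p r‖ ^ 2 * r) (Ioi 0)) :
    |∫ r in Ioi (0 : ℝ), mixedDensity m V p w r * r| ≤
      3 * (∫ r in Ioi (0 : ℝ), ‖p r‖ ^ 2 * r) + fluxConst m C * ∫ r in Ioi (0 : ℝ), h1 m r / r := by
  have hi := (integrableOn_h1_div hm).const_mul (fluxConst m C)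
  have h := norm_integral_le_of_norm_le (f := fun r => mixedDensity m V p w r * r)
    ((hp.const_mul 3).add hi) ?_
  · rw [integral_add' (hp.const_mul 3) hi, integral_const_mul, integral_const_mul] at h
    exact h
  · refine (ae_restrict_iff' measurableSet_Ioi).2 (Eventually.of_forall fun r hr => ?_)
    exact abs_mixedDensity_mul_le hw hr (hV r hr)

lemma fluxDensity_eq_mixedDensity (m : ℕ) (v w : ℝ → R3) :
    fluxDensity m v w = mixedDensity m v (deriv v) w := rfl

namespace IsSigmaProfile

variable {m : ℕ} {v : ℝ → R3}

lemma norm_le_one (hv : IsSigmaProfile m v) : ∀ r, 0 < r → ‖v r‖ ≤ 1 := fun r hr =>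
  norm_le_one_of_unit (hv.unit r hr.le)

lemma aesm (hv : IsSigmaProfile m v) :
    AEStronglyMeasurable v (volume.restrict (Ioi (0 : ℝ))) := hv.locAC.aestronglyMeasurable

lemma integrableOn_deriv (hv : IsSigmaProfile m v) :
    IntegrableOn (fun r => ‖deriv v r‖ ^ 2 * r) (Ioi 0) :=
  integrableOn_norm_deriv_sq m (integrableOn_radialDensity m hv.locAC hv.finite_energy)

lemma integrableOn_fluxDensity (hm : 1 ≤ m) (hv : IsSigmaProfile m v) {C : ℝ} {w : ℝ → R3}
    (hw : Decays m C w) : IntegrableOn (fun r => fluxDensity m v w r * r) (Ioi 0) :=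
  integrableOn_mixedDensity hm hw hv.aesm (aestronglyMeasurable_deriv' v) hv.norm_le_one
    hv.integrableOn_deriv

lemma abs_flux_le (hm : 1 ≤ m) (hv : IsSigmaProfile m v) {C : ℝ} {w : ℝ → R3}
    (hw : Decays m C w) : |flux m v w| ≤
      3 * (∫ r in Ioi (0 : ℝ), ‖deriv v r‖ ^ 2 * r) +
        fluxConst m C * ∫ r in Ioi (0 : ℝ), h1 m r / r :=
  abs_integral_mixedDensity_le hm hw hv.norm_le_one hv.integrableOn_deriv

end IsSigmaProfile

namespace IsEnergyContinuous

variable {m : ℕ} {I : Set ℝ} {v : ℝ → ℝ → R3}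

lemma continuousOn_pairing (hm : 3 ≤ m) (hv : IsEnergyContinuous m I v) {C : ℝ} {w : ℝ → R3}
    (hw : Decays m C w) : ContinuousOn (fun t => pairing (v t) w) I := by
  intro t ht
  refine tendsto_pairing hm (C := C) ?_ (Eventually.of_forall fun _ => hw.locAC.aestronglyMeasurable)
    ?_ (Eventually.of_forall fun _ => hw.norm_le)
    (fun r hr => hv.tendsto_apply (by omega) ht hr) (fun r _ => tendsto_const_nhds)
  · filter_upwards [self_mem_nhdsWithin] with τ hτ using (hv.profile τ hτ).aesm
  · filter_upwards [self_mem_nhdsWithin] with τ hτ using (hv.profile τ hτ).norm_le_one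

lemma eventually_integral_deriv_sub_le (hv : IsEnergyContinuous m I v) {t : ℝ} (ht : t ∈ I) {η : ℝ}
    (hη : 0 < η) : ∀ᶠ τ in 𝓝[I] t,
      IntegrableOn (fun r => ‖deriv (v τ) r - deriv (v t) r‖ ^ 2 * r) (Ioi 0) ∧
      ∫ r in Ioi (0 : ℝ), ‖deriv (v τ) r - deriv (v t) r‖ ^ 2 * r ≤ η ^ 2 := by
  filter_upwards [hv.eventually_radialEnergy_le ht hη, self_mem_nhdsWithin] with τ h hτ
  have hae : ∀ᵐ r ∂(volume.restrict (Ioi (0 : ℝ))),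
      ‖deriv (fun x => v τ x - v t x) r‖ ^ 2 * r = ‖deriv (v τ) r - deriv (v t) r‖ ^ 2 * r := by
    filter_upwards [(hv.profile τ hτ).locAC.ae_differentiableAt_pi,
      (hv.profile t ht).locAC.ae_differentiableAt_pi] with r h1 h2
    have e : deriv (fun x => v τ x - v t x) r = deriv (v τ) r - deriv (v t) r :=
      (h1.hasDerivAt.sub h2.hasDerivAt).deriv
    rw [e]
  have hi := integrableOn_norm_deriv_sq m h.1
  refine ⟨hi.congr hae, ?_⟩
  rw [← integral_congr_ae hae]
  refine le_trans ?_ h.2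
  refine setIntegral_mono_on hi h.1 measurableSet_Ioi fun r hr => ?_
  exact norm_deriv_sq_le_radialDensity m _ hr

/-- As τ tends to t, v converges pointwise but its derivative only in the energy norm. So the
derivative is first frozen at time t, where dominated convergence applies; the remaining term is
linear in the difference of the derivatives and is estimated by Young's inequality. -/
lemma continuousOn_flux (hm : 1 ≤ m) (hv : IsEnergyContinuous m I v) {C : ℝ} {w : ℝ → R3}
    (hw : Decays m C w) : ContinuousOn (fun t => flux m (v t) w) I := by
  intro t ht
  have hvt := hv.profile t ht
  have k1 : Tendsto (fun τ => ∫ r in Ioi (0 : ℝ), mixedDensity m (v τ) (deriv (v t)) w r * r)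
      (𝓝[I] t) (𝓝 (flux m (v t) w)) := by
    refine tendsto_integral_filter_of_dominated_convergence
      (fun r => 3 * (‖deriv (v t) r‖ ^ 2 * r) + fluxConst m C * (h1 m r / r)) ?_ ?_
      ((hvt.integrableOn_deriv.const_mul 3).add
        ((integrableOn_h1_div hm).const_mul (fluxConst m C))) ?_
    · filter_upwards [self_mem_nhdsWithin] with τ hτ
      exact aestronglyMeasurable_mixedDensity m (hv.profile τ hτ).aesm
        (aestronglyMeasurable_deriv' _) hw.locAC.aestronglyMeasurable
    · filter_upwards [self_mem_nhdsWithin] with τ hτ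
      refine (ae_restrict_iff' measurableSet_Ioi).2 (Eventually.of_forall fun r hr => ?_)
      exact abs_mixedDensity_mul_le hw hr ((hv.profile τ hτ).norm_le_one r hr)
    · refine (ae_restrict_iff' measurableSet_Ioi).2 (Eventually.of_forall fun r hr => ?_)
      have hp := hv.tendsto_apply hm ht hr
      rw [fluxDensity_eq_mixedDensity]
      unfold mixedDensity
      have c : Continuous fun x : R3 => ((x ⨯₃ deriv (v t) r) ⬝ᵥ deriv w r +
          (m / r) ^ 2 * ((x ⨯₃ (rotGen *ᵥ x)) ⬝ᵥ (rotGen *ᵥ w r))) * r := by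
        simp only [dot3, cross3, rotGen_mulVec, Matrix.cons_val]
        fun_prop
      exact (c.tendsto _).comp hp
  have h2 : Tendsto (fun τ => flux m (v τ) w -
      ∫ r in Ioi (0 : ℝ), mixedDensity m (v τ) (deriv (v t)) w r * r) (𝓝[I] t) (𝓝 0) := by
    set J := ∫ r in Ioi (0 : ℝ), h1 m r / r
    have hJ : 0 ≤ J := setIntegral_nonneg measurableSet_Ioi fun r (hr : 0 < r) =>
      div_nonneg (h1_nonneg m hr.le) hr.le
    rw [Metric.tendsto_nhds]
    intro ε hε
    -- Chosen so that the final bound η(3 + 3C²J) equals ε/2.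
    set η := ε / (2 * (3 + 3 * C ^ 2 * J)) with hη
    have hη0 : 0 < η := by positivity
    filter_upwards [hv.eventually_integral_deriv_sub_le ht hη0, self_mem_nhdsWithin] with τ h hτ
    have hvτ := hv.profile τ hτ
    have e : flux m (v τ) w - ∫ r in Ioi (0 : ℝ), mixedDensity m (v τ) (deriv (v t)) w r * r =
        ∫ r in Ioi (0 : ℝ), ((v τ r ⨯₃ (deriv (v τ) r - deriv (v t) r)) ⬝ᵥ deriv w r) * r := by
      rw [flux, ← integral_sub (hvτ.integrableOn_fluxDensity hm hw)
        (integrableOn_mixedDensity hm hw hvτ.aesm (aestronglyMeasurable_deriv' _)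
          hvτ.norm_le_one hvt.integrableOn_deriv)]
      refine integral_congr_ae (Eventually.of_forall fun r => ?_)
      simp only [fluxDensity, mixedDensity, map_sub, sub_dotProduct]
      ring
    rw [dist_zero_right, e]
    have hi := (integrableOn_h1_div hm).const_mul (3 * η * C ^ 2)
    have hi' := h.1.const_mul (3 * η⁻¹)
    refine lt_of_le_of_lt (norm_integral_le_of_norm_le (hi'.add hi) ?_) ?_
    · refine (ae_restrict_iff' measurableSet_Ioi).2 (Eventually.of_forall fun r hr => ?_)
      exact abs_cross_dot_mul_le hr hη0 (hvτ.norm_le_one r hr) (hw.norm_deriv_le r hr)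
    · rw [integral_add' hi' hi, integral_const_mul, integral_const_mul]
      change 3 * η⁻¹ * (∫ r in Ioi (0 : ℝ), ‖deriv (v τ) r - deriv (v t) r‖ ^ 2 * r) +
            3 * η * C ^ 2 * J < ε
      calc 3 * η⁻¹ * (∫ r in Ioi (0 : ℝ), ‖deriv (v τ) r - deriv (v t) r‖ ^ 2 * r) +
            3 * η * C ^ 2 * J ≤ 3 * η⁻¹ * η ^ 2 + 3 * η * C ^ 2 * J := by
              gcongr
              exact h.2
        _ = η * (3 + 3 * C ^ 2 * J) := by field_simp
        _ = ε / 2 := by rw [hη]; field_simp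
        _ < ε := by linarith
  have h3 := h2.add k1
  simpa [ContinuousWithinAt] using h3

/-- The Dirichlet energies are locally bounded in time. -/
lemma eventually_integral_deriv_le (hv : IsEnergyContinuous m I v) {t : ℝ} (ht : t ∈ I) :
    ∃ K : ℝ, ∀ᶠ τ in 𝓝[I] t, ∫ r in Ioi (0 : ℝ), ‖deriv (v τ) r‖ ^ 2 * r ≤ K := by
  refine ⟨2 * (∫ r in Ioi (0 : ℝ), ‖deriv (v t) r‖ ^ 2 * r) + 2, ?_⟩
  filter_upwards [hv.eventually_integral_deriv_sub_le ht one_pos, self_mem_nhdsWithin] with τ h hτ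
  have h1 := (hv.profile t ht).integrableOn_deriv.const_mul 2
  have h2 := h.1.const_mul 2
  calc ∫ r in Ioi (0 : ℝ), ‖deriv (v τ) r‖ ^ 2 * r
      ≤ ∫ r in Ioi (0 : ℝ), (2 * (‖deriv (v t) r‖ ^ 2 * r) +
          2 * (‖deriv (v τ) r - deriv (v t) r‖ ^ 2 * r)) := by
        refine setIntegral_mono_on (hv.profile τ hτ).integrableOn_deriv (h1.add h2)
          measurableSet_Ioi fun r (hr : 0 < r) => ?_
        have h3 : ‖deriv (v τ) r‖ ≤ ‖deriv (v t) r‖ + ‖deriv (v τ) r - deriv (v t) r‖ := by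
          have := norm_add_le (deriv (v t) r) (deriv (v τ) r - deriv (v t) r)
          rwa [add_sub_cancel] at this
        have h4 : ‖deriv (v τ) r‖ ^ 2 ≤ 2 * ‖deriv (v t) r‖ ^ 2 +
            2 * ‖deriv (v τ) r - deriv (v t) r‖ ^ 2 := by
          nlinarith [norm_nonneg (deriv (v τ) r), norm_nonneg (deriv (v t) r),
            norm_nonneg (deriv (v τ) r - deriv (v t) r),
            sq_nonneg (‖deriv (v t) r‖ - ‖deriv (v τ) r - deriv (v t) r‖)]
        nlinarith
    _ = 2 * (∫ r in Ioi (0 : ℝ), ‖deriv (v t) r‖ ^ 2 * r) +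
          2 * ∫ r in Ioi (0 : ℝ), ‖deriv (v τ) r - deriv (v t) r‖ ^ 2 * r := by
        rw [integral_add h1 h2, integral_const_mul, integral_const_mul]
    _ ≤ _ := by linarith [h.2]

end IsEnergyContinuous

/-! ### The weak formulation for separated test functions -/

lemma isEnergyContinuous_of_flow {m : ℕ} {I : Set ℝ} {v : ℝ → ℝ → R3}
    (hv : ∀ t ∈ I, IsSigmaProfile m (v t))
    (hu : IsWeakSchrodingerFlow I (fun t => equivariantMap m (v t))) :
    IsEnergyContinuous m I v := by
  refine ⟨hv, fun t ht => ?_⟩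
  have := hu.continuous_energy t ht
  simpa only [equivariantMap_sub] using this

lemma hasCompactSupport_equivariantMap (m : ℕ) {w : ℝ → R3} {b : ℝ} (hb : ∀ r, b < r → w r = 0) :
    HasCompactSupport (equivariantMap m w) := by
  refine HasCompactSupport.of_support_subset_isCompact (isCompact_closedBall (0 : ℂ) b) ?_
  intro x hx
  by_contra h
  rw [mem_closedBall_zero_iff, not_le] at h
  exact hx (by rw [equivariantMap, hb _ h, Matrix.mulVec_zero])

/-- Testing with η(t) times an equivariant field makes the spatial integrands radial, so the weak
equation becomes, up to the factor 2π, the statement that the pairing has weak time derivative minus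
the flux. -/
lemma integral_flow_separated {m : ℕ} (hm : 3 ≤ m) {I : Set ℝ} {v : ℝ → ℝ → R3}
    (hv : ∀ t ∈ I, IsSigmaProfile m (v t))
    (hu : IsWeakSchrodingerFlow I (fun t => equivariantMap m (v t))) {w : ℝ → R3} {a b C : ℝ}
    (hw : ContDiff ℝ 1 w) (ha : 0 < a) (hwa : ∀ r, r < a → w r = 0) (hwb : ∀ r, b < r → w r = 0)
    (hwd : Decays m C w) {η : ℝ → ℝ} (hη : ContDiff ℝ 1 η) (hηc : HasCompactSupport η)
    (hηI : tsupport η ⊆ interior I) :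
    ∫ t in interior I, (deriv η t * pairing (v t) w - η t * flux m (v t) w) = 0 := by
  have hψ := contDiff_equivariantMap m hw ha hwa
  have hψc := hasCompactSupport_equivariantMap m hwb
  set ψ := equivariantMap m w with hψdef
  set φ : ℝ × ℂ → R3 := fun p => η p.1 • ψ p.2 with hφdef
  have hφ : ContDiff ℝ 1 φ := (hη.comp contDiff_fst).smul (hψ.comp contDiff_snd)
  have hsupp : tsupport φ ⊆ tsupport η ×ˢ tsupport ψ := by
    refine closure_minimal ?_ ((isClosed_tsupport η).prod (isClosed_tsupport ψ))
    intro p hp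
    refine ⟨subset_tsupport _ ?_, subset_tsupport _ ?_⟩
    · intro h
      exact hp (by simp [hφdef, h])
    · intro h
      exact hp (by simp [hφdef, h])
  have hφc : HasCompactSupport φ :=
    (IsCompact.prod hηc hψc).of_isClosed_subset (isClosed_tsupport φ) hsupp
  have key := hu.weak_form φ hφ hφc fun p hp => ⟨hηI (hsupp hp).1, mem_univ _⟩
  have hinner : ∀ t ∈ interior I, ∫ x : ℂ,
      (equivariantMap m (v t) x ⬝ᵥ fderiv ℝ φ (t, x) (1, 0)
        - ∑ j : Fin 2, (equivariantMap m (v t) x ⨯₃ pd j (equivariantMap m (v t)) x) ⬝ᵥ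
          fderiv ℝ φ (t, x) (0, dir j)) =
      2 * Real.pi * (deriv η t * pairing (v t) w - η t * flux m (v t) w) := by
    intro t htI
    have hvt := hv t (interior_subset htI)
    have hfd : ∀ x, fderiv ℝ φ (t, x) (1, 0) = deriv η t • ψ x ∧
        ∀ d, fderiv ℝ φ (t, x) (0, d) = η t • fderiv ℝ ψ x d := by
      intro x
      have h1 : HasFDerivAt (fun p : ℝ × ℂ => η p.1) _ (t, x) :=
        ((hη.differentiable one_ne_zero t).hasDerivAt.hasFDerivAt).comp (t, x) hasFDerivAt_fst
      have h2 : HasFDerivAt (fun p : ℝ × ℂ => ψ p.2) _ (t, x) :=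
        HasFDerivAt.comp (g := ψ) (f := Prod.snd) (t, x)
          (hψ.differentiable one_ne_zero x).hasFDerivAt hasFDerivAt_snd
      have h3 := (h1.smul h2).fderiv
      constructor
      · change fderiv ℝ (fun p : ℝ × ℂ => η p.1 • ψ p.2) (t, x) (1, 0) = _
        erw [h3]
        simp
      · intro d
        change fderiv ℝ (fun p : ℝ × ℂ => η p.1 • ψ p.2) (t, x) (0, d) = _
        erw [h3]
        simp
    have hne : ∀ᵐ x : ℂ, x ≠ 0 := by
      simp [ae_iff, measure_singleton]
    have h1 : ∫ x : ℂ,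
      (equivariantMap m (v t) x ⬝ᵥ fderiv ℝ φ (t, x) (1, 0)
        - ∑ j : Fin 2, (equivariantMap m (v t) x ⨯₃ pd j (equivariantMap m (v t)) x) ⬝ᵥ
          fderiv ℝ φ (t, x) (0, dir j)) =
        ∫ x : ℂ, (deriv η t * (v t ‖x‖ ⬝ᵥ w ‖x‖) - η t * fluxDensity m (v t) w ‖x‖) := by
      refine integral_congr_ae ?_
      filter_upwards [ae_norm_of_ae hvt.locAC.ae_differentiableAt_pi, hne] with x hx hx0
      rw [(hfd x).1]
      simp only [(hfd x).2]
      rw [dotProduct_smul, hψdef, equivariantMap_dot, ← sum_cross_pd_dot_pd m hx0 hx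
        (hw.differentiable one_ne_zero _), Finset.mul_sum]
      simp only [dotProduct_smul, smul_eq_mul, pd]
    rw [h1, integral_radial (fun r => deriv η t * (v t r ⬝ᵥ w r) - η t * fluxDensity m (v t) w r)]
    congr 1
    have hi1 := (integrableOn_pairing hm hvt.aesm hwd.locAC.aestronglyMeasurable hvt.norm_le_one
      hwd.norm_le).const_mul (deriv η t)
    have hi2 := (hvt.integrableOn_fluxDensity (by omega) hwd).const_mul (η t)
    rw [pairing, flux, ← integral_const_mul, ← integral_const_mul, ← integral_sub hi1 hi2]
    refine integral_congr_ae (Eventually.of_forall fun r => ?_)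
    simp only
    ring
  rw [setIntegral_congr_fun isOpen_interior.measurableSet hinner, integral_const_mul] at key
  exact (mul_eq_zero.1 key).resolve_left (by positivity)

/-! ### The du Bois-Reymond lemma -/

/-- A continuous function on an interval with a continuous weak derivative is differentiable. -/
lemma hasDerivAt_of_weak_derivative {A B : ℝ → ℝ} {a b : ℝ} (hA : ContinuousOn A (Ioo a b))
    (hB : ContinuousOn B (Ioo a b))
    (h : ∀ η : ℝ → ℝ, ContDiff ℝ 1 η → HasCompactSupport η → tsupport η ⊆ Ioo a b →
      ∫ t in Ioo a b, (deriv η t * A t - η t * B t) = 0) {t : ℝ} (ht : t ∈ Ioo a b) :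
    HasDerivAt A (-B t) t := by
  have hab : a < b := ht.1.trans ht.2
  -- With P a primitive of B, the sum D = A + P has zero weak derivative. The remaining task is to
  -- show that D is constant.
  set P : ℝ → ℝ := fun x => ∫ y in t..x, B y with hP
  have hBi : ∀ x ∈ Ioo a b, ∀ y ∈ Ioo a b, IntervalIntegrable B volume x y := fun x hx y hy =>
    (hB.mono (ordConnected_Ioo.uIcc_subset hx hy)).intervalIntegrable
  have hPd : ∀ x ∈ Ioo a b, HasDerivAt P (B x) x := by
    intro x hx
    have hmem := Ioo_mem_nhds hx.1 hx.2
    exact intervalIntegral.integral_hasDerivAt_right (hBi t ht x hx)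
      (hB.stronglyMeasurableAtFilter isOpen_Ioo x hx) (hB.continuousAt hmem)
  have hPc : ContinuousOn P (Ioo a b) := fun x hx => (hPd x hx).continuousAt.continuousWithinAt
  set D : ℝ → ℝ := fun x => A x + P x with hD
  have hDc : ContinuousOn D (Ioo a b) := hA.add hPc
  have hint : ∀ (f g : ℝ → ℝ), ContinuousOn f (Ioo a b) → Continuous g → HasCompactSupport g →
      tsupport g ⊆ Ioo a b → Integrable (fun x => g x * f x) := by
    intro f g hf hg hgc hgs
    have hs : (fun x => g x * f x) = fun x => (Ioo a b).indicator (fun x => g x * f x) x := by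
      ext x
      by_cases hx : x ∈ Ioo a b
      · rw [indicator_of_mem hx]
      · rw [indicator_of_notMem hx, image_eq_zero_of_notMem_tsupport fun h' => hx (hgs h'), zero_mul]
    have hcont : Continuous (fun x => g x * f x) := by
      rw [continuous_iff_continuousAt]
      intro x
      by_cases hx : x ∈ tsupport g
      · have hx' := hgs hx
        exact hg.continuousAt.mul (hf.continuousAt (Ioo_mem_nhds hx'.1 hx'.2))
      · have : (fun x => g x * f x) =ᶠ[𝓝 x] fun _ => 0 := by
          filter_upwards [(isClosed_tsupport g).isOpen_compl.mem_nhds hx] with y hy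
          rw [image_eq_zero_of_notMem_tsupport hy, zero_mul]
        exact continuousAt_const.congr this.symm
    exact hcont.integrable_of_hasCompactSupport hgc.mul_right
  have hweak : ∀ η : ℝ → ℝ, ContDiff ℝ 1 η → HasCompactSupport η → tsupport η ⊆ Ioo a b →
      ∫ x, deriv η x * D x = 0 := by
    intro η hη hηc hηs
    have hdc : Continuous (deriv η) := hη.continuous_deriv le_rfl
    have hds : tsupport (deriv η) ⊆ Ioo a b := (tsupport_deriv_subset).trans hηs
    have hdcs : HasCompactSupport (deriv η) := hηc.deriv
    have h1 := h η hη hηc hηs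
    rw [setIntegral_eq_integral_of_forall_compl_eq_zero (fun x hx => by
      rw [image_eq_zero_of_notMem_tsupport fun h' => hx (hds h'),
        image_eq_zero_of_notMem_tsupport fun h' => hx (hηs h')]; ring)] at h1
    have hi1 := hint A _ hA hdc hdcs hds
    have hi2 := hint B _ hB hη.continuous hηc hηs
    have hi3 := hint P _ hPc hdc hdcs hds
    have h2 : ∫ x, (deriv η x * P x + η x * B x) = 0 := by
      refine integral_eq_zero_of_hasDerivAt_of_integrable (f := fun x => η x * P x) ?_
        (hi3.add hi2) (hint P _ hPc hη.continuous hηc hηs)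
      intro x
      by_cases hx : x ∈ Ioo a b
      · exact (hη.differentiable one_ne_zero x).hasDerivAt.mul (hPd x hx)
      · have hx1 : x ∉ tsupport η := fun h' => hx (hηs h')
        have e1 : deriv η x = 0 := image_eq_zero_of_notMem_tsupport fun h' => hx (hds h')
        have : (fun x => η x * P x) =ᶠ[𝓝 x] fun _ => 0 := by
          filter_upwards [(isClosed_tsupport η).isOpen_compl.mem_nhds hx1] with y hy
          rw [image_eq_zero_of_notMem_tsupport hy, zero_mul]
        rw [e1, image_eq_zero_of_notMem_tsupport hx1, zero_mul, zero_mul, add_zero]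
        exact (hasDerivAt_const x (0 : ℝ)).congr_of_eventuallyEq this
    rw [integral_sub hi1 hi2] at h1
    rw [integral_add hi3 hi2] at h2
    have e : ∀ x, deriv η x * D x = deriv η x * A x + deriv η x * P x := fun x => mul_add _ _ _
    simp only [e]
    rw [integral_add hi1 hi3]
    linarith
  obtain ⟨g, hgs, hgc, hg, hgr, hg1⟩ :=
    exists_contDiff_tsupport_subset (n := 1) (Ioo_mem_nhds ht.1 ht.2)
  have hgi : Integrable g := hg.continuous.integrable_of_hasCompactSupport hgc
  have hg0 : 0 < ∫ x, g x :=
    hg.continuous.integral_pos_of_hasCompactSupport_nonneg_nonzero hgc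
      (fun x => (hgr ⟨x, rfl⟩).1) (x := t) (by rw [hg1]; exact one_ne_zero)
  set κ := ∫ x, g x with hκ
  -- The only candidate for the constant is the mean of D against the bump g.
  set c := κ⁻¹ * ∫ x, g x * D x with hc
  have hzero : ∀ᵐ x, x ∈ Ioo a b → D x - c = 0 := by
    refine isOpen_Ioo.ae_eq_zero_of_integral_contDiff_smul_eq_zero
      ((hDc.sub continuousOn_const).locallyIntegrableOn measurableSet_Ioo) ?_
    intro θ hθ hθc hθs
    have hθi : Integrable θ := hθ.continuous.integrable_of_hasCompactSupport hθc
    set k := κ⁻¹ * ∫ x, θ x with hk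
    -- Subtracting the right multiple of g gives mean zero, so that the primitive of ζ again has
    -- compact support inside the interval and is an admissible test function.
    set ζ : ℝ → ℝ := fun x => θ x - k * g x with hζ
    have hζc : Continuous ζ := hθ.continuous.sub (continuous_const.mul hg.continuous)
    have hζi : Integrable ζ := hθi.sub (hgi.const_mul k)
    have hζ0 : ∫ x, ζ x = 0 := by
      rw [hζ, integral_sub hθi (hgi.const_mul k), integral_const_mul, hk, ← hκ]
      field_simp
      ring
    have hK : IsCompact (tsupport θ ∪ tsupport g) := hθc.isCompact.union hgc.isCompact
    have hKs : tsupport θ ∪ tsupport g ⊆ Ioo a b := union_subset hθs hgs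
    have hKne : (tsupport θ ∪ tsupport g).Nonempty :=
      ⟨t, Or.inr (subset_tsupport g (by simp [hg1]))⟩
    obtain ⟨p, hp, hpl⟩ := hK.exists_isLeast hKne
    obtain ⟨q, hq, hqg⟩ := hK.exists_isGreatest hKne
    have hζout : ∀ x, x ∉ tsupport θ ∪ tsupport g → ζ x = 0 := by
      intro x hx
      rw [mem_union, not_or] at hx
      simp only [hζ]
      rw [image_eq_zero_of_notMem_tsupport hx.1, image_eq_zero_of_notMem_tsupport hx.2]
      ring
    set η : ℝ → ℝ := fun x => ∫ y in p..x, ζ y with hη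
    have hηd : ∀ x, HasDerivAt η (ζ x) x := fun x =>
      intervalIntegral.integral_hasDerivAt_right (hζc.intervalIntegrable _ _)
        hζc.aestronglyMeasurable.stronglyMeasurableAtFilter hζc.continuousAt
    have hderiv : deriv η = ζ := funext fun x => (hηd x).deriv
    have hηC : ContDiff ℝ 1 η := by
      rw [contDiff_one_iff_deriv, hderiv]
      exact ⟨fun x => (hηd x).differentiableAt, hζc⟩
    have hηsupp : Function.support η ⊆ Icc p q := by
      intro x hx
      by_contra hxn
      apply hx
      have hsub : ∀ y, y ∉ Icc p q → ζ y = 0 := fun y hy =>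
        hζout y fun hy' => hy ⟨hpl hy', hqg hy'⟩
      rw [mem_Icc, not_and_or, not_le, not_le] at hxn
      rcases hxn with hxn | hxn
      · simp only [hη]
        rw [intervalIntegral.integral_symm, intervalIntegral.integral_of_le hxn.le, neg_eq_zero]
        rw [integral_Ioc_eq_integral_Ioo]
        exact setIntegral_eq_zero_of_forall_eq_zero fun y hy =>
          hsub y fun hy' => absurd hy.2 (not_lt.2 hy'.1)
      · simp only [hη]
        have hpq : p ≤ q := hpl hq
        rw [intervalIntegral.integral_of_le (hpq.trans hxn.le), ← hζ0, ← integral_Icc_eq_integral_Ioc]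
        refine setIntegral_eq_integral_of_forall_compl_eq_zero fun y hy => hsub y fun hy' => hy ?_
        exact ⟨hy'.1, hy'.2.trans hxn.le⟩
    have hηts : tsupport η ⊆ Icc p q := closure_minimal hηsupp isClosed_Icc
    have hηc : HasCompactSupport η := HasCompactSupport.of_support_subset_isCompact isCompact_Icc hηsupp
    have h1 := hweak η hηC hηc (hηts.trans fun x hx =>
      ⟨(hKs hp).1.trans_le hx.1, hx.2.trans_lt (hKs hq).2⟩)
    rw [hderiv] at h1
    have hi1 := hint D _ hDc hθ.continuous hθc hθs
    have hi2 := hint D _ hDc hg.continuous hgc hgs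
    have e : ∀ x, ζ x * D x = θ x * D x - k * (g x * D x) := fun x => by simp only [hζ]; ring
    simp only [e] at h1
    rw [integral_sub hi1 (hi2.const_mul k), integral_const_mul] at h1
    simp only [smul_eq_mul, mul_sub]
    rw [integral_sub hi1 (hθi.mul_const c), integral_mul_const, hc]
    rw [hk] at h1
    linarith
  have heq : EqOn D (fun _ => c) (Ioo a b) := by
    refine Measure.eqOn_Ioo_of_ae_eq volume ?_ hDc continuousOn_const
    refine (ae_restrict_iff' measurableSet_Ioo).2 ?_
    filter_upwards [hzero] with x hx hx'
    linarith [hx hx']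
  have hA' : A =ᶠ[𝓝 t] fun x => c - P x := by
    filter_upwards [Ioo_mem_nhds ht.1 ht.2] with x hx
    have := heq hx
    simp only [hD] at this
    linarith
  have := ((hPd t ht).const_sub c).congr_of_eventuallyEq hA'
  exact this

/-- The weak equation yields the derivative only strictly between the two times. Continuity of the
pairing on the closed interval extends the fundamental theorem to the end points, including those of
I. -/
lemma pairing_sub_eq_of_compact {m : ℕ} (hm : 3 ≤ m) {I : Set ℝ} (hI : I.OrdConnected)
    {v : ℝ → ℝ → R3}
    (hv : ∀ t ∈ I, IsSigmaProfile m (v t))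
    (hu : IsWeakSchrodingerFlow I (fun t => equivariantMap m (v t))) {w : ℝ → R3} {a b C : ℝ}
    (hw : ContDiff ℝ 1 w) (ha : 0 < a) (hwa : ∀ r, r < a → w r = 0) (hwb : ∀ r, b < r → w r = 0)
    (hwd : Decays m C w) {σ τ : ℝ} (hσ : σ ∈ I) (hτ : τ ∈ I) (hστ : σ ≤ τ) :
    pairing (v τ) w - pairing (v σ) w = -∫ t in σ..τ, flux m (v t) w := by
  have hec := isEnergyContinuous_of_flow hv hu
  have hA := hec.continuousOn_pairing hm hwd
  have hB := hec.continuousOn_flux (by omega) hwd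
  have hIcc : Icc σ τ ⊆ I := hI.out hσ hτ
  have hIoo : Ioo σ τ ⊆ interior I :=
    interior_maximal (Ioo_subset_Icc_self.trans hIcc) isOpen_Ioo
  have hd : ∀ t ∈ Ioo σ τ, HasDerivAt (fun t => pairing (v t) w) (-flux m (v t) w) t := by
    intro t ht
    refine hasDerivAt_of_weak_derivative (B := fun t => flux m (v t) w)
      (hA.mono (Ioo_subset_Icc_self.trans hIcc))
      (hB.mono (Ioo_subset_Icc_self.trans hIcc)) ?_ ht
    intro η hη hηc hηs
    rw [← integral_flow_separated hm hv hu hw ha hwa hwb hwd hη hηc (hηs.trans hIoo)]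
    symm
    refine setIntegral_eq_of_subset_of_forall_sdiff_eq_zero isOpen_interior.measurableSet hIoo ?_
    intro x hx
    have hx1 : x ∉ tsupport η := fun h' => hx.2 (hηs h')
    have hx2 : x ∉ tsupport (deriv η) := fun h' => hx1 (tsupport_deriv_subset h')
    rw [image_eq_zero_of_notMem_tsupport hx1, image_eq_zero_of_notMem_tsupport hx2]
    ring
  have hBi : IntervalIntegrable (fun t => flux m (v t) w) volume σ τ := by
    refine ContinuousOn.intervalIntegrable (hB.mono ?_)
    rwa [uIcc_of_le hστ]
  rw [← intervalIntegral.integral_neg]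
  exact (intervalIntegral.integral_eq_sub_of_hasDerivAt_of_le hστ (hA.mono hIcc) hd hBi.neg).symm

/-! ### Removing the compact support -/

lemma exists_bound_deriv_smoothTransition :
    ∃ S : ℝ, 0 ≤ S ∧ (∀ x, |deriv Real.smoothTransition x| ≤ S) ∧
      ∀ x, x ∉ Icc (0 : ℝ) 1 → deriv Real.smoothTransition x = 0 := by
  have hc : Continuous (deriv Real.smoothTransition) :=
    (Real.smoothTransition.contDiff (n := 1)).continuous_deriv le_rfl
  have h0 : ∀ x, x ∉ Icc (0 : ℝ) 1 → deriv Real.smoothTransition x = 0 := by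
    intro x hx
    rw [mem_Icc, not_and_or, not_le, not_le] at hx
    rcases hx with hx | hx
    · have : Real.smoothTransition =ᶠ[𝓝 x] fun _ => 0 := by
        filter_upwards [Iio_mem_nhds hx] with y hy
        exact Real.smoothTransition.zero_of_nonpos (le_of_lt hy)
      rw [this.deriv_eq, deriv_const]
    · have : Real.smoothTransition =ᶠ[𝓝 x] fun _ => 1 := by
        filter_upwards [Ioi_mem_nhds hx] with y hy
        exact Real.smoothTransition.one_of_one_le (le_of_lt hy)
      rw [this.deriv_eq, deriv_const]
  obtain ⟨S, hS⟩ := isCompact_Icc.exists_bound_of_continuousOn (hc.continuousOn (s := Icc (0 : ℝ) 1))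
  refine ⟨max S 0, le_max_right _ _, fun x => ?_, h0⟩
  by_cases hx : x ∈ Icc (0 : ℝ) 1
  · exact (hS x hx).trans (le_max_left _ _)
  · rw [h0 x hx, abs_zero]
    exact le_max_right _ _

/-- A smooth cutoff to the annulus `1/N ≤ r ≤ 2N`. -/
noncomputable def cutoff (N r : ℝ) : ℝ :=
  Real.smoothTransition (N * r - 1) * Real.smoothTransition (2 - r / N)

lemma cutoff_contDiff (N : ℝ) : ContDiff ℝ 1 (cutoff N) := by
  unfold cutoff
  refine ContDiff.mul ?_ ?_
  · exact (Real.smoothTransition.contDiff (n := 1)).comp (by fun_prop)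
  · exact (Real.smoothTransition.contDiff (n := 1)).comp (by fun_prop)

lemma abs_cutoff_le (N r : ℝ) : |cutoff N r| ≤ 1 := by
  unfold cutoff
  rw [abs_of_nonneg (mul_nonneg (Real.smoothTransition.nonneg _) (Real.smoothTransition.nonneg _))]
  exact mul_le_one₀ (Real.smoothTransition.le_one _) (Real.smoothTransition.nonneg _)
    (Real.smoothTransition.le_one _)

lemma cutoff_eq_zero_of_lt {N r : ℝ} (hN : 0 < N) (h : r < 1 / N) : cutoff N r = 0 := by
  rw [lt_div_iff₀ hN] at h
  rw [cutoff, Real.smoothTransition.zero_of_nonpos (by linarith), zero_mul]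

lemma cutoff_eq_zero_of_gt {N r : ℝ} (hN : 0 < N) (h : 2 * N < r) : cutoff N r = 0 := by
  rw [← lt_div_iff₀ hN] at h
  rw [cutoff, Real.smoothTransition.zero_of_nonpos (x := 2 - r / N) (by linarith), mul_zero]

lemma cutoff_eq_one {N r : ℝ} (hN : 0 < N) (h1 : 2 ≤ N * r) (h2 : r ≤ N) : cutoff N r = 1 := by
  rw [← div_le_one hN] at h2
  rw [cutoff, Real.smoothTransition.one_of_one_le (by linarith),
    Real.smoothTransition.one_of_one_le (by linarith), one_mul]

/-- The two factors vary only where Nr or r/N lies in [1, 2]; there N, respectively 1/N, is at most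
2/r. The resulting bound S/r does not depend on N, so cutting off a decaying profile keeps its decay
constant uniform. -/
lemma exists_abs_deriv_cutoff_le :
    ∃ S : ℝ, 0 ≤ S ∧ ∀ N r : ℝ, 0 < N → 0 < r → |deriv (cutoff N) r| ≤ S / r := by
  obtain ⟨S, hS0, hS, hSz⟩ := exists_bound_deriv_smoothTransition
  refine ⟨4 * S, by positivity, fun N r hN hr => ?_⟩
  have hd : ∀ x, HasDerivAt Real.smoothTransition (deriv Real.smoothTransition x) x := fun x =>
    ((Real.smoothTransition.contDiff (n := 1)).differentiable one_ne_zero x).hasDerivAt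
  have h1 : HasDerivAt (fun r => Real.smoothTransition (N * r - 1))
      (deriv Real.smoothTransition (N * r - 1) * N) r := by
    have h := ((hasDerivAt_id r).const_mul N).sub_const 1
    rw [mul_one] at h
    exact (hd (N * r - 1)).comp r h
  have h2 : HasDerivAt (fun r => Real.smoothTransition (2 - r / N))
      (deriv Real.smoothTransition (2 - r / N) * -(1 / N)) r := by
    exact (hd (2 - r / N)).comp r (((hasDerivAt_id r).div_const N).const_sub 2)
  have h3 : HasDerivAt (cutoff N) _ r := h1.mul h2
  rw [h3.deriv]
  have b1 : |deriv Real.smoothTransition (N * r - 1) * N| ≤ 2 * S / r := by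
    by_cases hx : N * r - 1 ∈ Icc (0 : ℝ) 1
    · have : N ≤ 2 / r := by rw [le_div_iff₀ hr]; linarith [hx.2]
      rw [abs_mul, abs_of_pos hN]
      calc _ ≤ S * (2 / r) := mul_le_mul (hS _) this hN.le hS0
        _ = _ := by ring
    · rw [hSz _ hx, zero_mul, abs_zero]; positivity
  have b2 : |deriv Real.smoothTransition (2 - r / N) * -(1 / N)| ≤ 2 * S / r := by
    by_cases hx : 2 - r / N ∈ Icc (0 : ℝ) 1
    · have h4 : r / N ≤ 2 := by linarith [hx.1]
      have : 1 / N ≤ 2 / r := by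
        rw [div_le_div_iff₀ hN hr]
        rw [div_le_iff₀ hN] at h4
        linarith
      rw [abs_mul, abs_neg, abs_of_pos (by positivity : 0 < 1 / N)]
      calc _ ≤ S * (2 / r) := mul_le_mul (hS _) this (by positivity) hS0
        _ = _ := by ring
    · rw [hSz _ hx, zero_mul, abs_zero]; positivity
  have c : ∀ x, |Real.smoothTransition x| ≤ 1 := fun x => by
    rw [abs_of_nonneg (Real.smoothTransition.nonneg _)]
    exact Real.smoothTransition.le_one _
  refine (abs_add_le _ _).trans ?_
  rw [abs_mul, abs_mul (Real.smoothTransition _)]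
  have d1 := mul_le_mul b1 (c (2 - r / N)) (abs_nonneg _) (by positivity)
  have d2 := mul_le_mul (c (N * r - 1)) b2 (abs_nonneg _) zero_le_one
  calc _ ≤ 2 * S / r * 1 + 1 * (2 * S / r) := add_le_add d1 d2
    _ = _ := by ring

lemma Decays.contDiff_cutoff_smul {m : ℕ} {C : ℝ} {w : ℝ → R3} (hw : Decays m C w) {N : ℝ}
    (hN : 0 < N) : ContDiff ℝ 1 (fun r => cutoff N r • w r) := by
  rw [contDiff_iff_contDiffAt]
  intro r
  rcases lt_or_ge r (1 / N) with h | h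
  · have : (fun r => cutoff N r • w r) =ᶠ[𝓝 r] fun _ => 0 := by
      filter_upwards [Iio_mem_nhds h] with y hy
      rw [cutoff_eq_zero_of_lt hN hy, zero_smul]
    exact contDiffAt_const.congr_of_eventuallyEq this
  · have hr : 0 < r := (by positivity : 0 < 1 / N).trans_le h
    exact (cutoff_contDiff N).contDiffAt.smul (hw.contDiffOn.contDiffAt (Ioi_mem_nhds hr))

lemma Decays.differentiableAt {m : ℕ} {C : ℝ} {w : ℝ → R3} (hw : Decays m C w) {r : ℝ}
    (hr : 0 < r) : DifferentiableAt ℝ w r :=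
  (hw.contDiffOn.contDiffAt (Ioi_mem_nhds hr)).differentiableAt one_ne_zero

lemma Decays.cutoff_smul {m : ℕ} {C : ℝ} {w : ℝ → R3} (hw : Decays m C w) {S : ℝ} (hS0 : 0 ≤ S)
    (hS : ∀ N r : ℝ, 0 < N → 0 < r → |deriv (cutoff N) r| ≤ S / r) {N : ℝ} (hN : 0 < N) :
    Decays m (C * (1 + S)) (fun r => cutoff N r • w r) := by
  have hC := hw.nonneg
  refine ⟨(hw.contDiff_cutoff_smul hN).contDiffOn, fun r hr => ?_, fun r hr => ?_⟩
  · rw [norm_smul, Real.norm_eq_abs]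
    have hnn := h1_nonneg m hr.le
    calc _ ≤ 1 * (C * h1 m r) :=
          mul_le_mul (abs_cutoff_le N r) (hw.norm_le r hr) (norm_nonneg _) zero_le_one
      _ ≤ _ := by nlinarith [mul_nonneg (mul_nonneg hC hS0) hnn]
  · have hd := (((cutoff_contDiff N).differentiable one_ne_zero r).hasDerivAt).smul
      (hw.differentiableAt hr).hasDerivAt
    have e : deriv (fun r => cutoff N r • w r) r = _ := hd.deriv
    rw [e]
    refine (norm_add_le _ _).trans ?_
    rw [norm_smul, norm_smul, Real.norm_eq_abs, Real.norm_eq_abs]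
    have b1 := mul_le_mul (abs_cutoff_le N r) (hw.norm_deriv_le r hr) (norm_nonneg _) zero_le_one
    have b2 := mul_le_mul (hS N r hN hr) (hw.norm_le r hr) (norm_nonneg _) (by positivity)
    calc _ ≤ 1 * (C * (h1 m r / r)) + S / r * (C * h1 m r) := add_le_add b1 b2
      _ = _ := by ring

/-- Equality of germs, not only of values, so that the derivatives converge pointwise as well. -/
lemma eventually_cutoff_smul_eq (w : ℝ → R3) {r : ℝ} (hr : 0 < r) :
    ∀ᶠ n : ℕ in atTop, (fun r => cutoff (n + 1) r • w r) =ᶠ[𝓝 r] w := by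
  have hb : Tendsto (fun n : ℕ => (n : ℝ) + 1) atTop atTop :=
    tendsto_atTop_add_const_right _ _ tendsto_natCast_atTop_atTop
  filter_upwards [hb.eventually_ge_atTop (4 / r), hb.eventually_ge_atTop (2 * r)] with n h1 h2
  filter_upwards [Ioo_mem_nhds (half_lt_self hr) (by linarith : r < 2 * r)] with y hy
  have hN : (0 : ℝ) < n + 1 := by positivity
  rw [cutoff_eq_one hN ?_ (by linarith [hy.2]), one_smul]
  rw [div_le_iff₀ hr] at h1
  nlinarith [hy.1]

/-- Limit of the identity for compactly supported profiles along the cutoffs. Space integrals pass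
to the limit by the uniform decay constant; the uniform energy bound K dominates the flux in time.
-/
lemma pairing_sub_eq {m : ℕ} (hm : 3 ≤ m) {I : Set ℝ} (hI : I.OrdConnected)
    {v : ℝ → ℝ → R3} (hv : ∀ t ∈ I, IsSigmaProfile m (v t))
    (hu : IsWeakSchrodingerFlow I (fun t => equivariantMap m (v t))) {w : ℝ → R3} {C : ℝ}
    (hw : Decays m C w) {σ τ : ℝ} (hσ : σ ∈ I) (hτ : τ ∈ I) (hστ : σ ≤ τ) {K : ℝ}
    (hK : ∀ t ∈ Icc σ τ, ∫ r in Ioi (0 : ℝ), ‖deriv (v t) r‖ ^ 2 * r ≤ K) :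
    pairing (v τ) w - pairing (v σ) w = -∫ t in σ..τ, flux m (v t) w := by
  obtain ⟨S, hS0, hS⟩ := exists_abs_deriv_cutoff_le
  have hec := isEnergyContinuous_of_flow hv hu
  have hIcc : Icc σ τ ⊆ I := hI.out hσ hτ
  set W : ℕ → ℝ → R3 := fun n r => cutoff (n + 1) r • w r with hW
  have hWd : ∀ n, Decays m (C * (1 + S)) (W n) := fun n => hw.cutoff_smul hS0 hS (by positivity)
  have hn : ∀ n, pairing (v τ) (W n) - pairing (v σ) (W n) = -∫ t in σ..τ, flux m (v t) (W n) := by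
    intro n
    have hN : (0 : ℝ) < (n : ℝ) + 1 := by positivity
    exact pairing_sub_eq_of_compact hm hI hv hu (hw.contDiff_cutoff_smul hN)
      (by positivity : (0 : ℝ) < 1 / ((n : ℝ) + 1))
      (fun r hr => by rw [cutoff_eq_zero_of_lt hN hr, zero_smul])
      (fun r hr => by rw [cutoff_eq_zero_of_gt hN hr, zero_smul]) (hWd n) hσ hτ hστ
  have hpair : ∀ t ∈ I, Tendsto (fun n => pairing (v t) (W n)) atTop (𝓝 (pairing (v t) w)) := by
    intro t ht
    refine tendsto_pairing hm (C := C * (1 + S)) (Eventually.of_forall fun _ => (hv t ht).aesm)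
      (Eventually.of_forall fun n => (hWd n).locAC.aestronglyMeasurable)
      (Eventually.of_forall fun _ => (hv t ht).norm_le_one)
      (Eventually.of_forall fun n => (hWd n).norm_le) (fun r _ => tendsto_const_nhds)
      (fun r hr => ?_)
    refine tendsto_const_nhds.congr' ?_
    filter_upwards [eventually_cutoff_smul_eq w hr] with n h
    exact h.eq_of_nhds.symm
  have hflux : ∀ t ∈ I, Tendsto (fun n => flux m (v t) (W n)) atTop (𝓝 (flux m (v t) w)) := by
    intro t ht
    refine tendsto_integral_filter_of_dominated_convergence
      (fun r => 3 * (‖deriv (v t) r‖ ^ 2 * r) + fluxConst m (C * (1 + S)) * (h1 m r / r)) ?_ ?_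
      (((hv t ht).integrableOn_deriv.const_mul 3).add
        ((integrableOn_h1_div (by omega)).const_mul _)) ?_
    · refine Eventually.of_forall fun n => ?_
      exact aestronglyMeasurable_mixedDensity m (hv t ht).aesm
        (aestronglyMeasurable_deriv' _) (hWd n).locAC.aestronglyMeasurable
    · refine Eventually.of_forall fun n => ?_
      refine (ae_restrict_iff' measurableSet_Ioi).2 (Eventually.of_forall fun r hr => ?_)
      exact abs_mixedDensity_mul_le (hWd n) hr ((hv t ht).norm_le_one r hr)
    · refine (ae_restrict_iff' measurableSet_Ioi).2 (Eventually.of_forall fun r hr => ?_)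
      refine tendsto_const_nhds.congr' ?_
      filter_upwards [eventually_cutoff_smul_eq w hr] with n h
      have e1 : W n r = w r := h.eq_of_nhds
      have e2 : deriv (W n) r = deriv w r := h.deriv_eq
      simp only [fluxDensity, e1, e2]
  have hlim : Tendsto (fun n => ∫ t in σ..τ, flux m (v t) (W n)) atTop
      (𝓝 (∫ t in σ..τ, flux m (v t) w)) := by
    refine intervalIntegral.tendsto_integral_filter_of_dominated_convergence
      (fun _ => 3 * K + fluxConst m (C * (1 + S)) * ∫ r in Ioi (0 : ℝ), h1 m r / r) ?_ ?_
      intervalIntegrable_const ?_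
    · refine Eventually.of_forall fun n => ?_
      rw [uIoc_of_le hστ]
      exact ((hec.continuousOn_flux (by omega) (hWd n)).mono
        (Ioc_subset_Icc_self.trans hIcc)).aestronglyMeasurable measurableSet_Ioc
    · refine Eventually.of_forall fun n => Eventually.of_forall fun t ht => ?_
      rw [uIoc_of_le hστ] at ht
      refine ((hv t (hIcc (Ioc_subset_Icc_self ht))).abs_flux_le (by omega) (hWd n)).trans ?_
      have := hK t (Ioc_subset_Icc_self ht)
      linarith
    · refine Eventually.of_forall fun t ht => ?_
      rw [uIoc_of_le hστ] at ht
      exact hflux t (hIcc (Ioc_subset_Icc_self ht))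
  refine tendsto_nhds_unique ((hpair τ hτ).sub (hpair σ hσ)) ?_
  exact hlim.neg.congr fun n => (hn n).symm

/-- Time derivative of the pairing with a decaying test profile. -/
theorem hasDerivWithinAt_pairing {m : ℕ} (hm : 3 ≤ m) {I : Set ℝ} (hI : I.OrdConnected)
    {v : ℝ → ℝ → R3} (hv : ∀ t ∈ I, IsSigmaProfile m (v t))
    (hu : IsWeakSchrodingerFlow I (fun t => equivariantMap m (v t))) {w : ℝ → R3} {C : ℝ}
    (hw : Decays m C w) {t : ℝ} (ht : t ∈ I) :
    HasDerivWithinAt (fun τ => pairing (v τ) w) (-flux m (v t) w) I t := by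
  have hec := isEnergyContinuous_of_flow hv hu
  obtain ⟨K, hK⟩ := hec.eventually_integral_deriv_le ht
  have hB := hec.continuousOn_flux (by omega) hw
  rw [hasDerivWithinAt_iff_isLittleO, Asymptotics.isLittleO_iff]
  intro ε hε
  have hBt := (Metric.tendsto_nhds.1 (hB t ht)) ε hε
  -- On one ball around t the Dirichlet energy is bounded, as the integrated identity requires, and
  -- the flux stays within ε of its value at t.
  obtain ⟨d, hd, hsub⟩ := Metric.mem_nhdsWithin_iff.1 (hK.and hBt)
  filter_upwards [inter_mem_nhdsWithin I (Metric.ball_mem_nhds t hd)] with τ hτ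
  have hseg : ∀ x ∈ uIcc t τ, x ∈ I ∧ x ∈ Metric.ball t d := fun x hx =>
    ⟨hI.uIcc_subset ht hτ.1 hx, by
      have := (convex_ball t d).ordConnected.uIcc_subset (Metric.mem_ball_self hd) hτ.2 hx
      exact this⟩
  have hprop : ∀ x ∈ uIcc t τ, (∫ r in Ioi (0 : ℝ), ‖deriv (v x) r‖ ^ 2 * r ≤ K) ∧
      dist (flux m (v x) w) (flux m (v t) w) < ε := fun x hx => hsub ⟨(hseg x hx).2, (hseg x hx).1⟩
  have heq : pairing (v τ) w - pairing (v t) w = -∫ x in t..τ, flux m (v x) w := by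
    rcases le_total t τ with h | h
    · refine pairing_sub_eq hm hI hv hu hw ht hτ.1 h (K := K) fun x hx => (hprop x ?_).1
      rwa [uIcc_of_le h]
    · have := pairing_sub_eq hm hI hv hu hw hτ.1 ht h (K := K) fun x hx => (hprop x (by
        rwa [uIcc_of_ge h])).1
      rw [intervalIntegral.integral_symm]
      linarith
  have hBi : IntervalIntegrable (fun x => flux m (v x) w) volume t τ :=
    (hB.mono fun x hx => (hseg x hx).1).intervalIntegrable
  have e : pairing (v τ) w - pairing (v t) w - (τ - t) • -flux m (v t) w =
      ∫ x in t..τ, (flux m (v t) w - flux m (v x) w) := by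
    rw [intervalIntegral.integral_sub intervalIntegrable_const hBi, intervalIntegral.integral_const,
      heq]
    simp only [smul_eq_mul]
    ring
  rw [e, Real.norm_eq_abs (τ - t)]
  refine intervalIntegral.norm_integral_le_of_norm_le_const fun x hx => ?_
  have := (hprop x (uIoc_subset_uIcc hx)).2
  rw [dist_comm, dist_eq_norm] at this
  exact this.le

/-! ### The kernels of the orthogonality conditions -/

/-- Together with `hasDerivAt_h3` this is the first order system h_r = (m/r) h × Rh written in
components. In particular h₁ is annihilated by ∂_r + (m/r)h₃. -/
lemma hasDerivAt_h1 (m : ℕ) {r : ℝ} (hr : 0 < r) :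
    HasDerivAt (h1 m) (-(m / r) * (h1 m r * h3 m r)) r := by
  have hp : r ^ (2 * m) + 1 ≠ 0 := by positivity
  -- Writing the derivative as n rⁿ / r avoids the truncated exponent n - 1, including at n = 0.
  have hd : ∀ n : ℕ, HasDerivAt (fun x : ℝ => x ^ n) (n * r ^ n / r) r := fun n => by
    refine (hasDerivAt_pow n r).congr_deriv ?_
    rcases n with _ | n
    · simp
    · rw [Nat.add_sub_cancel, pow_succ]
      field_simp
  have := ((hd m).const_mul 2).div ((hd (2 * m)).add_const 1) hp
  refine this.congr_deriv ?_
  unfold h1 h3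
  rw [pow_mul'] at hp ⊢
  push_cast
  field_simp
  ring

lemma hasDerivAt_h3 (m : ℕ) {r : ℝ} (hr : 0 < r) :
    HasDerivAt (h3 m) (m / r * h1 m r ^ 2) r := by
  have hp : r ^ (2 * m) + 1 ≠ 0 := by positivity
  have hd : ∀ n : ℕ, HasDerivAt (fun x : ℝ => x ^ n) (n * r ^ n / r) r := fun n => by
    refine (hasDerivAt_pow n r).congr_deriv ?_
    rcases n with _ | n
    · simp
    · rw [Nat.add_sub_cancel, pow_succ]
      field_simp
  have := ((hd (2 * m)).sub_const 1).div ((hd (2 * m)).add_const 1) hp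
  refine this.congr_deriv ?_
  unfold h1
  rw [pow_mul'] at hp ⊢
  push_cast
  field_simp
  ring

lemma pow_two_mul_add_one_ne_zero (m : ℕ) (r : ℝ) : r ^ (2 * m) + 1 ≠ 0 := by
  have : 0 ≤ r ^ (2 * m) := by rw [pow_mul]; positivity
  positivity

lemma contDiff_h1 (m : ℕ) : ContDiff ℝ 1 (h1 m) := by
  unfold h1
  exact ContDiff.div (by fun_prop) (by fun_prop) (pow_two_mul_add_one_ne_zero m)

lemma contDiff_h3 (m : ℕ) : ContDiff ℝ 1 (h3 m) := by
  unfold h3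
  exact ContDiff.div (by fun_prop) (by fun_prop) (pow_two_mul_add_one_ne_zero m)

/-- A kernel `K`, together with its scaling derivative `E = r ∂_r K`. -/
structure IsKernel (m : ℕ) (K E : ℝ → R3) : Prop where
  contDiff : ContDiff ℝ 1 K
  continuous : Continuous E
  hasDerivAt : ∀ r, 0 < r → HasDerivAt K ((1 / r) • E r) r
  norm_le : ∀ r, 0 < r → ‖K r‖ ≤ h1 m r
  norm_le' : ∀ r, 0 < r → ‖E r‖ ≤ 2 * m * h1 m r

/-- The kernel `h₁ ĵ`. -/
noncomputable def kernel1 (m : ℕ) (r : ℝ) : R3 := ![0, h1 m r, 0]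

/-- The scaling derivative of `kernel1`. -/
noncomputable def kernel1' (m : ℕ) (r : ℝ) : R3 := ![0, -m * (h1 m r * h3 m r), 0]

/-- The kernel `h₁ (h × ĵ)`. -/
noncomputable def kernel2 (m : ℕ) (r : ℝ) : R3 := ![-(h1 m r * h3 m r), 0, h1 m r ^ 2]

/-- The scaling derivative of `kernel2`. -/
noncomputable def kernel2' (m : ℕ) (r : ℝ) : R3 :=
  ![m * (h1 m r * h3 m r ^ 2 - h1 m r ^ 3), 0, -2 * m * (h1 m r ^ 2 * h3 m r)]

lemma isKernel1 (m : ℕ) : IsKernel m (kernel1 m) (kernel1' m) := by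
  have c1 := contDiff_h1 m
  have k1 := continuous_h1 m
  have k3 := continuous_h3 m
  refine ⟨?_, ?_, fun r hr => ?_, fun r hr => ?_, fun r hr => ?_⟩
  · rw [contDiff_pi]
    intro i
    fin_cases i
    · exact contDiff_const
    · exact c1
    · exact contDiff_const
  · refine continuous_pi fun i => ?_
    fin_cases i <;> simp [kernel1'] <;> fun_prop
  · rw [hasDerivAt_pi]
    intro i
    fin_cases i
    · simpa [kernel1, kernel1'] using hasDerivAt_const r (0 : ℝ)
    · refine (hasDerivAt_h1 m hr).congr_deriv ?_
      simp [kernel1']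
      ring
    · simpa [kernel1, kernel1'] using hasDerivAt_const r (0 : ℝ)
  · have h0 := h1_nonneg m hr.le
    rw [pi_norm_le_iff_of_nonneg h0]
    intro i
    fin_cases i <;> simp [kernel1, h0, abs_of_nonneg h0]
  · have h0 := h1_nonneg m hr.le
    have h3 := abs_h3_le_one m hr.le
    have hm : (0 : ℝ) ≤ m := m.cast_nonneg
    rw [pi_norm_le_iff_of_nonneg (by positivity)]
    intro i
    fin_cases i
    · simp [kernel1']; positivity
    · simp only [kernel1', Fin.mk_one, Matrix.cons_val, Real.norm_eq_abs]
      rw [abs_mul, abs_mul, abs_neg, abs_of_nonneg hm, abs_of_nonneg h0]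
      nlinarith [mul_nonneg hm h0]
    · simp [kernel1']; positivity

lemma isKernel2 (m : ℕ) : IsKernel m (kernel2 m) (kernel2' m) := by
  have c1 := contDiff_h1 m
  have c3 := contDiff_h3 m
  have k1 := continuous_h1 m
  have k3 := continuous_h3 m
  refine ⟨?_, ?_, fun r hr => ?_, fun r hr => ?_, fun r hr => ?_⟩
  · rw [contDiff_pi]
    intro i
    fin_cases i
    · exact (c1.mul c3).neg
    · exact contDiff_const
    · exact c1.pow 2
  · refine continuous_pi fun i => ?_
    fin_cases i <;> simp [kernel2'] <;> fun_prop
  · rw [hasDerivAt_pi]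
    intro i
    fin_cases i
    · refine ((hasDerivAt_h1 m hr).mul (hasDerivAt_h3 m hr)).neg.congr_deriv ?_
      simp [kernel2']
      field_simp
      ring
    · simpa [kernel2, kernel2'] using hasDerivAt_const r (0 : ℝ)
    · refine ((hasDerivAt_h1 m hr).pow 2).congr_deriv ?_
      simp [kernel2']
      field_simp
  · have h0 := h1_nonneg m hr.le
    have h3 := abs_h3_le_one m hr.le
    have h1' := h1_le_one m hr.le
    rw [pi_norm_le_iff_of_nonneg h0]
    intro i
    fin_cases i
    · simp only [kernel2, Fin.zero_eta, Matrix.cons_val, Real.norm_eq_abs]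
      rw [abs_neg, abs_mul, abs_of_nonneg h0]
      nlinarith
    · simp [kernel2, h0]
    · simp [kernel2, abs_of_nonneg h0]
      nlinarith
  · have h0 := h1_nonneg m hr.le
    have h3 := abs_h3_le_one m hr.le
    have h1' := h1_le_one m hr.le
    have hs := h1_sq_add_h3_sq m hr.le
    have hm : (0 : ℝ) ≤ m := m.cast_nonneg
    rw [pi_norm_le_iff_of_nonneg (by positivity)]
    intro i
    fin_cases i
    · simp only [kernel2', Fin.zero_eta, Matrix.cons_val, Real.norm_eq_abs]
      have e : h1 m r * SchrodingerMap.h3 m r ^ 2 - h1 m r ^ 3 =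
        h1 m r * (1 - 2 * h1 m r ^ 2) := by linear_combination h1 m r * hs
      rw [e, abs_mul, abs_mul, abs_of_nonneg hm, abs_of_nonneg h0]
      have : |1 - 2 * h1 m r ^ 2| ≤ 2 := by
        rw [abs_le]; constructor <;> nlinarith [sq_nonneg (SchrodingerMap.h3 m r)]
      calc _ ≤ m * (h1 m r * 2) := by gcongr
        _ = _ := by ring
    · simp [kernel2']; positivity
    · simp only [kernel2', Fin.reduceFinMk, Matrix.cons_val, Real.norm_eq_abs]
      rw [abs_mul, abs_mul, abs_mul, abs_neg, abs_two, abs_of_nonneg hm, abs_pow, abs_of_nonneg h0]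
      calc _ ≤ 2 * m * (h1 m r * 1) := by
            gcongr 2 * m * ?_
            nlinarith [mul_le_mul_of_nonneg_left h3 (sq_nonneg (h1 m r))]
        _ = _ := by ring

/-! ### Families of rotated and dilated kernels -/

/-- Dilations by σ in a compact range distort h₁ only by a constant factor. The condition a ≤ 1
serves to bound r^(2m) + σ^(2m) below by a^(2m) (r^(2m) + 1). -/
lemma h1_div_le {m : ℕ} {a b σ r : ℝ} (ha : 0 < a) (ha1 : a ≤ 1) (hσ : σ ∈ Icc a b) (hr : 0 < r) :
    h1 m (r / σ) ≤ b ^ m / a ^ (2 * m) * h1 m r := by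
  have hσ0 : 0 < σ := ha.trans_le hσ.1
  have hb : 0 < b := hσ0.trans_le hσ.2
  have e : h1 m (r / σ) = σ ^ m * (2 * r ^ m) / (r ^ (2 * m) + σ ^ (2 * m)) := by
    unfold h1
    rw [div_pow, div_pow, pow_mul' σ]
    field_simp
  have h2 : a ^ (2 * m) * (r ^ (2 * m) + 1) ≤ r ^ (2 * m) + σ ^ (2 * m) := by
    have h3 : a ^ (2 * m) ≤ 1 := pow_le_one₀ ha.le ha1
    have h4 : a ^ (2 * m) ≤ σ ^ (2 * m) := pow_le_pow_left₀ ha.le hσ.1 _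
    have h5 : 0 < r ^ (2 * m) := by positivity
    nlinarith
  rw [e, h1, div_mul_div_comm]
  have h3 : σ ^ m ≤ b ^ m := pow_le_pow_left₀ hσ0.le hσ.2 _
  gcongr

/-- The rotated and dilated kernel. -/
noncomputable def moved (K : ℝ → R3) (s α : ℝ) (r : ℝ) : R3 := rot α *ᵥ K (r / s)

lemma continuous_rot_mulVec (α : ℝ) : Continuous fun x : R3 => rot α *ᵥ x := by
  simp only [rot_mulVec]
  refine continuous_pi fun i => ?_
  fin_cases i <;> simp <;> fun_prop

namespace IsKernel

variable {m : ℕ} {K E : ℝ → R3}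

/-- The operator r ∂_r commutes with dilations and with constant rotations, so the scaling
derivative of the moved kernel is the moved scaling derivative. -/
lemma hasDerivAt_moved (hK : IsKernel m K E) {s : ℝ} (hs : 0 < s) (α : ℝ) {r : ℝ} (hr : 0 < r) :
    HasDerivAt (moved K s α) ((1 / r) • moved E s α r) r := by
  have h1 : HasDerivAt (fun r => r / s) (1 / s) r := (hasDerivAt_id r).div_const s
  have h2 : HasDerivAt (fun r => K (r / s)) ((1 / s) • (1 / (r / s)) • E (r / s)) r :=
    (hK.hasDerivAt (r / s) (by positivity)).scomp r h1
  have h3 := hasDerivAt_rot (hasDerivAt_const r α) h2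
  refine h3.congr_deriv ?_
  rw [zero_smul, zero_add, smul_smul, Matrix.mulVec_smul, moved]
  congr 1
  field_simp

lemma hasDerivAt_dilation (hK : IsKernel m K E) {s : ℝ} (hs : 0 < s) {r : ℝ} (hr : 0 < r) :
    HasDerivAt (fun s => K (r / s)) (-(1 / s) • E (r / s)) s := by
  have h1 : HasDerivAt (fun s => r / s) (-(r / s ^ 2)) s := by
    have := (hasDerivAt_inv hs.ne').const_mul r
    refine this.congr_deriv ?_
    field_simp
  have h2 : HasDerivAt (fun s => K (r / s)) (-(r / s ^ 2) • (1 / (r / s)) • E (r / s)) s :=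
    (hK.hasDerivAt (r / s) (by positivity)).scomp s h1
  refine h2.congr_deriv ?_
  rw [smul_smul]
  congr 1
  field_simp

lemma decays_moved (hK : IsKernel m K E) (hm : 1 ≤ m) {s : ℝ} (hs : 0 < s) (α : ℝ) :
    ∃ C, Decays m C (moved K s α) := by
  have hmin : 0 < min s 1 := lt_min hs one_pos
  have hdiv : ∀ r, 0 < r → h1 m (r / s) ≤ s ^ m / (min s 1) ^ (2 * m) * h1 m r := fun r hr =>
    h1_div_le hmin (min_le_right _ _) ⟨min_le_left _ _, le_rfl⟩ hr
  set c := s ^ m / (min s 1) ^ (2 * m) with hc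
  have hc0 : 0 < c := by positivity
  have hm' : (1 : ℝ) ≤ m := by exact_mod_cast hm
  refine ⟨4 * m * c, ?_, fun r hr => ?_, fun r hr => ?_⟩
  · refine ContDiff.contDiffOn ?_
    have h1 : ContDiff ℝ 1 fun r => K (r / s) := hK.contDiff.comp (by fun_prop)
    rw [contDiff_pi] at h1 ⊢
    intro i
    simp only [moved, rot_mulVec]
    fin_cases i
    · exact (contDiff_const.mul (h1 0)).sub (contDiff_const.mul (h1 1))
    · exact (contDiff_const.mul (h1 0)).add (contDiff_const.mul (h1 1))
    · exact h1 2
  · have h0 := h1_pos m hr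
    calc ‖moved K s α r‖ ≤ 2 * ‖K (r / s)‖ := norm_rot_le _ _
      _ ≤ 2 * (c * h1 m r) := by
        gcongr
        exact (hK.norm_le _ (by positivity)).trans (hdiv r hr)
      _ = 2 * 1 * c * h1 m r := by ring
      _ ≤ 4 * m * c * h1 m r := by gcongr; norm_num
  · rw [(hK.hasDerivAt_moved hs α hr).deriv, norm_smul, Real.norm_eq_abs,
      abs_of_pos (by positivity)]
    calc 1 / r * ‖moved E s α r‖ ≤ 1 / r * (2 * (2 * m * (c * h1 m r))) := by
          gcongr
          refine (norm_rot_le _ _).trans ?_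
          gcongr
          refine (hK.norm_le' _ (by positivity)).trans ?_
          gcongr
          exact hdiv r hr
      _ = _ := by ring

end IsKernel

/-! ### Difference quotients -/

/-- The mean value inequality off the diagonal and the derivative bound on it. It supplies the
uniform domination under which the coefficients of the parameter increments converge. -/
lemma norm_dslope_le {f f' : ℝ → R3} {a b L x y : ℝ} (hf : ∀ z ∈ Icc a b, HasDerivAt f (f' z) z)
    (hL : ∀ z ∈ Icc a b, ‖f' z‖ ≤ L) (hx : x ∈ Icc a b) (hy : y ∈ Icc a b) :
    ‖dslope f x y‖ ≤ L := by
  rcases eq_or_ne y x with rfl | h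
  · rw [dslope_same, (hf y hy).deriv]
    exact hL y hy
  · rw [dslope_of_ne _ h, slope_def_module, norm_smul, norm_inv]
    have := (convex_Icc a b).norm_image_sub_le_of_norm_hasDerivWithin_le
      (fun z hz => (hf z hz).hasDerivWithinAt) hL hx hy
    rw [inv_mul_le_iff₀ (norm_pos_iff.2 (sub_ne_zero.2 h)), mul_comm]
    exact this

lemma tendsto_dslope {f : ℝ → R3} {f' : R3} {x : ℝ} (hf : HasDerivAt f f' x) {ι : Type*}
    {l : Filter ι} {y : ι → ℝ} (hy : Tendsto y l (𝓝 x)) :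
    Tendsto (fun i => dslope f x (y i)) l (𝓝 f') := by
  have h := (continuousAt_dslope_same.2 hf.differentiableAt).tendsto.comp hy
  rw [dslope_same, hf.deriv] at h
  exact h

/-- Cramer's rule applied before the limit: for τ near t the determinant is nonzero, so the slopes
of x and y are explicit combinations of convergent quantities. Differentiability of x and y is thus
a conclusion and need not be assumed. -/
lemma hasDerivWithinAt_of_linear_system {I : Set ℝ} {t : ℝ} {x y a₁ a₂ b₁ b₂ P₁ P₂ : ℝ → ℝ}
    {A₁ A₂ B₁ B₂ p₁ p₂ : ℝ}
    (h₁ : ∀ᶠ τ in 𝓝[I] t, (x τ - x t) * a₁ τ + (y τ - y t) * b₁ τ = -(P₁ τ - P₁ t))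
    (h₂ : ∀ᶠ τ in 𝓝[I] t, (x τ - x t) * a₂ τ + (y τ - y t) * b₂ τ = -(P₂ τ - P₂ t))
    (ha₁ : Tendsto a₁ (𝓝[I] t) (𝓝 A₁)) (ha₂ : Tendsto a₂ (𝓝[I] t) (𝓝 A₂))
    (hb₁ : Tendsto b₁ (𝓝[I] t) (𝓝 B₁)) (hb₂ : Tendsto b₂ (𝓝[I] t) (𝓝 B₂))
    (hP₁ : HasDerivWithinAt P₁ p₁ I t) (hP₂ : HasDerivWithinAt P₂ p₂ I t)
    (hdet : A₁ * B₂ - A₂ * B₁ ≠ 0) :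
    HasDerivWithinAt x ((-p₁ * B₂ + p₂ * B₁) / (A₁ * B₂ - A₂ * B₁)) I t ∧
      HasDerivWithinAt y ((-p₂ * A₁ + p₁ * A₂) / (A₁ * B₂ - A₂ * B₁)) I t := by
  have hle : 𝓝[I \ {t}] t ≤ 𝓝[I] t := nhdsWithin_mono _ sdiff_subset
  rw [hasDerivWithinAt_iff_tendsto_slope] at hP₁ hP₂ ⊢
  rw [hasDerivWithinAt_iff_tendsto_slope]
  have hd := (ha₁.mul hb₂).sub (ha₂.mul hb₁)
  have hne := hd.eventually_ne hdet
  constructor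
  · refine (((hP₁.neg.mul (hb₂.mono_left hle)).add (hP₂.mul (hb₁.mono_left hle))).div
      (hd.mono_left hle) hdet).congr' ?_
    filter_upwards [h₁.filter_mono hle, h₂.filter_mono hle, hne.filter_mono hle,
      self_mem_nhdsWithin] with τ e₁ e₂ hn hτ
    have hτt : τ - t ≠ 0 := sub_ne_zero.2 hτ.2
    simp only [slope_def_field, Pi.div_apply]
    rw [div_eq_iff hn]
    field_simp
    linear_combination b₁ τ * e₂ - b₂ τ * e₁
  · refine (((hP₂.neg.mul (ha₁.mono_left hle)).add (hP₁.mul (ha₂.mono_left hle))).div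
      (hd.mono_left hle) hdet).congr' ?_
    filter_upwards [h₁.filter_mono hle, h₂.filter_mono hle, hne.filter_mono hle,
      self_mem_nhdsWithin] with τ e₁ e₂ hn hτ
    have hτt : τ - t ≠ 0 := sub_ne_zero.2 hτ.2
    simp only [slope_def_field, Pi.div_apply]
    rw [div_eq_iff hn]
    field_simp
    linear_combination a₂ τ * e₁ - a₁ τ * e₂

/-- The increment of an orthogonality condition is linear in the increments of the parameters,
with converging coefficients. -/
lemma IsKernel.exists_increment {m : ℕ} (hm : 3 ≤ m) {K E : ℝ → R3} (hK : IsKernel m K E)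
    {I : Set ℝ} {v : ℝ → ℝ → R3} (hv : IsEnergyContinuous m I v) {s α : ℝ → ℝ}
    (hs : ContinuousOn s I) (hα : ContinuousOn α I) {t : ℝ} (ht : t ∈ I) (hst : 0 < s t) :
    ∃ a b : ℝ → ℝ,
      (∀ᶠ τ in 𝓝[I] t, (s τ - s t) * a τ + (α τ - α t) * b τ =
        pairing (v τ) (moved K (s τ) (α τ)) - pairing (v τ) (moved K (s t) (α t))) ∧
      Tendsto a (𝓝[I] t) (𝓝 (pairing (v t) fun r => -(1 / s t) • moved E (s t) (α t) r)) ∧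
      Tendsto b (𝓝[I] t) (𝓝 (pairing (v t) (moved (fun r => rotGen *ᵥ K r) (s t) (α t)))) := by
  have hm1 : 1 ≤ m := by omega
  set s₀ := s t with hs₀
  -- A lower bound for s near t; the minimum with 1 is what `h1_div_le` requires of it.
  set c := min (s₀ / 2) 1 with hc
  have hc0 : 0 < c := lt_min (by positivity) one_pos
  have hcs : c ≤ s₀ / 2 := min_le_left _ _
  have hmem : ∀ᶠ τ in 𝓝[I] t, s τ ∈ Icc c (2 * s₀) :=
    (hs t ht).eventually (Icc_mem_nhds (by linarith) (by linarith))
  have hs₀mem : s₀ ∈ Icc c (2 * s₀) := ⟨by linarith, by linarith⟩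
  set M := (2 * s₀) ^ m / c ^ (2 * m) with hM
  have hM0 : 0 < M := by positivity
  have hdil : ∀ σ ∈ Icc c (2 * s₀), ∀ r, 0 < r → h1 m (r / σ) ≤ M * h1 m r := fun σ hσ r hr =>
    h1_div_le hc0 (min_le_right _ _) hσ hr
  have hd1 : ∀ σ ∈ Icc c (2 * s₀), ∀ r, 0 < r →
      ‖dslope (fun s => K (r / s)) s₀ σ‖ ≤ 1 / c * (2 * m * (M * h1 m r)) := by
    intro σ hσ r hr
    refine norm_dslope_le (fun z hz => hK.hasDerivAt_dilation (hc0.trans_le hz.1) hr) ?_ hs₀mem hσ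
    intro z hz
    have hz0 : 0 < z := hc0.trans_le hz.1
    rw [norm_smul, Real.norm_eq_abs, abs_neg, abs_of_pos (by positivity)]
    have h1 : ‖E (r / z)‖ ≤ 2 * m * (M * h1 m r) :=
      (hK.norm_le' _ (by positivity)).trans (by gcongr; exact hdil z hz r hr)
    have h2 : 1 / z ≤ 1 / c := one_div_le_one_div_of_le hc0 hz.1
    exact mul_le_mul h2 h1 (norm_nonneg _) (by positivity)
  have hder : ∀ (x : R3) (z : ℝ), HasDerivAt (fun β => rot β *ᵥ x) (rot z *ᵥ (rotGen *ᵥ x)) z := by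
    intro x z
    have := hasDerivAt_rot (hasDerivAt_id z) (hasDerivAt_const z x)
    simpa using this
  have hd2 : ∀ β r, 0 < r → ‖dslope (fun β => rot β *ᵥ K (r / s₀)) (α t) β‖ ≤ 2 * (M * h1 m r) := by
    intro β r hr
    refine norm_dslope_le (a := min (α t) β) (b := max (α t) β) (fun z _ => hder _ z) ?_
      ⟨min_le_left _ _, le_max_left _ _⟩ ⟨min_le_right _ _, le_max_right _ _⟩
    intro z _
    refine (norm_rot_le _ _).trans ?_
    gcongr
    exact (norm_rotGen_le _).trans ((hK.norm_le _ (by positivity)).trans (hdil _ hs₀mem r hr))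
  have hma : ∀ σ β, AEStronglyMeasurable (fun r => rot β *ᵥ dslope (fun s => K (r / s)) s₀ σ)
      (volume.restrict (Ioi (0 : ℝ))) := by
    intro σ β
    refine (continuous_rot_mulVec β).comp_aestronglyMeasurable ?_
    rcases eq_or_ne σ s₀ with h | h
    · rw [h]
      have hc : Continuous fun r => E (r / s₀) := hK.continuous.comp (by fun_prop)
      have : AEStronglyMeasurable (fun r => -(1 / s₀) • E (r / s₀))
          (volume.restrict (Ioi (0 : ℝ))) :=
        (show Continuous fun r => -(1 / s₀) • E (r / s₀) from
          hc.const_smul (-(1 / s₀))).aestronglyMeasurable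
      refine this.congr ((ae_restrict_iff' measurableSet_Ioi).2
        (Eventually.of_forall fun r hr => ?_))
      simp only [dslope_same]
      rw [(hK.hasDerivAt_dilation hst hr).deriv]
    · simp only [dslope_of_ne _ h, slope_def_module]
      have h1 : Continuous fun r => K (r / σ) := hK.contDiff.continuous.comp (by fun_prop)
      have h2 : Continuous fun r => K (r / s₀) := hK.contDiff.continuous.comp (by fun_prop)
      have h3 : Continuous fun r => (σ - s₀)⁻¹ • (K (r / σ) - K (r / s₀)) :=
        (h1.sub h2).const_smul (σ - s₀)⁻¹
      exact h3.aestronglyMeasurable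
  have hmb : ∀ β, AEStronglyMeasurable (fun r => dslope (fun β => rot β *ᵥ K (r / s₀)) (α t) β)
      (volume.restrict (Ioi (0 : ℝ))) := by
    intro β
    have h2 : Continuous fun r => K (r / s₀) := hK.contDiff.continuous.comp (by fun_prop)
    rcases eq_or_ne β (α t) with rfl | h
    · simp only [dslope_same]
      have : ∀ r, deriv (fun β => rot β *ᵥ K (r / s₀)) (α t) =
          rot (α t) *ᵥ (rotGen *ᵥ K (r / s₀)) := fun r => (hder _ _).deriv
      simp only [this]
      exact ((continuous_rot_mulVec _).comp (continuous_rotGen.comp h2)).aestronglyMeasurable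
    · simp only [dslope_of_ne _ h, slope_def_module]
      have h3 : Continuous fun r =>
          (β - α t)⁻¹ • (rot β *ᵥ K (r / s₀) - rot (α t) *ᵥ K (r / s₀)) :=
        (((continuous_rot_mulVec β).comp h2).sub
          ((continuous_rot_mulVec (α t)).comp h2)).const_smul (β - α t)⁻¹
      exact h3.aestronglyMeasurable
  have hbound_a : ∀ σ ∈ Icc c (2 * s₀), ∀ β r, 0 < r →
      ‖rot β *ᵥ dslope (fun s => K (r / s)) s₀ σ‖ ≤ 2 * (1 / c * (2 * m * M)) * h1 m r := by
    intro σ hσ β r hr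
    refine (norm_rot_le _ _).trans ?_
    have := hd1 σ hσ r hr
    calc _ ≤ 2 * (1 / c * (2 * m * (M * h1 m r))) := by gcongr
      _ = _ := by ring
  have hbound_b : ∀ β r, 0 < r → ‖dslope (fun β => rot β *ᵥ K (r / s₀)) (α t) β‖ ≤
      2 * M * h1 m r := fun β r hr => (hd2 β r hr).trans_eq (by ring)
  -- The increment is telescoped as dilation at the new angle followed by rotation at the old scale.
  -- Using `dslope` keeps the identity valid when a parameter happens to take the same value at τ
  -- and t.
  refine ⟨fun τ => pairing (v τ) fun r => rot (α τ) *ᵥ dslope (fun s => K (r / s)) s₀ (s τ),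
    fun τ => pairing (v τ) fun r => dslope (fun β => rot β *ᵥ K (r / s₀)) (α t) (α τ), ?_, ?_, ?_⟩
  · filter_upwards [hmem, self_mem_nhdsWithin] with τ hτ hτI
    have hvτ := hv.profile τ hτI
    obtain ⟨C₁, hC₁⟩ := hK.decays_moved hm1 (hc0.trans_le hτ.1) (α τ)
    obtain ⟨C₀, hC₀⟩ := hK.decays_moved hm1 hst (α t)
    have i1 := integrableOn_pairing hm hvτ.aesm hC₁.locAC.aestronglyMeasurable hvτ.norm_le_one
      hC₁.norm_le
    have i0 := integrableOn_pairing hm hvτ.aesm hC₀.locAC.aestronglyMeasurable hvτ.norm_le_one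
      hC₀.norm_le
    have ia := integrableOn_pairing hm hvτ.aesm (hma (s τ) (α τ)) hvτ.norm_le_one
      (hbound_a (s τ) hτ (α τ))
    have ib := integrableOn_pairing hm hvτ.aesm (hmb (α τ)) hvτ.norm_le_one (hbound_b (α τ))
    simp only [pairing]
    rw [← integral_const_mul, ← integral_const_mul,
      ← integral_add (ia.const_mul (s τ - s₀)) (ib.const_mul (α τ - α t)), ← integral_sub i1 i0]
    refine integral_congr_ae (Eventually.of_forall fun r => ?_)
    have e1 : (s τ - s₀) • dslope (fun s => K (r / s)) s₀ (s τ) = K (r / s τ) - K (r / s₀) :=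
      sub_smul_dslope (fun s => K (r / s)) s₀ (s τ)
    have e2 : (α τ - α t) • dslope (fun β => rot β *ᵥ K (r / s₀)) (α t) (α τ) =
        rot (α τ) *ᵥ K (r / s₀) - rot (α t) *ᵥ K (r / s₀) :=
      sub_smul_dslope (fun β => rot β *ᵥ K (r / s₀)) (α t) (α τ)
    have e3 : (s τ - s₀) • (rot (α τ) *ᵥ dslope (fun s => K (r / s)) s₀ (s τ)) +
        (α τ - α t) • dslope (fun β => rot β *ᵥ K (r / s₀)) (α t) (α τ) =
        moved K (s τ) (α τ) r - moved K s₀ (α t) r := by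
      rw [← Matrix.mulVec_smul, e1, e2, Matrix.mulVec_sub, moved, moved]
      abel
    have e4 := congrArg (fun x => (v τ r ⬝ᵥ x) * r) e3
    simp only [dotProduct_add, dotProduct_sub, dotProduct_smul, smul_eq_mul] at e4
    simp only
    linear_combination e4
  · refine tendsto_pairing hm (C := 2 * (1 / c * (2 * m * M))) ?_
      (Eventually.of_forall fun τ => hma _ _) ?_ ?_
      (fun r hr => hv.tendsto_apply hm1 ht hr) (fun r hr => ?_)
    · filter_upwards [self_mem_nhdsWithin] with τ hτ using (hv.profile τ hτ).aesm
    · filter_upwards [self_mem_nhdsWithin] with τ hτ using (hv.profile τ hτ).norm_le_one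
    · filter_upwards [hmem] with τ hτ using hbound_a _ hτ _
    · have h1 := tendsto_dslope (hK.hasDerivAt_dilation hst hr) (hs t ht)
      have c : Continuous fun p : ℝ × R3 => rot p.1 *ᵥ p.2 := by
        simp only [rot_mulVec]
        refine continuous_pi fun i => ?_
        fin_cases i <;> simp <;> fun_prop
      have := (c.tendsto (α t, -(1 / s₀) • E (r / s₀))).comp
        (Tendsto.prodMk_nhds (hα t ht) h1)
      rw [Matrix.mulVec_smul] at this
      exact this
  · refine tendsto_pairing hm (C := 2 * M) ?_
      (Eventually.of_forall fun τ => hmb _) ?_ (Eventually.of_forall fun τ => hbound_b _)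
      (fun r hr => hv.tendsto_apply hm1 ht hr) (fun r hr => ?_)
    · filter_upwards [self_mem_nhdsWithin] with τ hτ using (hv.profile τ hτ).aesm
    · filter_upwards [self_mem_nhdsWithin] with τ hτ using (hv.profile τ hτ).norm_le_one
    · exact tendsto_dslope (hder _ _) (hα t ht)

/-! ### Normalization of a profile by dilation and rotation -/

/-- The profile `e^{-αR} v(s ρ)`. -/
noncomputable def normalized (s α : ℝ) (v : ℝ → R3) (ρ : ℝ) : R3 := rot (-α) *ᵥ v (s * ρ)

/-- Profiles on the sphere starting at the south pole, with finite Dirichlet energy. -/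
structure IsUnitProfile (V : ℝ → R3) : Prop where
  locAC : LocAC V
  unit : ∀ r, 0 < r → V r ⬝ᵥ V r = 1
  tendsto_zero : Tendsto V (𝓝[>] 0) (𝓝 (-kHat))
  integrableOn_deriv : IntegrableOn (fun r => ‖deriv V r‖ ^ 2 * r) (Ioi 0)

lemma IsUnitProfile.norm_le_one {V : ℝ → R3} (hV : IsUnitProfile V) {r : ℝ} (hr : 0 < r) :
    ‖V r‖ ≤ 1 := norm_le_one_of_unit (hV.unit r hr)

/-- No differentiability is needed: rotations are invertible, so f and its rotation are
differentiable at the same points, and elsewhere both derivatives are 0 by convention. -/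
lemma deriv_rot (a : ℝ) (f : ℝ → R3) (r : ℝ) :
    deriv (fun x => rot a *ᵥ f x) r = rot a *ᵥ deriv f r := by
  have key : ∀ (b : ℝ) (g : ℝ → R3), DifferentiableAt ℝ g r →
      HasDerivAt (fun x => rot b *ᵥ g x) (rot b *ᵥ deriv g r) r := by
    intro b g hg
    simpa using hasDerivAt_rot (hasDerivAt_const r b) hg.hasDerivAt
  by_cases h : DifferentiableAt ℝ f r
  · exact (key a f h).deriv
  · have h' : ¬ DifferentiableAt ℝ (fun x => rot a *ᵥ f x) r := by
      intro hd
      refine h ?_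
      have := (key (-a) _ hd).differentiableAt
      simpa only [rot_neg_cancel'] using this
    rw [deriv_zero_of_not_differentiableAt h, deriv_zero_of_not_differentiableAt h',
      Matrix.mulVec_zero]

lemma deriv_normalized (s α : ℝ) (v : ℝ → R3) (ρ : ℝ) :
    deriv (normalized s α v) ρ = s • rot (-α) *ᵥ deriv v (s * ρ) := by
  have := deriv_rot (-α) (fun x => v (s * x)) ρ
  rw [deriv_comp_mul_left, Matrix.mulVec_smul] at this
  exact this

lemma LocAC.rot {f : ℝ → R3} (hf : LocAC f) (a : ℝ) : LocAC fun r => rot a *ᵥ f r := by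
  intro x y hx hxy
  have hL : LipschitzWith 2 fun z : R3 => SchrodingerMap.rot a *ᵥ z := by
    refine LipschitzWith.of_dist_le_mul fun z w => ?_
    rw [dist_eq_norm, dist_eq_norm, ← Matrix.mulVec_sub]
    exact norm_rot_le a _
  have := (absolutelyContinuousOnInterval_iff _ _ _).1 (hf x y hx hxy)
  rw [absolutelyContinuousOnInterval_iff]
  intro ε hε
  obtain ⟨δ, hδ, h⟩ := this (ε / 2) (by positivity)
  refine ⟨δ, hδ, fun e he hs => ?_⟩
  have h1 := h e he hs
  calc _ ≤ ∑ i ∈ Finset.range e.1, 2 * dist (f (e.2 i).1) (f (e.2 i).2) :=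
        Finset.sum_le_sum fun i _ => hL.dist_le_mul _ _
    _ = 2 * ∑ i ∈ Finset.range e.1, dist (f (e.2 i).1) (f (e.2 i).2) := by rw [Finset.mul_sum]
    _ < ε := by linarith

lemma IsSigmaProfile.normalized {m : ℕ} {v : ℝ → R3} (hv : IsSigmaProfile m v) {s : ℝ}
    (hs : 0 < s) (α : ℝ) : IsUnitProfile (normalized s α v) := by
  have hk : rot (-α) *ᵥ kHat = kHat := by
    rw [rot_mulVec]; ext i; fin_cases i <;> simp [kHat]
  refine ⟨(hv.locAC.comp_mul_left hs).rot _, fun r hr => ?_, ?_, ?_⟩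
  · rw [SchrodingerMap.normalized, rot_dot_rot]
    exact hv.unit _ (by positivity)
  · have h1 : Tendsto (fun r => s * r) (𝓝[>] 0) (𝓝[>] 0) := by
      refine tendsto_nhdsWithin_iff.2 ⟨?_, ?_⟩
      · have : Tendsto (fun r => s * r) (𝓝 0) (𝓝 (s * 0)) := tendsto_id.const_mul s
        rw [mul_zero] at this
        exact this.mono_left nhdsWithin_le_nhds
      · filter_upwards [self_mem_nhdsWithin] with r (hr : 0 < r)
        exact mul_pos hs hr
    have h2 := ((continuous_rot_mulVec (-α)).tendsto _).comp (hv.tendsto_zero.comp h1)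
    rwa [Matrix.mulVec_neg, hk] at h2
  · have h1 : IntegrableOn (fun r => ‖deriv v (s * r)‖ ^ 2 * (s * r)) (Ioi 0) := by
      have := (integrableOn_Ioi_comp_mul_left_iff (fun r => ‖deriv v r‖ ^ 2 * r) 0 hs).2
        (by rw [mul_zero]; exact hv.integrableOn_deriv)
      exact this
    refine (h1.const_mul (4 * s)).mono' ?_ ?_
    · have := measurable_deriv (SchrodingerMap.normalized s α v)
      exact (by fun_prop : Measurable fun r =>
        ‖deriv (SchrodingerMap.normalized s α v) r‖ ^ 2 * r).aestronglyMeasurable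
    · refine (ae_restrict_iff' measurableSet_Ioi).2 (Eventually.of_forall fun r (hr : 0 < r) => ?_)
      rw [Real.norm_eq_abs, abs_of_nonneg (by positivity), deriv_normalized, norm_smul,
        Real.norm_eq_abs, abs_of_pos hs]
      have h3 := norm_rot_le (-α) (deriv v (s * r))
      calc (s * ‖rot (-α) *ᵥ deriv v (s * r)‖) ^ 2 * r
          ≤ (s * (2 * ‖deriv v (s * r)‖)) ^ 2 * r := by gcongr
        _ = _ := by ring

lemma rot_neg_dot (α : ℝ) (x y : R3) : (rot (-α) *ᵥ x) ⬝ᵥ y = x ⬝ᵥ (rot α *ᵥ y) := by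
  rw [← rot_dot_rot α, rot_neg_cancel]

/-- Rotations are adjoint to their inverses, and the substitution r = sρ turns r dr into s² ρ dρ. -/
lemma pairing_moved (v G : ℝ → R3) {s : ℝ} (hs : 0 < s) (α : ℝ) :
    pairing v (moved G s α) = s ^ 2 * pairing (normalized s α v) G := by
  have h := integral_comp_mul_left_Ioi' (fun r => (v r ⬝ᵥ moved G s α r) * r) 0 hs
  rw [mul_zero] at h
  rw [pairing, ← h, smul_eq_mul, pairing, sq, mul_assoc]
  congr 1
  rw [← integral_const_mul]
  refine integral_congr_ae (Eventually.of_forall fun r => ?_)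
  simp only [moved, normalized]
  rw [rot_neg_dot, mul_div_cancel_left₀ _ hs.ne']
  ring

/-- The flux is scale invariant: the two derivatives, or the factor r⁻², compensate for the s²
coming from r dr. -/
lemma flux_moved {m : ℕ} {K E : ℝ → R3} (hK : IsKernel m K E) (v : ℝ → R3) {s : ℝ} (hs : 0 < s)
    (α : ℝ) : flux m v (moved K s α) = flux m (normalized s α v) K := by
  have h := integral_comp_mul_left_Ioi' (fun r => fluxDensity m v (moved K s α) r * r) 0 hs
  rw [mul_zero] at h
  rw [flux, ← h, smul_eq_mul, ← integral_const_mul, flux]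
  refine setIntegral_congr_fun measurableSet_Ioi fun r (hr : 0 < r) => ?_
  have e1 : deriv (moved K s α) (s * r) = (1 / (s * r)) • rot α *ᵥ E r := by
    rw [(hK.hasDerivAt_moved hs α (by positivity)).deriv, moved, mul_div_cancel_left₀ _ hs.ne']
  have e2 : moved K s α (s * r) = rot α *ᵥ K r := by
    rw [moved, mul_div_cancel_left₀ _ hs.ne']
  simp only [fluxDensity]
  rw [e1, e2, (hK.hasDerivAt r hr).deriv, deriv_normalized, normalized, rot_rotGen, rot_rotGen,
    map_smul, smul_dotProduct, rot_cross_rot, rot_cross_rot, rot_neg_dot, rot_neg_dot,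
    Matrix.mulVec_smul, dotProduct_smul, dotProduct_smul]
  simp only [smul_eq_mul]
  field_simp

lemma deviation_normalized (m : ℕ) (v : ℝ → R3) {s : ℝ} (hs : 0 < s) (α ρ : ℝ) :
    deviation m (normalized s α v) ρ = s • rot (-α) *ᵥ deviation m v (s * ρ) := by
  rw [deviation, deviation, deriv_normalized, normalized, rot_rotGen, rot_cross_rot,
    Matrix.mulVec_sub, smul_sub, Matrix.mulVec_smul, smul_smul]
  congr 2
  rcases eq_or_ne ρ 0 with rfl | h
  · simp
  · field_simp

/-! ### The deviation from the first order equation -/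

namespace LocAC

variable {V : ℝ → R3}

lemma ae_deriv_dot_eq_zero (hV : LocAC V) (hu : ∀ r, 0 < r → V r ⬝ᵥ V r = 1) :
    ∀ᵐ r ∂(volume.restrict (Ioi (0 : ℝ))), deriv V r ⬝ᵥ V r = 0 := by
  filter_upwards [hV.ae_differentiableAt_pi, ae_restrict_mem measurableSet_Ioi] with r hr hr0
  have h1 := fun i => hasDerivAt_pi.1 hr.hasDerivAt i
  have h2 := (((h1 0).mul (h1 0)).add ((h1 1).mul (h1 1))).add ((h1 2).mul (h1 2))
  have h3 : HasDerivAt (fun x => V x ⬝ᵥ V x) 0 r :=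
    (hasDerivAt_const r (1 : ℝ)).congr_of_eventuallyEq (by
      filter_upwards [Ioi_mem_nhds hr0] with x hx using hu x hx)
  simp only [dot3] at h3 ⊢
  have := h2.unique h3
  linarith

end LocAC

lemma cross_rotGen {x : R3} (hx : x ⬝ᵥ x = 1) : x ⨯₃ (rotGen *ᵥ x) = kHat - x 2 • x := by
  rw [dot3] at hx
  rw [cross3, rotGen_mulVec]
  ext i
  fin_cases i <;> simp [kHat]
  linear_combination hx

lemma deviation_eq {m : ℕ} {V : ℝ → R3} {r : ℝ} (hV : V r ⬝ᵥ V r = 1) :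
    deviation m V r = deriv V r - (m / r) • (kHat - V r 2 • V r) := by
  rw [deviation, cross_rotGen hV]

lemma deviation_dot_eq_zero {m : ℕ} {V : ℝ → R3} {r : ℝ} (h : deriv V r ⬝ᵥ V r = 0) :
    deviation m V r ⬝ᵥ V r = 0 := by
  rw [deviation, sub_dotProduct, h, smul_dotProduct, dotProduct_comm (_ ⨯₃ _),
    dot_self_cross, smul_zero, sub_zero]

lemma measurable_dot_deviation {m : ℕ} {V : ℝ → R3} (hV : LocAC V) :
    AEStronglyMeasurable (fun r => deviation m V r ⬝ᵥ deviation m V r)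
      (volume.restrict (Ioi (0 : ℝ))) := by
  have h1 : AEStronglyMeasurable (deviation m V) (volume.restrict (Ioi (0 : ℝ))) :=
    (aestronglyMeasurable_deriv' V).sub
      (((by fun_prop : Measurable fun r : ℝ => (m : ℝ) / r).aestronglyMeasurable).smul
        (aestronglyMeasurable_cross hV.aestronglyMeasurable
          (aestronglyMeasurable_rotGen hV.aestronglyMeasurable)))
  exact aestronglyMeasurable_dot h1 h1

/-- Pythagoras in the orthonormal frame `e, v × e` of the plane orthogonal to `v`. -/
lemma sq_add_sq_of_frame {w v e : R3} (hv : v ⬝ᵥ v = 1) (he : e ⬝ᵥ e = 1) (hev : e ⬝ᵥ v = 0)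
    (hw : w ⬝ᵥ v = 0) : (w ⬝ᵥ e) ^ 2 + (w ⬝ᵥ (v ⨯₃ e)) ^ 2 = w ⬝ᵥ w := by
  -- The square of a triple product is the Gram determinant.
  have gram : (w ⬝ᵥ (v ⨯₃ e)) ^ 2 = (w ⬝ᵥ w) * ((v ⬝ᵥ v) * (e ⬝ᵥ e) - (e ⬝ᵥ v) ^ 2) -
      (w ⬝ᵥ v) * ((w ⬝ᵥ v) * (e ⬝ᵥ e) - (e ⬝ᵥ v) * (w ⬝ᵥ e)) +
      (w ⬝ᵥ e) * ((w ⬝ᵥ v) * (e ⬝ᵥ v) - (v ⬝ᵥ v) * (w ⬝ᵥ e)) := by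
    simp only [dot3, cross3, Matrix.cons_val]
    ring
  rw [gram, hv, he, hev, hw]
  ring

/-- W is tangent to the sphere and e, v × e is an orthonormal frame of the tangent plane, so passing
to Hasimoto coordinates preserves length. -/
lemma norm_hasimoto_sq {m : ℕ} {v e : ℝ → R3} (he : IsGaugeFrame v e) {r : ℝ} (hr : 0 < r)
    (hv : v r ⬝ᵥ v r = 1) (hd : deriv v r ⬝ᵥ v r = 0) :
    ‖hasimoto m v e r‖ ^ 2 = deviation m v r ⬝ᵥ deviation m v r := by
  rw [← sq_add_sq_of_frame hv (he.unit r hr) (he.tangent r hr) (deviation_dot_eq_zero hd),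
    Complex.sq_norm, Complex.normSq_apply, hasimoto]
  ring

/-- The norm of the Hasimoto variable, in terms of the normalized profile. -/
lemma sqNormDivR_eq {m : ℕ} {v e : ℝ → R3} (hv : IsSigmaProfile m v) (he : IsGaugeFrame v e)
    {s : ℝ} (hs : 0 < s) (α : ℝ) (hfin : sqNormDivR (hasimoto m v e) ≠ ∞) :
    IntegrableOn (fun ρ => deviation m (normalized s α v) ρ ⬝ᵥ deviation m (normalized s α v) ρ / ρ)
      (Ioi 0) ∧
    sqNormDivR (hasimoto m v e) = ENNReal.ofReal ((s ^ 2)⁻¹ * ∫ ρ in Ioi (0 : ℝ),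
      deviation m (normalized s α v) ρ ⬝ᵥ deviation m (normalized s α v) ρ / ρ) := by
  set g : ℝ → ℝ := fun r => deviation m v r ⬝ᵥ deviation m v r / r with hg
  have h0 : ∀ᵐ r ∂(volume.restrict (Ioi (0 : ℝ))), 0 ≤ g r := by
    filter_upwards [ae_restrict_mem measurableSet_Ioi] with r (hr : 0 < r)
    exact div_nonneg (dot_self_nonneg _) hr.le
  have h1 : sqNormDivR (hasimoto m v e) = ∫⁻ r in Ioi (0 : ℝ), ENNReal.ofReal (g r) := by
    refine lintegral_congr_ae ?_
    filter_upwards [hv.locAC.ae_deriv_dot_eq_zero fun r hr => hv.unit r hr.le,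
      ae_restrict_mem measurableSet_Ioi] with r hd (hr : 0 < r)
    rw [norm_hasimoto_sq he hr (hv.unit r hr.le) hd]
    congr 1
    simp only [hg]
    field_simp
  have hm : AEStronglyMeasurable g (volume.restrict (Ioi (0 : ℝ))) := by
    have := (measurable_dot_deviation (m := m) hv.locAC).mul
      (by fun_prop : Measurable fun r : ℝ => r⁻¹).aestronglyMeasurable
    simp only [hg, div_eq_mul_inv]
    exact this
  have hi : IntegrableOn g (Ioi 0) := by
    refine ⟨hm, ?_⟩
    rw [hasFiniteIntegral_iff_ofReal h0, ← h1]
    exact lt_top_iff_ne_top.2 hfin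
  -- The deviation scales with a factor s, hence s² for its square, and the weight 1/ρ gives one
  -- more; the substitution then takes one factor away, leaving the s² of the claim.
  have e : ∀ ρ, deviation m (normalized s α v) ρ ⬝ᵥ deviation m (normalized s α v) ρ / ρ =
      s ^ 3 * g (s * ρ) := by
    intro ρ
    rw [deviation_normalized m v hs, smul_dotProduct, dotProduct_smul, rot_dot_rot]
    simp only [hg, smul_eq_mul]
    rcases eq_or_ne ρ 0 with rfl | h
    · simp
    · field_simp
  simp only [e]
  constructor
  · refine Integrable.const_mul ?_ _
    exact (integrableOn_Ioi_comp_mul_left_iff g 0 hs).2 (by rwa [mul_zero])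
  · rw [h1, ← ofReal_integral_eq_lintegral_ofReal hi h0, integral_const_mul,
      integral_comp_mul_left_Ioi g 0 hs, mul_zero, smul_eq_mul]
    congr 1
    field_simp

/-! ### The flux in terms of the deviation -/

lemma IsKernel.decays {m : ℕ} {K E : ℝ → R3} (hK : IsKernel m K E) (hm : 1 ≤ m) :
    ∃ C, Decays m C K := by
  have := hK.decays_moved hm one_pos 0
  have e : moved K 1 0 = K := by
    funext r
    rw [moved, rot_zero_mulVec, div_one]
  rwa [e] at this

lemma tendsto_h1_zero {m : ℕ} (hm : 1 ≤ m) : Tendsto (h1 m) (𝓝[>] 0) (𝓝 0) := by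
  have := ((continuous_h1 m).tendsto 0).mono_left (nhdsWithin_le_nhds (s := Ioi 0))
  have e : h1 m 0 = 0 := by
    have : m ≠ 0 := by omega
    simp [h1, this]
  rwa [e] at this

lemma tendsto_h1_atTop {m : ℕ} (hm : 1 ≤ m) : Tendsto (h1 m) atTop (𝓝 0) := by
  refine squeeze_zero' ?_ ?_ (tendsto_const_nhds.div_atTop tendsto_id : Tendsto (fun r : ℝ => 2 / r) atTop (𝓝 0))
  · filter_upwards [eventually_gt_atTop 0] with r hr using h1_nonneg m hr.le
  · filter_upwards [eventually_gt_atTop 0] with r hr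
    rw [le_div_iff₀ hr]
    simpa using h1_mul_pow_le (m := m) (j := 1) (by omega) hr

lemma rotGen_dot (x y : R3) : (rotGen *ᵥ x) ⬝ᵥ y = x 0 * y 1 - x 1 * y 0 := by
  simp only [rotGen_mulVec, dot3, Matrix.cons_val]
  ring

lemma deriv_rotGen_dot {m : ℕ} {V K E : ℝ → R3} (hK : IsKernel m K E) {r : ℝ}
    (hd : DifferentiableAt ℝ V r) (hr : 0 < r) : deriv (fun r => (rotGen *ᵥ V r) ⬝ᵥ K r) r =
      (rotGen *ᵥ deriv V r) ⬝ᵥ K r + (rotGen *ᵥ V r) ⬝ᵥ ((1 / r) • E r) := by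
  have k := fun i => hasDerivAt_pi.1 hd.hasDerivAt i
  have l := fun i => hasDerivAt_pi.1 (hK.hasDerivAt r hr) i
  have := ((k 0).mul (l 1)).sub ((k 1).mul (l 0))
  simp only [rotGen_dot]
  refine this.deriv.trans ?_
  ring

/-- RV · K is dominated by h₁ and so vanishes at both ends of the half line: its derivative can be
added to the flux without changing it. -/
lemma integral_rotGen_dot_deriv {m : ℕ} (hm : 1 ≤ m) {V K E : ℝ → R3} (hV : IsUnitProfile V)
    (hK : IsKernel m K E) :
    IntegrableOn (deriv fun r => (rotGen *ᵥ V r) ⬝ᵥ K r) (Ioi 0) ∧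
      ∫ r in Ioi (0 : ℝ), deriv (fun r => (rotGen *ᵥ V r) ⬝ᵥ K r) r = 0 := by
  obtain ⟨C, hC⟩ := hK.decays hm
  have hK' : LocAC K := hC.locAC
  have hac : LocAC fun r => (rotGen *ᵥ V r) ⬝ᵥ K r := by
    have := ((hV.locAC.apply 0).mul (hK'.apply 1)).sub ((hV.locAC.apply 1).mul (hK'.apply 0))
    simpa only [rotGen_dot] using this
  have hb : ∀ r, 0 < r → ‖(rotGen *ᵥ V r) ⬝ᵥ K r‖ ≤ 3 * h1 m r := by
    intro r hr
    refine (abs_dot_le _ _).trans ?_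
    have := mul_le_mul ((norm_rotGen_le _).trans (hV.norm_le_one hr)) (hK.norm_le r hr)
      (norm_nonneg _) zero_le_one
    linarith
  have hint : IntegrableOn (deriv fun r => (rotGen *ᵥ V r) ⬝ᵥ K r) (Ioi 0) := by
    refine Integrable.mono' ((hV.integrableOn_deriv.const_mul 3).add
      ((integrableOn_h1_div hm).const_mul (3 + 6 * (m : ℝ)))) (aestronglyMeasurable_deriv _ _) ?_
    filter_upwards [hV.locAC.ae_differentiableAt_pi, ae_restrict_mem measurableSet_Ioi] with
      r hd (hr : 0 < r)
    have hd' := deriv_rotGen_dot hK hd hr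
    rw [hd']
    have k0 := h1_pos m hr
    have k1 := h1_le_one m hr.le
    have b1 : ‖(rotGen *ᵥ deriv V r) ⬝ᵥ K r‖ ≤ 3 * (‖deriv V r‖ * h1 m r) := by
      refine (abs_dot_le _ _).trans ?_
      have := mul_le_mul (norm_rotGen_le (deriv V r)) (hK.norm_le r hr)
        (norm_nonneg _) (norm_nonneg _)
      linarith
    have b2 : ‖(rotGen *ᵥ V r) ⬝ᵥ ((1 / r) • E r)‖ ≤ 6 * m * (h1 m r / r) := by
      rw [dotProduct_smul, norm_smul, Real.norm_eq_abs, abs_of_pos (by positivity)]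
      have h2 := abs_dot_le (rotGen *ᵥ V r) (E r)
      have h3 := mul_le_mul ((norm_rotGen_le _).trans (hV.norm_le_one hr)) (hK.norm_le' r hr)
        (norm_nonneg _) zero_le_one
      calc 1 / r * ‖(rotGen *ᵥ V r) ⬝ᵥ E r‖ ≤ 1 / r * (3 * (1 * (2 * m * h1 m r))) := by
            gcongr
            exact h2.trans (by gcongr)
        _ = _ := by ring
    have b3 : ‖deriv V r‖ * h1 m r ≤ ‖deriv V r‖ ^ 2 * r + h1 m r / r := by
      have h4 : h1 m r ^ 2 / r ≤ h1 m r / r := by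
        gcongr
        nlinarith
      have h5 : ‖deriv V r‖ ^ 2 * r + h1 m r ^ 2 / r - ‖deriv V r‖ * h1 m r =
          ((‖deriv V r‖ * r - h1 m r / 2) ^ 2 + 3 / 4 * h1 m r ^ 2) / r := by
        field_simp
        ring
      have h6 : 0 ≤ ((‖deriv V r‖ * r - h1 m r / 2) ^ 2 + 3 / 4 * h1 m r ^ 2) / r := by positivity
      linarith
    refine (norm_add_le _ _).trans ?_
    simp only [Pi.add_apply]
    nlinarith
  refine ⟨hint, hac.integral_Ioi_deriv_eq_zero ?_ ?_ hint⟩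
  · refine squeeze_zero_norm' (a := fun r => 3 * h1 m r) ?_ (by
      simpa using (tendsto_h1_zero hm).const_mul 3)
    filter_upwards [self_mem_nhdsWithin] with r hr using hb r hr
  · refine squeeze_zero_norm' (a := fun r => 3 * h1 m r) ?_ (by
      simpa using (tendsto_h1_atTop hm).const_mul 3)
    filter_upwards [eventually_gt_atTop 0] with r hr using hb r hr

/-- The exact derivative m (RV · K)_r completes the flux to an expression in which V_r occurs only
through W. Pointwise this uses the antisymmetry of R and the identity (V × RV) · (E × V) = -RV · E
for unit V, the latter because RV ⟂ V. -/
lemma flux_eq_integral_deviation {m : ℕ} (hm : 1 ≤ m) {V K E : ℝ → R3} (hV : IsUnitProfile V)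
    (hK : IsKernel m K E) : flux m V K = ∫ r in Ioi (0 : ℝ),
      deviation m V r ⬝ᵥ (E r ⨯₃ V r - (m : ℝ) • (rotGen *ᵥ K r)) := by
  obtain ⟨C, hC⟩ := hK.decays hm
  obtain ⟨h1, h2⟩ := integral_rotGen_dot_deriv hm hV hK
  have h3 : IntegrableOn (fun r => fluxDensity m V K r * r) (Ioi 0) :=
    integrableOn_mixedDensity hm hC hV.locAC.aestronglyMeasurable (aestronglyMeasurable_deriv' V)
      (fun r hr => hV.norm_le_one hr) hV.integrableOn_deriv
  have h4 : flux m V K = ∫ r in Ioi (0 : ℝ), (fluxDensity m V K r * r +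
      m * deriv (fun r => (rotGen *ᵥ V r) ⬝ᵥ K r) r) := by
    rw [integral_add h3 (h1.const_mul _), integral_const_mul, h2, mul_zero, add_zero, flux]
  rw [h4]
  refine integral_congr_ae ?_
  filter_upwards [hV.locAC.ae_differentiableAt_pi, ae_restrict_mem measurableSet_Ioi] with
    r hd (hr : 0 < r)
  have hd' := deriv_rotGen_dot hK hd hr
  have hu := hV.unit r hr
  rw [hd', fluxDensity, (hK.hasDerivAt r hr).deriv, deviation]
  rw [dot3] at hu
  simp only [rotGen_mulVec, dot3, cross3, Matrix.cons_val, Pi.sub_apply, Pi.smul_apply,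
    smul_eq_mul]
  field_simp
  linear_combination (m * (V r 1 * E r 0 - V r 0 * E r 1)) * hu

/-! ### Coordinates with respect to the harmonic map frame -/

/-- The coordinate along `ĵ`. -/
noncomputable def coordJ (V : ℝ → R3) (r : ℝ) : ℝ := V r 1

/-- The coordinate along `h × ĵ`. -/
noncomputable def coordB (m : ℕ) (V : ℝ → R3) (r : ℝ) : ℝ := h1 m r * V r 2 - h3 m r * V r 0

/-- The coordinate along `h`. -/
noncomputable def coordH (m : ℕ) (V : ℝ → R3) (r : ℝ) : ℝ := h1 m r * V r 0 + h3 m r * V r 2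

/-- The subtracted h is orthogonal to ĵ and to h × ĵ, so the coordinates of ξ are those of the full
normalized profile. -/
lemma zCoord_eq (m : ℕ) (s α : ℝ) (v : ℝ → R3) (ρ : ℝ) : zCoord m s α v ρ =
    ⟨coordJ (normalized s α v) ρ, coordB m (normalized s α v) ρ⟩ := by
  have e : pert m s α v ρ = normalized s α v ρ - harm m ρ := rfl
  rw [zCoord, e]
  simp only [dot3, cross3, harm, jHat, coordJ, coordB, Pi.sub_apply, Matrix.cons_val]
  congr 1 <;> ring

namespace IsUnitProfile

variable {m : ℕ} {V : ℝ → R3}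

lemma locAC_coordJ (hV : IsUnitProfile V) : LocAC (coordJ V) := hV.locAC.apply 1

lemma locAC_coordB (m : ℕ) (hV : IsUnitProfile V) : LocAC (coordB m V) :=
  ((LocAC.of_contDiffOn (contDiff_h1 m).contDiffOn).mul (hV.locAC.apply 2)).sub
    ((LocAC.of_contDiffOn (contDiff_h3 m).contDiffOn).mul (hV.locAC.apply 0))

lemma coord_sq (hV : IsUnitProfile V) {r : ℝ} (hr : 0 < r) :
    coordJ V r ^ 2 + coordB m V r ^ 2 + coordH m V r ^ 2 = 1 := by
  have k1 := hV.unit r hr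
  have k2 := h1_sq_add_h3_sq m hr.le
  rw [dot3] at k1
  unfold coordJ coordB coordH
  linear_combination k1 + (V r 0 ^ 2 + V r 2 ^ 2) * k2

lemma tendsto_apply_zero (hV : IsUnitProfile V) (i : Fin 3) :
    Tendsto (fun r => V r i) (𝓝[>] 0) (𝓝 ((-kHat) i)) :=
  ((continuous_apply i).tendsto _).comp hV.tendsto_zero

lemma tendsto_coordJ (hV : IsUnitProfile V) : Tendsto (coordJ V) (𝓝[>] 0) (𝓝 0) := by
  have := hV.tendsto_apply_zero 1
  simp only [kHat, Pi.neg_apply, Matrix.cons_val, neg_zero] at this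
  exact this

lemma tendsto_h3_zero (hm : 1 ≤ m) : Tendsto (h3 m) (𝓝[>] 0) (𝓝 (-1)) := by
  have := ((continuous_h3 m).tendsto 0).mono_left (nhdsWithin_le_nhds (s := Ioi 0))
  have e : h3 m 0 = -1 := by
    have : m ≠ 0 := by omega
    simp [h3, this]
  rwa [e] at this

lemma tendsto_coordB (hm : 1 ≤ m) (hV : IsUnitProfile V) :
    Tendsto (coordB m V) (𝓝[>] 0) (𝓝 0) := by
  have := ((tendsto_h1_zero hm).mul (hV.tendsto_apply_zero 2)).sub
    ((tendsto_h3_zero hm).mul (hV.tendsto_apply_zero 0))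
  simp [kHat] at this
  exact this

lemma tendsto_coordH (hm : 1 ≤ m) (hV : IsUnitProfile V) :
    Tendsto (coordH m V) (𝓝[>] 0) (𝓝 1) := by
  have := ((tendsto_h1_zero hm).mul (hV.tendsto_apply_zero 0)).add
    ((tendsto_h3_zero hm).mul (hV.tendsto_apply_zero 2))
  simp [kHat] at this
  exact this

/-- The three coordinates have squares adding up to 1, so smallness of the tangential ones keeps the
coordinate along h away from zero. It tends to 1 at the origin, and by connectedness it never
changes sign. -/
lemma coordH_pos (hm : 1 ≤ m) (hV : IsUnitProfile V)
    (hs : ∀ r, 0 < r → coordJ V r ^ 2 + coordB m V r ^ 2 < 1) {r : ℝ} (hr : 0 < r) :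
    0 < coordH m V r := by
  have hne : ∀ x, 0 < x → coordH m V x ≠ 0 := by
    intro x hx h0
    have k1 := hV.coord_sq (m := m) hx
    rw [h0] at k1
    have := hs x hx
    linarith
  have hc : ContinuousOn (coordH m V) (Ioi 0) :=
    ((continuous_h1 m).continuousOn.mul (hV.locAC.apply 0).continuousOn).add
      ((continuous_h3 m).continuousOn.mul (hV.locAC.apply 2).continuousOn)
  obtain ⟨a, ha, ha0⟩ := (((hV.tendsto_coordH hm).eventually (lt_mem_nhds one_pos)).and
    (eventually_mem_nhdsWithin : ∀ᶠ x : ℝ in 𝓝[>] 0, x ∈ Ioi 0)).exists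
  by_contra hneg
  obtain ⟨x, hx, hx0⟩ := isPreconnected_Ioi.intermediate_value hr ha0 hc
    ⟨not_lt.1 hneg, ha.le⟩
  exact hne x hx hx0

/-- For g > 0, |1 - g| is at most (1 + g)|1 - g| = |1 - g²|: once the sign of the normal coordinate
is known, its defect is quadratic in the tangential ones. -/
lemma abs_one_sub_coordH_le (hm : 1 ≤ m) (hV : IsUnitProfile V)
    (hs : ∀ r, 0 < r → coordJ V r ^ 2 + coordB m V r ^ 2 < 1) {r : ℝ} (hr : 0 < r) :
    |coordH m V r - 1| ≤ coordJ V r ^ 2 + coordB m V r ^ 2 := by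
  have k1 := hV.coord_sq (m := m) hr
  have k2 := hV.coordH_pos hm hs hr
  rw [abs_le]
  constructor <;> nlinarith [sq_nonneg (coordJ V r), sq_nonneg (coordB m V r)]

/-- Control of the coordinates by the `X` norm. -/
lemma sq_coord_le (hm : 1 ≤ m) (hV : IsUnitProfile V) {δ : ℝ} (hδ : 0 ≤ δ)
    (hX : xNorm (fun ρ => ⟨coordJ V ρ, coordB m V ρ⟩) ≤ ENNReal.ofReal δ) {r : ℝ} (hr : 0 < r) :
    coordJ V r ^ 2 ≤ δ ^ 2 ∧ coordB m V r ^ 2 ≤ δ ^ 2 := by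
  set z : ℝ → ℂ := fun ρ => ⟨coordJ V ρ, coordB m V ρ⟩ with hz
  set g : ℝ → ℝ := fun ρ => (‖deriv z ρ‖ ^ 2 + ‖z ρ‖ ^ 2 / ρ ^ 2) * ρ with hg
  have g0 : ∀ᵐ ρ ∂(volume.restrict (Ioi (0 : ℝ))), 0 ≤ g ρ := by
    filter_upwards [ae_restrict_mem measurableSet_Ioi] with ρ (hρ : 0 < ρ)
    positivity
  have hle : ∫⁻ ρ in Ioi (0 : ℝ), ENNReal.ofReal (g ρ) ≤ ENNReal.ofReal (δ ^ 2) := by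
    rw [xNorm, one_div, ENNReal.rpow_inv_le_iff (by norm_num)] at hX
    refine hX.trans_eq ?_
    rw [ENNReal.ofReal_pow hδ]
    norm_num
  have hzm : AEStronglyMeasurable z (volume.restrict (Ioi (0 : ℝ))) := by
    have h1 := hV.locAC_coordJ.aestronglyMeasurable.aemeasurable
    have h2 := (hV.locAC_coordB m).aestronglyMeasurable.aemeasurable
    have e : z = fun ρ => ((coordJ V ρ : ℝ) : ℂ) + (coordB m V ρ : ℝ) * Complex.I := by
      funext ρ
      apply Complex.ext <;> simp [hz]
    rw [e]
    exact ((Complex.measurable_ofReal.comp_aemeasurable h1).add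
      ((Complex.measurable_ofReal.comp_aemeasurable h2).mul_const _)).aestronglyMeasurable
  have gm : AEStronglyMeasurable g (volume.restrict (Ioi (0 : ℝ))) := by
    have h1 := measurable_deriv z
    have h2 := hzm.aemeasurable
    exact (by fun_prop : AEMeasurable g (volume.restrict (Ioi (0 : ℝ)))).aestronglyMeasurable
  have gi : IntegrableOn g (Ioi 0) := by
    refine ⟨gm, ?_⟩
    rw [hasFiniteIntegral_iff_ofReal g0]
    exact hle.trans_lt ENNReal.ofReal_lt_top
  have gδ : ∫ ρ in Ioi (0 : ℝ), g ρ ≤ δ ^ 2 := by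
    rw [integral_eq_lintegral_of_nonneg_ae g0 gm]
    exact ENNReal.toReal_le_of_le_ofReal (by positivity) hle
  have hd : ∀ᵐ ρ ∂(volume.restrict (Ioi (0 : ℝ))),
      ‖deriv z ρ‖ ^ 2 = deriv (coordJ V) ρ ^ 2 + deriv (coordB m V) ρ ^ 2 := by
    filter_upwards [hV.locAC_coordJ.ae_differentiableAt,
      (hV.locAC_coordB m).ae_differentiableAt] with ρ d1 d2
    have h := d1.hasDerivAt.ofReal_comp.add (d2.hasDerivAt.ofReal_comp.mul_const Complex.I)
    have e : z = fun ρ => ((coordJ V ρ : ℝ) : ℂ) + (coordB m V ρ : ℝ) * Complex.I := by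
      funext ρ
      apply Complex.ext <;> simp [hz]
    rw [e]
    erw [h.deriv]
    rw [Complex.sq_norm, Complex.normSq_apply]
    simp
    ring
  have hz2 : ∀ ρ, ‖z ρ‖ ^ 2 = coordJ V ρ ^ 2 + coordB m V ρ ^ 2 := by
    intro ρ
    rw [Complex.sq_norm, Complex.normSq_apply]
    ring
  have hgd : ∀ᵐ ρ ∂(volume.restrict (Ioi (0 : ℝ))), g ρ =
      (deriv (coordJ V) ρ ^ 2 * ρ + coordJ V ρ ^ 2 / ρ) +
        (deriv (coordB m V) ρ ^ 2 * ρ + coordB m V ρ ^ 2 / ρ) := by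
    filter_upwards [hd, ae_restrict_mem measurableSet_Ioi] with ρ h1 (hρ : 0 < ρ)
    simp only [hg]
    rw [h1, hz2]
    field_simp
    ring
  constructor
  · refine (hV.locAC_coordJ.sq_le_integral hV.tendsto_coordJ gi ?_ hr).trans gδ
    filter_upwards [hgd, ae_restrict_mem measurableSet_Ioi] with ρ h1 (hρ : 0 < ρ)
    rw [h1]
    exact le_add_of_nonneg_right (by positivity)
  · refine ((hV.locAC_coordB m).sq_le_integral (hV.tendsto_coordB hm) gi ?_ hr).trans gδ
    filter_upwards [hgd, ae_restrict_mem measurableSet_Ioi] with ρ h1 (hρ : 0 < ρ)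
    rw [h1]
    exact le_add_of_nonneg_left (by positivity)

end IsUnitProfile

/-- Profiles uniformly close to the harmonic map. -/
structure IsClose (m : ℕ) (δ : ℝ) (V : ℝ → R3) : Prop extends IsUnitProfile V where
  abs_coordJ_le : ∀ r, 0 < r → |coordJ V r| ≤ δ
  abs_coordB_le : ∀ r, 0 < r → |coordB m V r| ≤ δ
  abs_coordH_le : ∀ r, 0 < r → |coordH m V r - 1| ≤ coordJ V r ^ 2 + coordB m V r ^ 2

lemma IsUnitProfile.isClose {m : ℕ} {V : ℝ → R3} (hm : 1 ≤ m) (hV : IsUnitProfile V) {δ : ℝ}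
    (hδ : 0 ≤ δ) (hδ1 : δ ≤ 1 / 2)
    (hX : xNorm (fun ρ => ⟨coordJ V ρ, coordB m V ρ⟩) ≤ ENNReal.ofReal δ) : IsClose m δ V := by
  have k := fun r (hr : 0 < r) => hV.sq_coord_le hm hδ hX hr
  refine ⟨hV, fun r hr => abs_le_of_sq_le_sq (k r hr).1 hδ,
    fun r hr => abs_le_of_sq_le_sq (k r hr).2 hδ,
    fun r hr => hV.abs_one_sub_coordH_le hm (fun x hx => ?_) hr⟩
  nlinarith [(k x hx).1, (k x hx).2]

/-! ### The first order system for the coordinates -/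

/-- The operator `L₀ z = z' + (m/r) h₃ z`, which annihilates `h₁`. -/
noncomputable def firstOrder (m : ℕ) (z : ℝ → ℝ) (r : ℝ) : ℝ := deriv z r + m / r * h3 m r * z r

lemma deriv_coordB {m : ℕ} {V : ℝ → R3} {r : ℝ} (hr : 0 < r) (hd : DifferentiableAt ℝ V r) :
    deriv (coordB m V) r = h1 m r * deriv V r 2 - h3 m r * deriv V r 0 -
      m / r * h1 m r * coordH m V r := by
  have k := fun i => hasDerivAt_pi.1 hd.hasDerivAt i
  have := ((hasDerivAt_h1 m hr).mul (k 2)).sub ((hasDerivAt_h3 m hr).mul (k 0))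
  refine this.deriv.trans ?_
  unfold coordH
  ring

/-- The first order system for the coordinates: its right hand side is the deviation, up to
quadratic terms. -/
lemma IsClose.firstOrder_sq_le {m : ℕ} {δ : ℝ} {V : ℝ → R3} (hV : IsClose m δ V) (hδ1 : δ ≤ 1 / 2) :
    ∀ᵐ r ∂(volume.restrict (Ioi (0 : ℝ))),
      firstOrder m (coordJ V) r ^ 2 + firstOrder m (coordB m V) r ^ 2 ≤
        2 * (deviation m V r ⬝ᵥ deviation m V r) +
          40 * δ ^ 2 * m ^ 2 * ((coordJ V r ^ 2 + coordB m V r ^ 2) / r ^ 2) := by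
  filter_upwards [hV.locAC.ae_differentiableAt_pi, ae_restrict_mem measurableSet_Ioi] with
    r hd (hr : 0 < r)
  have hδ0 : 0 ≤ δ := (abs_nonneg _).trans (hV.abs_coordJ_le r hr)
  have hu := hV.unit r hr
  have hh := h1_sq_add_h3_sq m hr.le
  have hW := deviation_eq (m := m) hu
  have dJ : deriv (coordJ V) r = deriv V r 1 := (hasDerivAt_pi.1 hd.hasDerivAt 1).deriv
  have dB := deriv_coordB (m := m) hr hd
  set a := coordJ V r with ha
  set b := coordB m V r with hb
  set g := coordH m V r with hg
  have V2 : V r 2 = h1 m r * b + h3 m r * g := by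
    simp only [hb, hg, coordB, coordH]
    linear_combination (-(V r 2)) * hh
  set W := deviation m V r with hWd
  have W0 : W 0 = deriv V r 0 + m / r * (V r 2 * V r 0) := by
    have := congrFun hW 0
    simp only [Pi.sub_apply, Pi.smul_apply, smul_eq_mul, kHat, Matrix.cons_val] at this
    linarith
  have W1 : W 1 = deriv V r 1 + m / r * (V r 2 * V r 1) := by
    have := congrFun hW 1
    simp only [Pi.sub_apply, Pi.smul_apply, smul_eq_mul, kHat, Matrix.cons_val] at this
    linarith
  have W2 : W 2 = deriv V r 2 - m / r * (1 - V r 2 * V r 2) := by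
    have := congrFun hW 2
    simp only [Pi.sub_apply, Pi.smul_apply, smul_eq_mul, kHat, Matrix.cons_val] at this
    linarith
  -- Besides a component of W, the right sides contain only terms quadratic in the perturbation: h₃
  -- - V₃ is of first order and is multiplied by a coordinate, and g - 1 is itself quadratic.
  have FJ : firstOrder m (coordJ V) r = W 1 + m / r * ((h3 m r - V r 2) * a) := by
    rw [firstOrder, dJ, W1, ← ha]
    simp only [ha, coordJ]
    ring
  have FB : firstOrder m (coordB m V) r = (h1 m r * W 2 - h3 m r * W 0) +
      m / r * ((h3 m r - V r 2) * b - h1 m r * (g - 1)) := by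
    rw [firstOrder, dB, W2, W0, ← hb]
    simp only [hb, coordB]
    ring
  -- The two components are the projections of W to the orthonormal pair ĵ, h × ĵ; the projection to
  -- h is dropped.
  have hWle : W 1 ^ 2 + (h1 m r * W 2 - h3 m r * W 0) ^ 2 ≤ W ⬝ᵥ W := by
    rw [dot3]
    have e : (h1 m r * W 2 - h3 m r * W 0) ^ 2 + (h1 m r * W 0 + h3 m r * W 2) ^ 2 =
        W 0 * W 0 + W 2 * W 2 := by
      linear_combination (W 0 ^ 2 + W 2 ^ 2) * hh
    nlinarith [sq_nonneg (h1 m r * W 0 + h3 m r * W 2)]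
  have ka : |a| ≤ δ := hV.abs_coordJ_le r hr
  have kb : |b| ≤ δ := hV.abs_coordB_le r hr
  have kg : |g - 1| ≤ a ^ 2 + b ^ 2 := hV.abs_coordH_le r hr
  have ka2 : a ^ 2 ≤ δ ^ 2 := sq_le_sq.2 (by rwa [abs_of_nonneg hδ0])
  have kb2 : b ^ 2 ≤ δ ^ 2 := sq_le_sq.2 (by rwa [abs_of_nonneg hδ0])
  have l1 := h1_le_one m hr.le
  have l0 := h1_nonneg m hr.le
  have l3 := abs_h3_le_one m hr.le
  have kd : |h3 m r - V r 2| ≤ 2 * δ := by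
    have e : h3 m r - V r 2 = -(h1 m r * b) - h3 m r * (g - 1) := by rw [V2]; ring
    rw [e]
    refine (abs_sub _ _).trans ?_
    rw [abs_neg, abs_mul, abs_mul, abs_of_nonneg l0]
    have q1 := mul_le_mul l1 kb (abs_nonneg _) zero_le_one
    have q2 := mul_le_mul l3 kg (abs_nonneg _) zero_le_one
    have q3 : δ ^ 2 ≤ δ * (1 / 2) := by rw [sq]; gcongr
    linarith
  have kd2 : (h3 m r - V r 2) ^ 2 ≤ 4 * δ ^ 2 := by
    calc (h3 m r - V r 2) ^ 2 = |h3 m r - V r 2| ^ 2 := (sq_abs _).symm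
      _ ≤ (2 * δ) ^ 2 := by gcongr
      _ = _ := by ring
  have kg2 : (h1 m r * (g - 1)) ^ 2 ≤ 2 * δ ^ 2 * (a ^ 2 + b ^ 2) := by
    rw [mul_pow, ← sq_abs (g - 1)]
    calc h1 m r ^ 2 * |g - 1| ^ 2 ≤ 1 ^ 2 * (a ^ 2 + b ^ 2) ^ 2 := by gcongr
      _ = (a ^ 2 + b ^ 2) * (a ^ 2 + b ^ 2) := by ring
      _ ≤ 2 * δ ^ 2 * (a ^ 2 + b ^ 2) := by
        gcongr
        linarith
  have main : ((h3 m r - V r 2) * a) ^ 2 + ((h3 m r - V r 2) * b - h1 m r * (g - 1)) ^ 2 ≤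
      20 * δ ^ 2 * (a ^ 2 + b ^ 2) := by
    have e1 : ((h3 m r - V r 2) * a) ^ 2 ≤ 4 * δ ^ 2 * a ^ 2 := by
      rw [mul_pow]; gcongr
    have e2 : ((h3 m r - V r 2) * b) ^ 2 ≤ 4 * δ ^ 2 * b ^ 2 := by
      rw [mul_pow]; gcongr
    have e3 : ∀ p q : ℝ, (p - q) ^ 2 ≤ 2 * p ^ 2 + 2 * q ^ 2 := fun p q => by
      linarith [sq_nonneg (p + q), (by ring : (p - q) ^ 2 + (p + q) ^ 2 = 2 * p ^ 2 + 2 * q ^ 2)]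
    have e4 := e3 ((h3 m r - V r 2) * b) (h1 m r * (g - 1))
    have e5 : 0 ≤ δ ^ 2 * a ^ 2 := by positivity
    have e6 : 0 ≤ δ ^ 2 * b ^ 2 := by positivity
    linarith
  rw [FJ, FB]
  have fin : ∀ x y p q : ℝ, (x + m / r * p) ^ 2 + (y + m / r * q) ^ 2 ≤
      2 * (x ^ 2 + y ^ 2) + 2 * (m / r) ^ 2 * (p ^ 2 + q ^ 2) := by
    intro x y p q
    have e1 := sq_nonneg (x - m / r * p)
    have e2 := sq_nonneg (y - m / r * q)
    linarith
  refine (fin _ _ _ _).trans ?_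
  have e : 40 * δ ^ 2 * m ^ 2 * ((a ^ 2 + b ^ 2) / r ^ 2) =
      2 * (m / r) ^ 2 * (20 * δ ^ 2 * (a ^ 2 + b ^ 2)) := by
    field_simp
    ring
  rw [e]
  gcongr

/-! ### A Hardy inequality -/

/-- L₀ annihilates h₁, hence L₀z = h₁ (z/h₁)'. The Hardy inequality is therefore one for the plain
derivative of z/h₁, in weights involving h₁². -/
lemma deriv_div_h1 {m : ℕ} {z : ℝ → ℝ} {r : ℝ} (hr : 0 < r) (hd : DifferentiableAt ℝ z r) (c : ℝ) :
    HasDerivAt (fun x => z x / h1 m x - c) (firstOrder m z r / h1 m r) r := by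
  have h0 := (h1_pos m hr).ne'
  refine ((hd.hasDerivAt.div (hasDerivAt_h1 m hr) h0).sub_const c).congr_deriv ?_
  rw [firstOrder]
  field_simp
  ring

lemma LocAC.div_h1 (m : ℕ) {z : ℝ → ℝ} (hz : LocAC z) (c : ℝ) :
    LocAC fun x => z x / h1 m x - c := by
  have h1 : LocAC fun x => (h1 m x)⁻¹ := LocAC.of_contDiffOn
    ((contDiff_h1 m).contDiffOn.inv fun x hx => (h1_pos m hx).ne')
  exact (hz.mul h1).sub (LocAC.of_contDiffOn contDiffOn_const)

/-- The Hardy inequality on an interval where `h₁²` is comparable to a power. -/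
lemma hardy_of_comparable {m : ℕ} {z : ℝ → ℝ} (hz : LocAC z) (c : ℝ) (p : ℤ) {a b : ℝ} (ha : 0 < a)
    (hab : a ≤ b) (hlow : ∀ r ∈ Icc a b, r ^ p ≤ h1 m r ^ 2)
    (hupp : ∀ r ∈ Icc a b, h1 m r ^ 2 ≤ 4 * r ^ p) (hp : 16 ≤ ((p : ℝ) - 2) ^ 2)
    (hbd : ((p : ℝ) - 2) * (b ^ p / b ^ 2 * (z b / h1 m b - c) ^ 2) ≤
      ((p : ℝ) - 2) * (a ^ p / a ^ 2 * (z a / h1 m a - c) ^ 2))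
    (hi : IntervalIntegrable (fun r => firstOrder m z r ^ 2 / r) volume a b) :
    ∫ r in a..b, (z r - c * h1 m r) ^ 2 / r ^ 3 ≤ ∫ r in a..b, firstOrder m z r ^ 2 / r := by
  set k : ℝ := (p : ℝ) - 2 with hk
  have hsub : Icc a b ⊆ Ioi 0 := fun x hx => ha.trans_le hx.1
  -- The primitive used for the Hardy inequality is f = k r^(p-2) y² with y = z/h₁ - c and k = p -
  -- 2; the boundary hypothesis says exactly f(b) ≤ f(a).
  set f : ℝ → ℝ := fun r => k * (r ^ p / r ^ 2 * ((z r / h1 m r - c) * (z r / h1 m r - c))) with hf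
  have hy := hz.div_h1 m c
  have hw : LocAC fun r : ℝ => r ^ p / r ^ 2 := by
    refine LocAC.of_contDiffOn ?_
    have e : ∀ r ∈ Ioi (0 : ℝ), r ^ p / r ^ 2 = r ^ (p - 2) := fun r hr => by
      rw [zpow_sub₀ (ne_of_gt hr)]; rfl
    refine ContDiffOn.congr (fun r hr => ?_) e
    exact ((analyticAt_id (𝕜 := ℝ) (z := r)).fun_zpow (ne_of_gt hr)).contDiffAt.contDiffWithinAt
  have hfac : LocAC f := (hw.mul (hy.mul hy)).const_mul k
  have hJ : IntervalIntegrable (fun r => (z r - c * h1 m r) ^ 2 / r ^ 3) volume a b := by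
    refine ContinuousOn.intervalIntegrable ?_
    rw [uIcc_of_le hab]
    have hc := hz.continuousOn_Icc (b := b) ha
    have h1c := (continuous_h1 m).continuousOn (s := Icc a b)
    refine ContinuousOn.div (by fun_prop) (by fun_prop) fun r hr => ?_
    have : 0 < r := hsub hr
    positivity
  have hint : ∫ r in a..b, (k ^ 2 / 8 * ((z r - c * h1 m r) ^ 2 / r ^ 3) -
      2 * (firstOrder m z r ^ 2 / r)) ≤ ∫ r in a..b, deriv f r := by
    refine intervalIntegral.integral_mono_ae_restrict hab
      ((hJ.const_mul _).sub (hi.const_mul _)) (hfac.intervalIntegrable_deriv ha hab) ?_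
    filter_upwards [ae_restrict_of_ae_restrict_of_subset hsub hz.ae_differentiableAt,
      ae_restrict_mem measurableSet_Icc] with r hd hr
    have hr0 : 0 < r := hsub hr
    have h0 := h1_pos m hr0
    have hrp : 0 < r ^ p := zpow_pos hr0 p
    set y := z r / h1 m r - c with hyd
    set F := firstOrder m z r with hF
    have hdy := deriv_div_h1 (m := m) hr0 hd c
    have hdw : HasDerivAt (fun r : ℝ => r ^ p / r ^ 2) (k * (r ^ p / r ^ 3)) r := by
      refine ((hasDerivAt_zpow p r (Or.inl hr0.ne')).div (hasDerivAt_pow 2 r)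
        (by positivity)).congr_deriv ?_
      rw [zpow_sub_one₀ hr0.ne', hk]
      field_simp
      ring
    have hdf : deriv f r = k * (k * (r ^ p / r ^ 3) * (y * y) +
        r ^ p / r ^ 2 * (F / h1 m r * y + y * (F / h1 m r))) :=
      ((hdw.mul (hdy.mul hdy)).const_mul k).deriv
    have hz' : z r - c * h1 m r = h1 m r * y := by
      rw [hyd]; field_simp
    have e1 : k ^ 2 / 8 * ((z r - c * h1 m r) ^ 2 / r ^ 3) ≤ k ^ 2 / 2 * (r ^ p / r ^ 3 * y ^ 2) := by
      rw [hz', mul_pow]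
      have := hupp r hr
      calc k ^ 2 / 8 * (h1 m r ^ 2 * y ^ 2 / r ^ 3)
          ≤ k ^ 2 / 8 * (4 * r ^ p * y ^ 2 / r ^ 3) := by gcongr
        _ = _ := by ring
    have e2 : 2 * (r ^ p / r * (F / h1 m r) ^ 2) ≤ 2 * (F ^ 2 / r) := by
      have := hlow r hr
      have h2 : r ^ p / h1 m r ^ 2 ≤ 1 := (div_le_one (by positivity)).2 this
      calc 2 * (r ^ p / r * (F / h1 m r) ^ 2) = 2 * (F ^ 2 / r) * (r ^ p / h1 m r ^ 2) := by
            field_simp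
        _ ≤ 2 * (F ^ 2 / r) * 1 := by gcongr
        _ = _ := mul_one _
    -- Completing the square bounds f' below by (k²/2) r^(p-3) y² - 2 r^(p-1) y'². The comparison
    -- h₁² ≤ 4 r^p costs a factor 4, leaving k²/8, and k² ≥ 16 makes this at least 2, the
    -- coefficient of the other term.
    have e3 : deriv f r - (k ^ 2 / 2 * (r ^ p / r ^ 3 * y ^ 2) -
        2 * (r ^ p / r * (F / h1 m r) ^ 2)) =
        r ^ p / r ^ 3 / 2 * (k * y + 2 * r * (F / h1 m r)) ^ 2 := by
      rw [hdf]
      field_simp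
      ring
    have e4 : 0 ≤ r ^ p / r ^ 3 / 2 * (k * y + 2 * r * (F / h1 m r)) ^ 2 := by positivity
    linarith
  rw [hfac.integral_deriv ha hab, intervalIntegral.integral_sub (hJ.const_mul _) (hi.const_mul _),
    intervalIntegral.integral_const_mul, intervalIntegral.integral_const_mul] at hint
  have hJ0 : 0 ≤ ∫ r in a..b, (z r - c * h1 m r) ^ 2 / r ^ 3 :=
    intervalIntegral.integral_nonneg hab fun r hr => by
      have : 0 < r := hsub hr
      positivity
  have hfab : f b - f a ≤ 0 := by
    simp only [hf, ← sq]
    linarith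
  nlinarith

lemma pow_le_h1 (m : ℕ) {r : ℝ} (hr : 0 < r) (hr1 : r ≤ 1) : r ^ m ≤ h1 m r := by
  have k : r ^ (2 * m) ≤ 1 := pow_le_one₀ hr.le hr1
  rw [h1, le_div_iff₀ (by positivity)]
  nlinarith [pow_pos hr m]

lemma one_le_h1_mul_pow (m : ℕ) {r : ℝ} (hr1 : 1 ≤ r) : 1 ≤ h1 m r * r ^ m := by
  have k : 1 ≤ r ^ (2 * m) := one_le_pow₀ hr1
  rw [h1, div_mul_eq_mul_div, le_div_iff₀ (by positivity), mul_assoc, ← pow_add, ← two_mul]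
  linarith

lemma h1_one (m : ℕ) : h1 m 1 = 1 := by
  simp [h1]
  norm_num

/-- Hardy inequality for the operator `L₀` modulo its kernel. -/
lemma hardy_h1 {m : ℕ} (hm : 3 ≤ m) {z : ℝ → ℝ} (hz : LocAC z) {a b : ℝ} (ha : 0 < a)
    (ha1 : a ≤ 1) (hb1 : 1 ≤ b)
    (hi : IntervalIntegrable (fun r => firstOrder m z r ^ 2 / r) volume a b) :
    ∫ r in a..b, (z r - z 1 * h1 m r) ^ 2 / r ^ 3 ≤ ∫ r in a..b, firstOrder m z r ^ 2 / r := by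
  have hm' : (3 : ℝ) ≤ m := by exact_mod_cast hm
  have hJ : ∀ x y, 0 < x → x ≤ y →
      IntervalIntegrable (fun r => (z r - z 1 * h1 m r) ^ 2 / r ^ 3) volume x y := by
    intro x y hx hxy
    refine ContinuousOn.intervalIntegrable ?_
    rw [uIcc_of_le hxy]
    have hc := hz.continuousOn_Icc (b := y) hx
    have h1c := (continuous_h1 m).continuousOn (s := Icc x y)
    refine ContinuousOn.div (by fun_prop) (by fun_prop) fun r hr => ?_
    have : 0 < r := hx.trans_le hr.1
    positivity
  have hi1 : IntervalIntegrable (fun r => firstOrder m z r ^ 2 / r) volume a 1 :=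
    hi.mono_set (by rw [uIcc_of_le ha1, uIcc_of_le (ha1.trans hb1)]; exact Icc_subset_Icc_right hb1)
  have hi2 : IntervalIntegrable (fun r => firstOrder m z r ^ 2 / r) volume 1 b :=
    hi.mono_set (by rw [uIcc_of_le hb1, uIcc_of_le (ha1.trans hb1)]; exact Icc_subset_Icc_left ha1)
  -- Subtracting z(1)h₁ makes the boundary term at r = 1 vanish. Below 1 the exponent is p = 2m,
  -- above it p = -2m; the signs of p - 2 then make the outer boundary terms favorable, and m ≥ 3
  -- gives (p - 2)² ≥ 16.
  have y1 : z 1 / h1 m 1 - z 1 = 0 := by rw [h1_one]; ring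
  have k1 : ∫ r in a..1, (z r - z 1 * h1 m r) ^ 2 / r ^ 3 ≤
      ∫ r in a..1, firstOrder m z r ^ 2 / r := by
    refine hardy_of_comparable hz (z 1) (2 * m : ℕ) ha ha1 ?_ ?_ ?_ ?_ hi1
    · intro r hr
      have hr0 : 0 < r := ha.trans_le hr.1
      rw [zpow_natCast, pow_mul']
      exact pow_le_pow_left₀ (by positivity) (pow_le_h1 m hr0 hr.2) 2
    · intro r hr
      have hr0 : 0 < r := ha.trans_le hr.1
      have := h1_div_pow_le (m := m) le_rfl hr0
      rw [div_le_iff₀ (by positivity)] at this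
      rw [zpow_natCast, pow_mul']
      calc h1 m r ^ 2 ≤ (2 * r ^ m) ^ 2 := pow_le_pow_left₀ (h1_nonneg m hr0.le) this 2
        _ = _ := by ring
    · push_cast; nlinarith
    · rw [y1]
      push_cast
      have : 0 ≤ 2 * (m : ℝ) - 2 := by linarith
      have h2 : (0 : ℝ) < a ^ (2 * (m : ℤ)) := zpow_pos ha _
      simp only [ne_eq, OfNat.ofNat_ne_zero, not_false_eq_true, zero_pow, mul_zero]
      positivity
  have k2 : ∫ r in 1..b, (z r - z 1 * h1 m r) ^ 2 / r ^ 3 ≤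
      ∫ r in 1..b, firstOrder m z r ^ 2 / r := by
    refine hardy_of_comparable hz (z 1) (-(2 * m : ℕ)) one_pos hb1 ?_ ?_ ?_ ?_ hi2
    · intro r hr
      have hr0 : 0 < r := one_pos.trans_le hr.1
      rw [zpow_neg, zpow_natCast, pow_mul', inv_le_iff_one_le_mul₀ (by positivity), ← mul_pow]
      exact one_le_pow₀ (one_le_h1_mul_pow m hr.1)
    · intro r hr
      have hr0 : 0 < r := one_pos.trans_le hr.1
      have := h1_mul_pow_le (m := m) (j := m) (by omega) hr0
      rw [zpow_neg, zpow_natCast, pow_mul', ← div_eq_mul_inv, le_div_iff₀ (by positivity),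
        ← mul_pow]
      have h0 := h1_pos m hr0
      calc (h1 m r * r ^ m) ^ 2 ≤ 2 ^ 2 := pow_le_pow_left₀ (by positivity) this 2
        _ = 4 := by norm_num
    · push_cast; nlinarith
    · rw [y1]
      push_cast
      have h1 : -(2 * (m : ℝ)) - 2 ≤ 0 := by linarith
      have hb : 0 < b := by linarith
      have h2 : (0 : ℝ) < b ^ (-(2 * (m : ℤ))) := zpow_pos hb _
      simp only [ne_eq, OfNat.ofNat_ne_zero, not_false_eq_true, zero_pow, mul_zero]
      exact mul_nonpos_of_nonpos_of_nonneg h1 (by positivity)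
  rw [← intervalIntegral.integral_add_adjacent_intervals (hJ a 1 ha ha1) (hJ 1 b one_pos hb1),
    ← intervalIntegral.integral_add_adjacent_intervals hi1 hi2]
  exact add_le_add k1 k2

/-- Exhaustion by [1/(n+1), n+1], each of which contains 1. Testing only intervals around 1 matches
`hardy_h1`, where the kernel component is normalized at that point. -/
lemma integrableOn_of_integral_le {f : ℝ → ℝ} (h0 : ∀ r, 0 < r → 0 ≤ f r)
    (hf : ∀ a b, 0 < a → a ≤ b → IntervalIntegrable f volume a b) {M : ℝ}
    (hM : ∀ a b, 0 < a → a ≤ 1 → 1 ≤ b → ∫ r in a..b, f r ≤ M) :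
    IntegrableOn f (Ioi 0) ∧ ∫ r in Ioi (0 : ℝ), f r ≤ M := by
  set a : ℕ → ℝ := fun n => 1 / ((n : ℝ) + 1) with ha
  set b : ℕ → ℝ := fun n => (n : ℝ) + 1 with hb
  have a0 : ∀ n, 0 < a n := fun n => by simp only [ha]; positivity
  have a1 : ∀ n, a n ≤ 1 := fun n => (div_le_one (by positivity)).2 (by linarith [(n.cast_nonneg : (0 : ℝ) ≤ n)])
  have b1 : ∀ n, 1 ≤ b n := fun n => by simp only [hb]; linarith [(n.cast_nonneg : (0 : ℝ) ≤ n)]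
  have hta : Tendsto a atTop (𝓝 0) := tendsto_one_div_add_atTop_nhds_zero_nat
  have htb : Tendsto b atTop atTop :=
    tendsto_atTop_add_const_right _ _ tendsto_natCast_atTop_atTop
  have hcov : AECover (volume.restrict (Ioi (0 : ℝ))) atTop fun n => Ioi (a n) ∩ Iic (b n) :=
    (aecover_Ioi_of_Ioi hta).inter (aecover_Iic htb)
  have hres : ∀ n, (volume.restrict (Ioi (0 : ℝ))).restrict (Ioi (a n) ∩ Iic (b n)) =
      volume.restrict (Ioc (a n) (b n)) := by
    intro n
    rw [Measure.restrict_restrict (measurableSet_Ioi.inter measurableSet_Iic), Ioi_inter_Iic,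
      inter_eq_left.2]
    exact fun x hx => (a0 n).trans hx.1
  have hi : ∀ n, IntegrableOn f (Ioc (a n) (b n)) := fun n => by
    have := hf (a n) (b n) (a0 n) ((a1 n).trans (b1 n))
    rwa [intervalIntegrable_iff, uIoc_of_le ((a1 n).trans (b1 n))] at this
  have hint : ∀ n, ∫ r in Ioc (a n) (b n), f r ≤ M := fun n => by
    rw [← intervalIntegral.integral_of_le ((a1 n).trans (b1 n))]
    exact hM _ _ (a0 n) (a1 n) (b1 n)
  have hI : IntegrableOn f (Ioi 0) := by
    refine hcov.integrable_of_integral_norm_bounded M (fun n => ?_)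
      (Eventually.of_forall fun n => ?_)
    · rw [IntegrableOn, hres]
      exact hi n
    · rw [hres]
      refine le_trans (le_of_eq ?_) (hint n)
      refine setIntegral_congr_fun measurableSet_Ioc fun r hr => ?_
      exact (Real.norm_eq_abs _).trans (abs_of_nonneg (h0 r ((a0 n).trans hr.1)))
  refine ⟨hI, ?_⟩
  have := hcov.integral_tendsto_of_countably_generated hI
  refine le_of_tendsto this (Eventually.of_forall fun n => ?_)
  rw [hres]
  exact hint n

/-! ### Coercivity of the first order system on the orthogonal complement of `h₁` -/

lemma integrableOn_h1_sq_mul (m : ℕ) (hm : 2 ≤ m) : IntegrableOn (fun r => h1 m r ^ 2 * r) (Ioi 0) := by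
  have hc := continuous_h1 m
  refine integrableOn_of_abs_le (by fun_prop) 6 fun r hr => ?_
  have h0 := h1_pos m hr
  rw [abs_of_pos (by positivity)]
  have k1 := h1_mul_pow_le (m := m) (j := 1) (by omega) hr
  have k2 := h1_mul_pow_le (m := m) (j := 2) (by omega) hr
  have l1 := h1_le_one m hr.le
  have e : h1 m r ^ 2 * r * (1 + r ^ 2) = h1 m r * (h1 m r * r ^ 1) +
    (h1 m r * r ^ 1) * (h1 m r * r ^ 2) := by ring
  rw [e]
  have k3 : h1 m r * (h1 m r * r ^ 1) ≤ 1 * 2 := by gcongr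
  have k4 : (h1 m r * r ^ 1) * (h1 m r * r ^ 2) ≤ 2 * 2 := by gcongr
  linarith

/-- At infinity the integrand behaves like r^(5-2m), which is the source of the requirement m > 3.
The weight r⁵ is dual to r⁻³ with respect to r dr. -/
lemma integrableOn_h1_sq_mul_pow (m : ℕ) (hm : 4 ≤ m) :
    IntegrableOn (fun r => h1 m r ^ 2 * r ^ 5) (Ioi 0) := by
  have hc := continuous_h1 m
  refine integrableOn_of_abs_le (by fun_prop) 8 fun r hr => ?_
  have h0 := h1_pos m hr
  rw [abs_of_pos (by positivity)]
  have k2 := h1_mul_pow_le (m := m) (j := 2) (by omega) hr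
  have k3 := h1_mul_pow_le (m := m) (j := 3) (by omega) hr
  have k4 := h1_mul_pow_le (m := m) (j := 4) (by omega) hr
  have e : h1 m r ^ 2 * r ^ 5 * (1 + r ^ 2) = (h1 m r * r ^ 2) * (h1 m r * r ^ 3) +
    (h1 m r * r ^ 4) * (h1 m r * r ^ 3) := by ring
  rw [e]
  have l1 : (h1 m r * r ^ 2) * (h1 m r * r ^ 3) ≤ 2 * 2 := by gcongr
  have l2 : (h1 m r * r ^ 4) * (h1 m r * r ^ 3) ≤ 2 * 2 := by gcongr
  linarith

lemma integrableOn_h1_sq_div_cube (m : ℕ) (hm : 3 ≤ m) :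
    IntegrableOn (fun r => h1 m r ^ 2 / r ^ 3) (Ioi 0) := by
  have hc := (continuous_h1 m).measurable
  refine integrableOn_of_abs_le
    (by fun_prop : Measurable fun r => h1 m r ^ 2 / r ^ 3).aestronglyMeasurable 4 fun r hr => ?_
  have h0 := h1_pos m hr
  rw [abs_of_pos (by positivity)]
  have k1 := h1_div_pow_le (m := m) (j := 1) (by omega) hr
  have k3 := h1_div_pow_le (m := m) (j := 3) (by omega) hr
  have l1 := h1_le_one m hr.le
  have e : h1 m r ^ 2 / r ^ 3 * (1 + r ^ 2) = h1 m r * (h1 m r / r ^ 3) +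
    h1 m r * (h1 m r / r ^ 1) := by field_simp
  rw [e]
  have l2 : h1 m r * (h1 m r / r ^ 3) ≤ 1 * 2 := by gcongr
  have l3 : h1 m r * (h1 m r / r ^ 1) ≤ 1 * 2 := by gcongr
  linarith

/-- The mass `∫ h₁² r dr`. -/
noncomputable def mass (m : ℕ) : ℝ := ∫ r in Ioi (0 : ℝ), h1 m r ^ 2 * r

lemma integral_Ioi_pos {f : ℝ → ℝ} (hf : IntegrableOn f (Ioi 0)) (h : ∀ r, 0 < r → 0 < f r) :
    0 < ∫ r in Ioi (0 : ℝ), f r := by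
  rw [setIntegral_pos_iff_support_of_nonneg_ae _ hf]
  · have e : Function.support f ∩ Ioi 0 = Ioi 0 :=
      inter_eq_right.2 fun x hx => (h x hx).ne'
    rw [e]
    simp
  · exact (ae_restrict_iff' measurableSet_Ioi).2 (Eventually.of_forall fun x hx => (h x hx).le)

lemma mass_pos {m : ℕ} (hm : 2 ≤ m) : 0 < mass m :=
  integral_Ioi_pos (integrableOn_h1_sq_mul m hm) fun r hr => by
    have := h1_pos m hr
    positivity

/-- The component along the kernel is controlled by the rest for functions orthogonal to `h₁`. -/
lemma sq_apply_one_le {m : ℕ} (hm : 4 ≤ m) {z : ℝ → ℝ}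
    (hi : IntegrableOn (fun r => z r * h1 m r * r) (Ioi 0))
    (horth : ∫ r in Ioi (0 : ℝ), z r * h1 m r * r = 0)
    (hA : IntegrableOn (fun r => (z r - z 1 * h1 m r) ^ 2 / r ^ 3) (Ioi 0)) :
    z 1 ^ 2 ≤ (∫ r in Ioi (0 : ℝ), h1 m r ^ 2 * r ^ 5) / mass m ^ 2 *
      ∫ r in Ioi (0 : ℝ), (z r - z 1 * h1 m r) ^ 2 / r ^ 3 := by
  set A := ∫ r in Ioi (0 : ℝ), (z r - z 1 * h1 m r) ^ 2 / r ^ 3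
  set B := ∫ r in Ioi (0 : ℝ), h1 m r ^ 2 * r ^ 5
  have hB : 0 < B := integral_Ioi_pos (integrableOn_h1_sq_mul_pow m hm) fun r hr => by
    have := h1_pos m hr
    positivity
  have hκ := mass_pos (m := m) (by omega)
  -- By orthogonality z(1) ∫ h₁² r = -∫ (z - z(1)h₁) h₁ r, and Cauchy-Schwarz with weights r⁻³ and
  -- r⁵ bounds the right side. This is carried out by integrating a perfect square, with λ the
  -- minimizer of the resulting quadratic.
  set lam := z 1 * mass m / B with hlam
  have hi2 := integrableOn_h1_sq_mul m (by omega)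
  have hiB := integrableOn_h1_sq_mul_pow m hm
  have hid : IntegrableOn (fun r => z r * h1 m r * r - z 1 * (h1 m r ^ 2 * r)) (Ioi 0) :=
    hi.sub (hi2.const_mul _)
  have hAd : IntegrableOn (fun r => (z r - z 1 * h1 m r) ^ 2 / r ^ 3 +
      2 * lam * (z r * h1 m r * r - z 1 * (h1 m r ^ 2 * r))) (Ioi 0) :=
    hA.add (hid.const_mul _)
  have key : 0 ≤ A + 2 * lam * (0 - z 1 * mass m) + lam ^ 2 * B := by
    have e : A + 2 * lam * (0 - z 1 * mass m) + lam ^ 2 * B =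
        ∫ r in Ioi (0 : ℝ), ((z r - z 1 * h1 m r) ^ 2 / r ^ 3 +
          2 * lam * (z r * h1 m r * r - z 1 * (h1 m r ^ 2 * r)) +
          lam ^ 2 * (h1 m r ^ 2 * r ^ 5)) := by
      rw [integral_add hAd (hiB.const_mul _),
        integral_add hA (hid.const_mul _), integral_const_mul,
        integral_const_mul, integral_sub hi (hi2.const_mul _), integral_const_mul, horth]
      rfl
    rw [e]
    refine setIntegral_nonneg measurableSet_Ioi fun r (hr : 0 < r) => ?_
    have e2 : (z r - z 1 * h1 m r) ^ 2 / r ^ 3 +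
          2 * lam * (z r * h1 m r * r - z 1 * (h1 m r ^ 2 * r)) +
          lam ^ 2 * (h1 m r ^ 2 * r ^ 5) =
        (z r - z 1 * h1 m r + lam * h1 m r * r ^ 4) ^ 2 / r ^ 3 := by
      field_simp
      ring
    rw [e2]
    positivity
  have e3 : A + 2 * lam * (0 - z 1 * mass m) + lam ^ 2 * B = A - z 1 ^ 2 * mass m ^ 2 / B := by
    rw [hlam]
    field_simp
    ring
  rw [e3, sub_nonneg, div_le_iff₀ hB] at key
  rw [div_mul_eq_mul_div, le_div_iff₀ (by positivity)]
  linarith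

/-- Weighted coercivity of the operator `L₀` under small perturbations of lower order. -/
theorem exists_coercive {m : ℕ} (hm : 4 ≤ m) : ∃ ε : ℝ, 0 < ε ∧ ∃ C : ℝ, 0 < C ∧
    ∀ (z₁ z₂ G : ℝ → ℝ) (η : ℝ), LocAC z₁ → LocAC z₂ → 0 ≤ η → η ≤ ε →
      IntegrableOn (fun r => z₁ r * h1 m r * r) (Ioi 0) →
      IntegrableOn (fun r => z₂ r * h1 m r * r) (Ioi 0) →
      ∫ r in Ioi (0 : ℝ), z₁ r * h1 m r * r = 0 → ∫ r in Ioi (0 : ℝ), z₂ r * h1 m r * r = 0 →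
      IntegrableOn G (Ioi 0) → (∀ r, 0 < r → 0 ≤ G r) →
      (∀ᵐ r ∂(volume.restrict (Ioi (0 : ℝ))),
        (firstOrder m z₁ r ^ 2 + firstOrder m z₂ r ^ 2) / r ≤
          G r + η * ((z₁ r ^ 2 + z₂ r ^ 2) / r ^ 3)) →
      IntegrableOn (fun r => (z₁ r ^ 2 + z₂ r ^ 2) / r ^ 3) (Ioi 0) ∧
      ∫ r in Ioi (0 : ℝ), (z₁ r ^ 2 + z₂ r ^ 2) / r ^ 3 ≤ C * ∫ r in Ioi (0 : ℝ), G r := by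
  set c₃ := ∫ r in Ioi (0 : ℝ), h1 m r ^ 2 / r ^ 3 with hc₃
  set b₀ := (∫ r in Ioi (0 : ℝ), h1 m r ^ 2 * r ^ 5) / mass m ^ 2 with hb₀
  have hκ := mass_pos (m := m) (by omega)
  have hc0 : 0 < c₃ := integral_Ioi_pos (integrableOn_h1_sq_div_cube m (by omega)) fun r hr => by
    have := h1_pos m hr
    positivity
  have hb0 : 0 < b₀ := div_pos (integral_Ioi_pos (integrableOn_h1_sq_mul_pow m hm) fun r hr => by
    have := h1_pos m hr
    positivity) (by positivity)
  -- The 2 comes from splitting z into z - z(1)h₁ and z(1)h₁; the other term is the cost of the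
  -- second piece after z(1)² has been bounded by b₀ times the first. With ε = 1/(2C₀) the
  -- perturbation takes at most half of the left side.
  set C₀ := 2 + 2 * c₃ * b₀ with hC₀
  have hC0 : 2 ≤ C₀ := by
    have : 0 < 2 * c₃ * b₀ := by positivity
    linarith
  refine ⟨1 / (2 * C₀), by positivity, 2 * C₀, by positivity, ?_⟩
  intro z₁ z₂ G η hz₁ hz₂ hη0 hη hi₁ hi₂ ho₁ ho₂ hG hG0 hle
  have hηC : η * C₀ ≤ 1 / 2 := by
    calc η * C₀ ≤ 1 / (2 * C₀) * C₀ := by gcongr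
      _ = 1 / 2 := by field_simp
  have hη4 : η ≤ 1 / 4 := by nlinarith
  set n : ℝ → ℝ := fun r => (z₁ r ^ 2 + z₂ r ^ 2) / r ^ 3 with hn
  have hn0 : ∀ r, 0 < r → 0 ≤ n r := fun r hr => by simp only [hn]; positivity
  have hcont : ∀ {f : ℝ → ℝ}, ContinuousOn f (Ioi 0) → ∀ a b, 0 < a → a ≤ b →
      IntervalIntegrable f volume a b := fun hf a b ha hab =>
    (hf.mono (by rw [uIcc_of_le hab]; exact fun x hx => ha.trans_le hx.1)).intervalIntegrable
  have hpow : ∀ r ∈ Ioi (0 : ℝ), r ^ 3 ≠ 0 := fun r hr => by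
    have : (0 : ℝ) < r := hr
    positivity
  have c₁ := hz₁.continuousOn
  have c₂ := hz₂.continuousOn
  have ch := (continuous_h1 m).continuousOn (s := Ioi 0)
  have hni := hcont (f := n) (ContinuousOn.div (by fun_prop) (by fun_prop) hpow)
  have hti : ∀ {z : ℝ → ℝ}, ContinuousOn z (Ioi 0) → ∀ a b, 0 < a → a ≤ b →
      IntervalIntegrable (fun r => (z r - z 1 * h1 m r) ^ 2 / r ^ 3) volume a b := fun hz =>
    hcont (ContinuousOn.div (by fun_prop) (by fun_prop) hpow)
  have hhi := hcont (f := fun r => h1 m r ^ 2 / r ^ 3)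
    (ContinuousOn.div (by fun_prop) (by fun_prop) hpow)
  have hGi : ∀ a b, 0 < a → a ≤ b → IntervalIntegrable G volume a b := fun a b ha hab => by
    rw [intervalIntegrable_iff, uIoc_of_le hab]
    exact hG.mono_set fun x hx => ha.trans hx.1
  have hFm : ∀ {z : ℝ → ℝ}, LocAC z → AEStronglyMeasurable (fun r => firstOrder m z r ^ 2 / r)
      (volume.restrict (Ioi (0 : ℝ))) := fun {z} hz => by
    have k1 := measurable_deriv z
    have k2 := hz.aestronglyMeasurable.aemeasurable
    have k3 := (continuous_h3 m).measurable
    unfold firstOrder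
    exact (by fun_prop : AEMeasurable _ (volume.restrict (Ioi (0 : ℝ)))).aestronglyMeasurable
  have hF₁ : ∀ᵐ r ∂(volume.restrict (Ioi (0 : ℝ))),
      ‖firstOrder m z₁ r ^ 2 / r‖ ≤ G r + η * n r := by
    filter_upwards [hle, ae_restrict_mem measurableSet_Ioi] with r h (hr : 0 < r)
    rw [Real.norm_eq_abs, abs_of_nonneg (by positivity)]
    refine le_trans ?_ h
    gcongr
    exact le_add_of_nonneg_right (by positivity)
  have hF₂ : ∀ᵐ r ∂(volume.restrict (Ioi (0 : ℝ))),
      ‖firstOrder m z₂ r ^ 2 / r‖ ≤ G r + η * n r := by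
    filter_upwards [hle, ae_restrict_mem measurableSet_Ioi] with r h (hr : 0 < r)
    rw [Real.norm_eq_abs, abs_of_nonneg (by positivity)]
    refine le_trans ?_ h
    gcongr
    exact le_add_of_nonneg_left (by positivity)
  have hFi : ∀ {F : ℝ → ℝ}, AEStronglyMeasurable F (volume.restrict (Ioi (0 : ℝ))) →
      (∀ᵐ r ∂(volume.restrict (Ioi (0 : ℝ))), ‖F r‖ ≤ G r + η * n r) →
      ∀ a b, 0 < a → a ≤ b → IntervalIntegrable F volume a b := by
    intro F hFm hF a b ha hab
    have h1 := (hGi a b ha hab).add ((hni a b ha hab).const_mul η)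
    have hsub : Ioc a b ⊆ Ioi 0 := fun x hx => ha.trans hx.1
    rw [intervalIntegrable_iff, uIoc_of_le hab] at h1 ⊢
    exact Integrable.mono' h1 (hFm.mono_measure (Measure.restrict_mono hsub le_rfl))
      (ae_restrict_of_ae_restrict_of_subset hsub hF)
  have hFi₁ := hFi (hFm hz₁) hF₁
  have hFi₂ := hFi (hFm hz₂) hF₂
  have split : ∀ x y : ℝ, x ^ 2 ≤ 2 * (x - y) ^ 2 + 2 * y ^ 2 := fun x y => by
    nlinarith [sq_nonneg (x - 2 * y)]
  have hnle : ∀ r, 0 < r → n r ≤ 2 * ((z₁ r - z₁ 1 * h1 m r) ^ 2 / r ^ 3 +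
      (z₂ r - z₂ 1 * h1 m r) ^ 2 / r ^ 3) +
      2 * (z₁ 1 ^ 2 + z₂ 1 ^ 2) * (h1 m r ^ 2 / r ^ 3) := by
    intro r hr
    have e : 2 * ((z₁ r - z₁ 1 * h1 m r) ^ 2 / r ^ 3 +
      (z₂ r - z₂ 1 * h1 m r) ^ 2 / r ^ 3) +
      2 * (z₁ 1 ^ 2 + z₂ 1 ^ 2) * (h1 m r ^ 2 / r ^ 3) =
      ((2 * (z₁ r - z₁ 1 * h1 m r) ^ 2 + 2 * (z₁ 1 * h1 m r) ^ 2) +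
        (2 * (z₂ r - z₂ 1 * h1 m r) ^ 2 + 2 * (z₂ 1 * h1 m r) ^ 2)) / r ^ 3 := by ring
    rw [e]
    simp only [hn]
    gcongr
    · exact split _ _
    · exact split _ _
  have hh3 := integrableOn_h1_sq_div_cube m (by omega : 3 ≤ m)
  -- Absorption needs a finite left side, so finiteness comes first. On [a, b] everything is finite
  -- and η ≤ 1/4 suffices for absorbing; the bound still contains z₁(1) and z₂(1), but it is
  -- independent of a and b. Orthogonality is used only afterwards, for the quantitative bound.
  have hfin : IntegrableOn n (Ioi 0) := by
    refine (integrableOn_of_integral_le hn0 hni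
      (M := 4 * (∫ r in Ioi (0 : ℝ), G r) + 4 * (z₁ 1 ^ 2 + z₂ 1 ^ 2) * c₃) ?_).1
    intro a b ha ha1 hb1
    have hab := ha1.trans hb1
    have hsub : Ioc a b ⊆ Ioi 0 := fun x hx => ha.trans hx.1
    have t₁ := hti c₁ a b ha hab
    have t₂ := hti c₂ a b ha hab
    have H₁ := hardy_h1 (by omega) hz₁ ha ha1 hb1 (hFi₁ a b ha hab)
    have H₂ := hardy_h1 (by omega) hz₂ ha ha1 hb1 (hFi₂ a b ha hab)
    have k1 : ∫ r in a..b, n r ≤ 2 * ((∫ r in a..b, (z₁ r - z₁ 1 * h1 m r) ^ 2 / r ^ 3) +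
        ∫ r in a..b, (z₂ r - z₂ 1 * h1 m r) ^ 2 / r ^ 3) +
        2 * (z₁ 1 ^ 2 + z₂ 1 ^ 2) * ∫ r in a..b, h1 m r ^ 2 / r ^ 3 := by
      rw [← intervalIntegral.integral_add t₁ t₂, ← intervalIntegral.integral_const_mul,
        ← intervalIntegral.integral_const_mul, ← intervalIntegral.integral_add
          ((t₁.add t₂).const_mul 2) ((hhi a b ha hab).const_mul _)]
      exact intervalIntegral.integral_mono_on hab (hni a b ha hab)
        (((t₁.add t₂).const_mul 2).add ((hhi a b ha hab).const_mul _))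
        fun r hr => hnle r (ha.trans_le hr.1)
    have k2 : (∫ r in a..b, firstOrder m z₁ r ^ 2 / r) + ∫ r in a..b, firstOrder m z₂ r ^ 2 / r ≤
        (∫ r in a..b, G r) + η * ∫ r in a..b, n r := by
      rw [← intervalIntegral.integral_add (hFi₁ a b ha hab) (hFi₂ a b ha hab),
        ← intervalIntegral.integral_const_mul,
        ← intervalIntegral.integral_add (hGi a b ha hab) ((hni a b ha hab).const_mul η)]
      refine intervalIntegral.integral_mono_ae_restrict hab
        ((hFi₁ a b ha hab).add (hFi₂ a b ha hab))
        ((hGi a b ha hab).add ((hni a b ha hab).const_mul η)) ?_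
      have hsub' : Icc a b ⊆ Ioi 0 := fun x hx => ha.trans_le hx.1
      filter_upwards [ae_restrict_of_ae_restrict_of_subset hsub' hle] with r hr
      rw [← add_div]
      exact hr
    have k3 : ∫ r in a..b, G r ≤ ∫ r in Ioi (0 : ℝ), G r := by
      rw [intervalIntegral.integral_of_le hab]
      exact setIntegral_mono_set hG ((ae_restrict_iff' measurableSet_Ioi).2
        (Eventually.of_forall hG0)) hsub.eventuallyLE
    have k4 : ∫ r in a..b, h1 m r ^ 2 / r ^ 3 ≤ c₃ := by
      rw [intervalIntegral.integral_of_le hab]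
      exact setIntegral_mono_set hh3 ((ae_restrict_iff' measurableSet_Ioi).2
        (Eventually.of_forall fun r (hr : 0 < r) => by
          show 0 ≤ h1 m r ^ 2 / r ^ 3
          positivity)) hsub.eventuallyLE
    have k5 : 0 ≤ ∫ r in a..b, n r :=
      intervalIntegral.integral_nonneg hab fun r hr => hn0 r (ha.trans_le hr.1)
    have k6 : 2 * (z₁ 1 ^ 2 + z₂ 1 ^ 2) * ∫ r in a..b, h1 m r ^ 2 / r ^ 3 ≤
        2 * (z₁ 1 ^ 2 + z₂ 1 ^ 2) * c₃ := by gcongr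
    have k7 : η * ∫ r in a..b, n r ≤ 1 / 4 * ∫ r in a..b, n r := by gcongr
    linarith
  refine ⟨hfin, ?_⟩
  have hGn : IntegrableOn (fun r => G r + η * n r) (Ioi 0) := hG.add (hfin.const_mul η)
  have hS₁ : IntegrableOn (fun r => firstOrder m z₁ r ^ 2 / r) (Ioi 0) := hGn.mono' (hFm hz₁) hF₁
  have hS₂ : IntegrableOn (fun r => firstOrder m z₂ r ^ 2 / r) (Ioi 0) := hGn.mono' (hFm hz₂) hF₂
  have hT : ∀ {z : ℝ → ℝ}, LocAC z →
      IntegrableOn (fun r => firstOrder m z r ^ 2 / r) (Ioi 0) →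
      IntegrableOn (fun r => (z r - z 1 * h1 m r) ^ 2 / r ^ 3) (Ioi 0) ∧
      ∫ r in Ioi (0 : ℝ), (z r - z 1 * h1 m r) ^ 2 / r ^ 3 ≤
        ∫ r in Ioi (0 : ℝ), firstOrder m z r ^ 2 / r := by
    intro z hz hS
    refine integrableOn_of_integral_le (fun r hr => by positivity) (hti hz.continuousOn) ?_
    intro a b ha ha1 hb1
    have hab := ha1.trans hb1
    have hsub : Ioc a b ⊆ Ioi 0 := fun x hx => ha.trans hx.1
    have hFi : IntervalIntegrable (fun r => firstOrder m z r ^ 2 / r) volume a b := by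
      rw [intervalIntegrable_iff, uIoc_of_le hab]
      exact hS.mono_set hsub
    refine (hardy_h1 (by omega) hz ha ha1 hb1 hFi).trans ?_
    rw [intervalIntegral.integral_of_le hab]
    exact setIntegral_mono_set hS ((ae_restrict_iff' measurableSet_Ioi).2
      (Eventually.of_forall fun r (hr : 0 < r) => by
        show 0 ≤ firstOrder m z r ^ 2 / r
        positivity)) hsub.eventuallyLE
  obtain ⟨T₁, L₁⟩ := hT hz₁ hS₁
  obtain ⟨T₂, L₂⟩ := hT hz₂ hS₂
  have O₁ := sq_apply_one_le hm hi₁ ho₁ T₁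
  have O₂ := sq_apply_one_le hm hi₂ ho₂ T₂
  rw [← hb₀] at O₁ O₂
  have hT₁₂ : IntegrableOn (fun r => 2 * ((z₁ r - z₁ 1 * h1 m r) ^ 2 / r ^ 3 +
      (z₂ r - z₂ 1 * h1 m r) ^ 2 / r ^ 3)) (Ioi 0) := (T₁.add T₂).const_mul 2
  have k1 : ∫ r in Ioi (0 : ℝ), n r ≤
      2 * ((∫ r in Ioi (0 : ℝ), (z₁ r - z₁ 1 * h1 m r) ^ 2 / r ^ 3) +
        ∫ r in Ioi (0 : ℝ), (z₂ r - z₂ 1 * h1 m r) ^ 2 / r ^ 3) +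
        2 * (z₁ 1 ^ 2 + z₂ 1 ^ 2) * c₃ := by
    rw [← integral_add T₁ T₂, ← integral_const_mul, hc₃, ← integral_const_mul, ← integral_add
          hT₁₂ (hh3.const_mul _)]
    exact setIntegral_mono_on hfin (hT₁₂.add (hh3.const_mul _))
      measurableSet_Ioi hnle
  have k2 : (∫ r in Ioi (0 : ℝ), firstOrder m z₁ r ^ 2 / r) +
      ∫ r in Ioi (0 : ℝ), firstOrder m z₂ r ^ 2 / r ≤
        (∫ r in Ioi (0 : ℝ), G r) + η * ∫ r in Ioi (0 : ℝ), n r := by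
    rw [← integral_add hS₁ hS₂, ← integral_const_mul, ← integral_add hG (hfin.const_mul η)]
    refine integral_mono_ae (hS₁.add hS₂) hGn ?_
    filter_upwards [hle] with r hr
    rw [add_div] at hr
    exact hr
  set A₁ := ∫ r in Ioi (0 : ℝ), (z₁ r - z₁ 1 * h1 m r) ^ 2 / r ^ 3
  set A₂ := ∫ r in Ioi (0 : ℝ), (z₂ r - z₂ 1 * h1 m r) ^ 2 / r ^ 3
  set J := ∫ r in Ioi (0 : ℝ), n r with hJ
  have hJ0 : 0 ≤ J := setIntegral_nonneg measurableSet_Ioi fun r hr => hn0 r hr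
  have k3 : 2 * (z₁ 1 ^ 2 + z₂ 1 ^ 2) * c₃ ≤ 2 * (b₀ * A₁ + b₀ * A₂) * c₃ := by gcongr
  have k4 : J ≤ C₀ * (A₁ + A₂) := by rw [hC₀]; linarith
  have k5 : C₀ * (A₁ + A₂) ≤ C₀ * ((∫ r in Ioi (0 : ℝ), G r) + η * J) :=
    mul_le_mul_of_nonneg_left (by linarith) (by linarith)
  have k6 : C₀ * (η * J) ≤ 1 / 2 * J := by
    calc C₀ * (η * J) = η * C₀ * J := by ring
      _ ≤ _ := by gcongr
  linarith

/-! ### Estimates for profiles close to the harmonic map -/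

namespace IsClose

variable {m : ℕ} {δ : ℝ} {V : ℝ → R3}

lemma nonneg (hV : IsClose m δ V) : 0 ≤ δ := (abs_nonneg _).trans (hV.abs_coordJ_le 1 one_pos)

lemma abs_coordH_sub_one_le (hV : IsClose m δ V) (hδ : δ ≤ 1 / 2) {r : ℝ} (hr : 0 < r) :
    |coordH m V r - 1| ≤ δ := by
  have k1 := hV.abs_coordJ_le r hr
  have k2 := hV.abs_coordB_le r hr
  have hδ0 := hV.nonneg
  refine (hV.abs_coordH_le r hr).trans ?_
  have k3 : coordJ V r ^ 2 ≤ δ ^ 2 := sq_le_sq.2 (by rwa [abs_of_nonneg hδ0])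
  have k4 : coordB m V r ^ 2 ≤ δ ^ 2 := sq_le_sq.2 (by rwa [abs_of_nonneg hδ0])
  nlinarith

lemma integrableOn_coord_mul (hm : 3 ≤ m) {z : ℝ → ℝ} (hz : LocAC z)
    (hb : ∀ r, 0 < r → |z r| ≤ δ) : IntegrableOn (fun r => z r * h1 m r * r) (Ioi 0) := by
  refine ((integrableOn_h1_mul hm).const_mul δ).mono' ?_ ?_
  · exact (hz.aestronglyMeasurable.mul (continuous_h1 m).aestronglyMeasurable).mul
      continuous_id.aestronglyMeasurable
  · refine (ae_restrict_iff' measurableSet_Ioi).2 (Eventually.of_forall fun r (hr : 0 < r) => ?_)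
    have h0 := h1_pos m hr
    rw [Real.norm_eq_abs, abs_mul, abs_mul, abs_of_pos hr, abs_of_pos h0, mul_assoc]
    exact mul_le_mul_of_nonneg_right (hb r hr) (by positivity)

end IsClose

/-- Control of the perturbation by the deviation. -/
lemma exists_integral_coord_le {m : ℕ} (hm : 4 ≤ m) : ∃ δ₀ : ℝ, 0 < δ₀ ∧ δ₀ ≤ 1 / 2 ∧ ∃ C : ℝ, 0 < C ∧
    ∀ (δ : ℝ) (V : ℝ → R3), δ ≤ δ₀ → IsClose m δ V →
      ∫ r in Ioi (0 : ℝ), coordJ V r * h1 m r * r = 0 →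
      ∫ r in Ioi (0 : ℝ), coordB m V r * h1 m r * r = 0 →
      IntegrableOn (fun r => deviation m V r ⬝ᵥ deviation m V r / r) (Ioi 0) →
      IntegrableOn (fun r => (coordJ V r ^ 2 + coordB m V r ^ 2) / r ^ 3) (Ioi 0) ∧
      ∫ r in Ioi (0 : ℝ), (coordJ V r ^ 2 + coordB m V r ^ 2) / r ^ 3 ≤
        C * ∫ r in Ioi (0 : ℝ), deviation m V r ⬝ᵥ deviation m V r / r := by
  obtain ⟨ε, hε, C, hC, H⟩ := exists_coercive hm
  have hm0 : (0 : ℝ) < m := by exact_mod_cast (by omega : 0 < m)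
  refine ⟨min (1 / 2) (ε / (40 * m ^ 2)), by positivity, min_le_left _ _, 2 * C, by positivity, ?_⟩
  intro δ V hδ hV hoJ hoB hW
  have hδ0 := hV.nonneg
  have hδ1 : δ ≤ 1 / 2 := hδ.trans (min_le_left _ _)
  have hδ2 : δ ≤ ε / (40 * m ^ 2) := hδ.trans (min_le_right _ _)
  have hη : 40 * δ ^ 2 * m ^ 2 ≤ ε := by
    rw [le_div_iff₀ (by positivity)] at hδ2
    have : δ ^ 2 ≤ δ := by nlinarith
    calc 40 * δ ^ 2 * m ^ 2 ≤ 40 * δ * m ^ 2 := by gcongr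
      _ = δ * (40 * m ^ 2) := by ring
      _ ≤ ε := hδ2
  have := H (coordJ V) (coordB m V) (fun r => 2 * (deviation m V r ⬝ᵥ deviation m V r / r))
    (40 * δ ^ 2 * m ^ 2) hV.locAC_coordJ (hV.locAC_coordB m) (by positivity) hη
    (IsClose.integrableOn_coord_mul (by omega) hV.locAC_coordJ hV.abs_coordJ_le)
    (IsClose.integrableOn_coord_mul (by omega) (hV.locAC_coordB m) hV.abs_coordB_le) hoJ hoB
    (hW.const_mul 2)
    (fun r hr => mul_nonneg zero_le_two (div_nonneg (dot_self_nonneg _) hr.le)) ?_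
  · refine ⟨this.1, this.2.trans_eq ?_⟩
    rw [integral_const_mul]
    ring
  · filter_upwards [hV.firstOrder_sq_le hδ1, ae_restrict_mem measurableSet_Ioi] with r h (hr : 0 < r)
    rw [div_le_iff₀ hr]
    refine h.trans_eq ?_
    field_simp

lemma dot_pert_self {m : ℕ} {V : ℝ → R3} {r : ℝ} (hr : 0 < r) :
    (V r - harm m r) ⬝ᵥ (V r - harm m r) =
      coordJ V r ^ 2 + coordB m V r ^ 2 + (coordH m V r - 1) ^ 2 := by
  have k2 := h1_sq_add_h3_sq m hr.le
  unfold coordJ coordB coordH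
  simp only [dot3, harm, Pi.sub_apply, Matrix.cons_val]
  linear_combination (1 - V r 0 ^ 2 - V r 2 ^ 2) * k2

lemma IsClose.dot_pert_self_le {m : ℕ} {δ : ℝ} {V : ℝ → R3} (hV : IsClose m δ V) (hδ : δ ≤ 1 / 2)
    {r : ℝ} (hr : 0 < r) : (V r - harm m r) ⬝ᵥ (V r - harm m r) ≤
      2 * (coordJ V r ^ 2 + coordB m V r ^ 2) := by
  rw [dot_pert_self hr]
  have k1 := hV.abs_coordH_le r hr
  have k2 := hV.abs_coordH_sub_one_le hδ hr
  rw [← sq_abs (coordH m V r - 1)]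
  nlinarith [abs_nonneg (coordH m V r - 1)]

/-- The flux against a kernel of the linearized operator is quadratically small. -/
lemma IsClose.abs_flux_le {m : ℕ} {δ : ℝ} {V K E : ℝ → R3} (hm : 3 ≤ m) (hV : IsClose m δ V)
    (hδ : δ ≤ 1 / 2) (hK : IsKernel m K E) {c : ℝ → ℝ}
    (hc : ∀ r, 0 < r → |c r| ≤ m * h1 m r)
    (hKc : ∀ r, 0 < r → E r ⨯₃ harm m r - (m : ℝ) • (rotGen *ᵥ K r) = c r • harm m r)
    (hW : IntegrableOn (fun r => deviation m V r ⬝ᵥ deviation m V r / r) (Ioi 0))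
    (hz : IntegrableOn (fun r => (coordJ V r ^ 2 + coordB m V r ^ 2) / r ^ 3) (Ioi 0)) :
    |flux m V K| ≤ 15 * m * ((∫ r in Ioi (0 : ℝ), deviation m V r ⬝ᵥ deviation m V r / r) +
      2 * ∫ r in Ioi (0 : ℝ), (coordJ V r ^ 2 + coordB m V r ^ 2) / r ^ 3) := by
  rw [flux_eq_integral_deviation (by omega) hV.toIsUnitProfile hK, ← integral_const_mul 2,
    ← integral_add hW (hz.const_mul 2), ← integral_const_mul]
  rw [← Real.norm_eq_abs]
  refine norm_integral_le_of_norm_le ((hW.add (hz.const_mul 2)).const_mul _) ?_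
  filter_upwards [hV.locAC.ae_deriv_dot_eq_zero hV.unit, ae_restrict_mem measurableSet_Ioi] with
    r hd (hr : 0 < r)
  have hWV := deviation_dot_eq_zero (m := m) hd
  set W := deviation m V r with hWd
  set ξ := V r - harm m r with hξ
  have hVξ : V r = harm m r + ξ := by rw [hξ]; abel
  -- At V = h the bracket is c h, and W ⟂ V turns W · h into -W · ξ. The part of zeroth order in ξ
  -- thus disappears, leaving an expression bilinear in W and ξ.
  have e : W ⬝ᵥ (E r ⨯₃ V r - (m : ℝ) • (rotGen *ᵥ K r)) = W ⬝ᵥ (E r ⨯₃ ξ) - c r * (W ⬝ᵥ ξ) := by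
    have e1 : E r ⨯₃ V r - (m : ℝ) • (rotGen *ᵥ K r) = E r ⨯₃ ξ + c r • harm m r := by
      rw [← hKc r hr, hVξ, map_add]
      abel
    have e2 : W ⬝ᵥ harm m r = -(W ⬝ᵥ ξ) := by
      rw [hVξ, dotProduct_add] at hWV
      linarith
    rw [e1, dotProduct_add, dotProduct_smul, e2, smul_eq_mul]
    ring
  have h0 := h1_pos m hr
  have hm0 : (0 : ℝ) ≤ m := m.cast_nonneg
  have b1 : |W ⬝ᵥ (E r ⨯₃ ξ)| ≤ 12 * m * (h1 m r * (‖W‖ * ‖ξ‖)) := by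
    calc |W ⬝ᵥ (E r ⨯₃ ξ)| ≤ 3 * (‖W‖ * ‖E r ⨯₃ ξ‖) := abs_dot_le _ _
      _ ≤ 3 * (‖W‖ * (2 * ((2 * m * h1 m r) * ‖ξ‖))) := by
        gcongr
        refine (norm_cross_le _ _).trans ?_
        gcongr
        exact hK.norm_le' r hr
      _ = _ := by ring
  have b2 : |c r * (W ⬝ᵥ ξ)| ≤ 3 * m * (h1 m r * (‖W‖ * ‖ξ‖)) := by
    rw [abs_mul]
    calc |c r| * |W ⬝ᵥ ξ| ≤ m * h1 m r * (3 * (‖W‖ * ‖ξ‖)) :=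
          mul_le_mul (hc r hr) (abs_dot_le _ _) (abs_nonneg _) (by positivity)
      _ = _ := by ring
  -- The bound h₁ ≤ 2/r² provides exactly the weight r⁻² = r^(-1/2) r^(-3/2), and a perfect square
  -- then separates the two factors.
  have b3 : h1 m r * (‖W‖ * ‖ξ‖) ≤ ‖W‖ ^ 2 / r + ‖ξ‖ ^ 2 / r ^ 3 := by
    have k := h1_mul_pow_le (m := m) (j := 2) (by omega) hr
    rw [← le_div_iff₀ (by positivity)] at k
    calc h1 m r * (‖W‖ * ‖ξ‖) ≤ 2 / r ^ 2 * (‖W‖ * ‖ξ‖) := by gcongr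
      _ ≤ 2 / r ^ 2 * (‖W‖ * ‖ξ‖) + (‖W‖ - ‖ξ‖ / r) ^ 2 / r :=
        le_add_of_nonneg_right (by positivity)
      _ = _ := by field_simp; ring
  have b4 : ‖W‖ ^ 2 / r ≤ W ⬝ᵥ W / r := by
    gcongr
    exact norm_sq_le_dot W
  have b5 : ‖ξ‖ ^ 2 / r ^ 3 ≤ 2 * ((coordJ V r ^ 2 + coordB m V r ^ 2) / r ^ 3) := by
    rw [← mul_div_assoc]
    gcongr
    exact (norm_sq_le_dot ξ).trans (hV.dot_pert_self_le hδ hr)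
  rw [e, Real.norm_eq_abs]
  calc |W ⬝ᵥ (E r ⨯₃ ξ) - c r * (W ⬝ᵥ ξ)| ≤ 15 * m * (h1 m r * (‖W‖ * ‖ξ‖)) := by
        refine (abs_sub _ _).trans ?_
        linarith
    _ ≤ 15 * m * (W ⬝ᵥ W / r + 2 * ((coordJ V r ^ 2 + coordB m V r ^ 2) / r ^ 3)) := by
      gcongr
      linarith

/-- The first order form of the kernel equation: the tangential part cancels because h₁ĵ comes from
rotating the harmonic map. The remaining normal multiple of h is harmless against W. -/
lemma kernel1_cross_harm {m : ℕ} {r : ℝ} (hr : 0 < r) :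
    kernel1' m r ⨯₃ harm m r - (m : ℝ) • (rotGen *ᵥ kernel1 m r) =
      (m * h1 m r ^ 2) • harm m r := by
  have k2 := h1_sq_add_h3_sq m hr.le
  ext i
  simp only [cross3, rotGen_mulVec, kernel1, kernel1', harm, Pi.sub_apply, Pi.smul_apply, smul_eq_mul,
    Matrix.cons_val]
  fin_cases i <;> simp only [Fin.zero_eta, Fin.mk_one, Fin.reduceFinMk, Matrix.cons_val]
  · linear_combination (-(m * h1 m r)) * k2
  · ring
  · ring

/-- The analogous cancellation for the dilation direction, here with no normal remainder. -/
lemma kernel2_cross_harm {m : ℕ} {r : ℝ} (hr : 0 < r) :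
    kernel2' m r ⨯₃ harm m r - (m : ℝ) • (rotGen *ᵥ kernel2 m r) = (0 : ℝ) • harm m r := by
  have k2 := h1_sq_add_h3_sq m hr.le
  ext i
  simp only [cross3, rotGen_mulVec, kernel2, kernel2', harm, Pi.sub_apply, Pi.smul_apply, smul_eq_mul,
    Matrix.cons_val]
  fin_cases i <;> simp only [Fin.zero_eta, Fin.mk_one, Fin.reduceFinMk, Matrix.cons_val]
  · ring
  · linear_combination (-(m * h1 m r * h3 m r)) * k2
  · ring

/-! ### The coefficients of the modulation system -/

/-- Compares a coefficient of the modulation system with its value at V = h, which is always a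
multiple of `mass m`, the error being measured in ∫ h₁ r dr. -/
lemma abs_pairing_sub_le {m : ℕ} (hm : 3 ≤ m) {V w : ℝ → R3} {C k c : ℝ}
    (hVm : AEStronglyMeasurable V (volume.restrict (Ioi (0 : ℝ))))
    (hwm : AEStronglyMeasurable w (volume.restrict (Ioi (0 : ℝ))))
    (hV : ∀ r, 0 < r → ‖V r‖ ≤ 1) (hw : ∀ r, 0 < r → ‖w r‖ ≤ C * h1 m r)
    (h : ∀ r, 0 < r → |V r ⬝ᵥ w r - k * h1 m r ^ 2| ≤ c * h1 m r) :
    |pairing V w - k * mass m| ≤ c * ∫ r in Ioi (0 : ℝ), h1 m r * r := by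
  have hi := integrableOn_pairing hm hVm hwm hV hw
  have h2 := (integrableOn_h1_sq_mul m (by omega)).const_mul k
  rw [pairing, mass, ← integral_const_mul, ← integral_sub hi h2, ← integral_const_mul]
  rw [← Real.norm_eq_abs]
  refine norm_integral_le_of_norm_le ((integrableOn_h1_mul hm).const_mul c) ?_
  refine (ae_restrict_iff' measurableSet_Ioi).2 (Eventually.of_forall fun r (hr : 0 < r) => ?_)
  have e : (V r ⬝ᵥ w r) * r - k * (h1 m r ^ 2 * r) = (V r ⬝ᵥ w r - k * h1 m r ^ 2) * r := by ring
  rw [e, Real.norm_eq_abs, abs_mul, abs_of_pos hr, ← mul_assoc]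
  exact mul_le_mul_of_nonneg_right (h r hr) hr.le

namespace IsClose

variable {m : ℕ} {δ : ℝ} {V : ℝ → R3}

/-- At V = h the coefficient vanishes because h has no component along ĵ. Likewise the rotated
second kernel pairs to 0 with h, while the other two coefficients become -mκ and -κ with κ = `mass
m`; the limiting system is antidiagonal. -/
lemma abs_pairing_kernel1' (hm : 3 ≤ m) (hV : IsClose m δ V) :
    |pairing V (kernel1' m)| ≤ m * δ * ∫ r in Ioi (0 : ℝ), h1 m r * r := by
  have := abs_pairing_sub_le hm (k := 0) (c := m * δ) hV.locAC.aestronglyMeasurable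
    (isKernel1 m).continuous.aestronglyMeasurable (fun r hr => hV.norm_le_one hr)
    (isKernel1 m).norm_le' fun r hr => ?_
  · simpa using this
  · have e : V r ⬝ᵥ kernel1' m r - 0 * h1 m r ^ 2 = -(m * h1 m r * (h3 m r * coordJ V r)) := by
      simp only [dot3, kernel1', Matrix.cons_val, coordJ]
      ring
    have h0 := h1_pos m hr
    have hm0 : (0 : ℝ) ≤ m := m.cast_nonneg
    rw [e, abs_neg, abs_mul, abs_of_nonneg (by positivity), abs_mul]
    have := mul_le_mul (abs_h3_le_one m hr.le) (hV.abs_coordJ_le r hr) (abs_nonneg _) zero_le_one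
    calc m * h1 m r * (|h3 m r| * |coordJ V r|) ≤ m * h1 m r * (1 * δ) := by gcongr
      _ = _ := by ring

lemma abs_pairing_rotGen_kernel2 (hm : 3 ≤ m) (hV : IsClose m δ V) :
    |pairing V (fun r => rotGen *ᵥ kernel2 m r)| ≤ δ * ∫ r in Ioi (0 : ℝ), h1 m r * r := by
  have := abs_pairing_sub_le hm
    (w := fun r => rotGen *ᵥ kernel2 m r) (k := 0) (c := δ) (C := 1)
    hV.locAC.aestronglyMeasurable
    (continuous_rotGen.comp (isKernel2 m).contDiff.continuous).aestronglyMeasurable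
    (fun r hr => hV.norm_le_one hr)
    (fun r hr => by
      rw [one_mul]; exact (norm_rotGen_le _).trans ((isKernel2 m).norm_le r hr)) fun r hr => ?_
  · simpa using this
  · have e : V r ⬝ᵥ (rotGen *ᵥ kernel2 m r) - 0 * h1 m r ^ 2 =
        -(h1 m r * (h3 m r * coordJ V r)) := by
      simp only [dot3, kernel2, rotGen_mulVec, Matrix.cons_val, coordJ]
      ring
    have h0 := h1_pos m hr
    rw [e, abs_neg, abs_mul, abs_of_nonneg h0.le, abs_mul]
    have := mul_le_mul (abs_h3_le_one m hr.le) (hV.abs_coordJ_le r hr) (abs_nonneg _) zero_le_one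
    calc h1 m r * (|h3 m r| * |coordJ V r|) ≤ h1 m r * (1 * δ) := by gcongr
      _ = _ := by ring

lemma abs_combination_le (hV : IsClose m δ V) (hδ : δ ≤ 1 / 2) {r : ℝ} (hr : 0 < r) :
    |h3 m r * coordB m V r| + |h1 m r * (coordH m V r - 1)| ≤ 2 * δ := by
  have k1 := mul_le_mul (abs_h3_le_one m hr.le) (hV.abs_coordB_le r hr) (abs_nonneg _) zero_le_one
  have k2 := mul_le_mul (h1_le_one m hr.le) (hV.abs_coordH_sub_one_le hδ hr) (abs_nonneg _)
    zero_le_one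
  rw [abs_mul, abs_mul, abs_of_pos (h1_pos m hr)]
  linarith

lemma abs_pairing_kernel2' (hm : 3 ≤ m) (hV : IsClose m δ V) (hδ : δ ≤ 1 / 2) :
    |pairing V (kernel2' m) + m * mass m| ≤ m * (2 * δ) * ∫ r in Ioi (0 : ℝ), h1 m r * r := by
  have := abs_pairing_sub_le hm (k := -m) (c := m * (2 * δ)) hV.locAC.aestronglyMeasurable
    (isKernel2 m).continuous.aestronglyMeasurable (fun r hr => hV.norm_le_one hr)
    (isKernel2 m).norm_le' fun r hr => ?_
  · rwa [neg_mul, sub_neg_eq_add] at this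
  · have e : V r ⬝ᵥ kernel2' m r - -m * h1 m r ^ 2 =
        -(m * h1 m r * (h3 m r * coordB m V r + h1 m r * (coordH m V r - 1))) := by
      simp only [dot3, kernel2', Matrix.cons_val, coordB, coordH]
      ring
    have h0 := h1_pos m hr
    have hm0 : (0 : ℝ) ≤ m := m.cast_nonneg
    rw [e, abs_neg, abs_mul, abs_of_nonneg (by positivity)]
    calc m * h1 m r * |h3 m r * coordB m V r + h1 m r * (coordH m V r - 1)|
        ≤ m * h1 m r * (2 * δ) := by
          gcongr
          exact (abs_add_le _ _).trans (hV.abs_combination_le hδ hr)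
      _ = _ := by ring

lemma abs_pairing_rotGen_kernel1 (hm : 3 ≤ m) (hV : IsClose m δ V) (hδ : δ ≤ 1 / 2) :
    |pairing V (fun r => rotGen *ᵥ kernel1 m r) + mass m| ≤
      2 * δ * ∫ r in Ioi (0 : ℝ), h1 m r * r := by
  have := abs_pairing_sub_le hm
    (w := fun r => rotGen *ᵥ kernel1 m r) (k := -1) (c := 2 * δ) (C := 1)
    hV.locAC.aestronglyMeasurable
    (continuous_rotGen.comp (isKernel1 m).contDiff.continuous).aestronglyMeasurable
    (fun r hr => hV.norm_le_one hr)
    (fun r hr => by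
      rw [one_mul]; exact (norm_rotGen_le _).trans ((isKernel1 m).norm_le r hr)) fun r hr => ?_
  · rwa [neg_one_mul, sub_neg_eq_add] at this
  · have hh := h1_sq_add_h3_sq m hr.le
    have e : V r ⬝ᵥ (rotGen *ᵥ kernel1 m r) - -1 * h1 m r ^ 2 =
        h1 m r * (h3 m r * coordB m V r - h1 m r * (coordH m V r - 1)) := by
      simp only [dot3, kernel1, rotGen_mulVec, Matrix.cons_val, coordB, coordH]
      linear_combination (h1 m r * V r 0) * hh
    have h0 := h1_pos m hr
    rw [e, abs_mul, abs_of_nonneg h0.le]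
    calc h1 m r * |h3 m r * coordB m V r - h1 m r * (coordH m V r - 1)| ≤ h1 m r * (2 * δ) := by
          gcongr
          exact (abs_sub _ _).trans (hV.abs_combination_le hδ hr)
      _ = _ := by ring

end IsClose

/-! ### The modulation equations -/

lemma pairing_smul (v w : ℝ → R3) (c : ℝ) : pairing v (fun r => c • w r) = c * pairing v w := by
  rw [pairing, pairing, ← integral_const_mul]
  refine integral_congr_ae (Eventually.of_forall fun r => ?_)
  simp only [dotProduct_smul, smul_eq_mul]
  ring

lemma pairing_kernel1 (m : ℕ) (V : ℝ → R3) :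
    pairing V (kernel1 m) = ∫ r in Ioi (0 : ℝ), coordJ V r * h1 m r * r := by
  refine integral_congr_ae (Eventually.of_forall fun r => ?_)
  simp only [dot3, kernel1, coordJ, Matrix.cons_val]
  ring

lemma pairing_kernel2 (m : ℕ) (V : ℝ → R3) :
    pairing V (kernel2 m) = ∫ r in Ioi (0 : ℝ), coordB m V r * h1 m r * r := by
  refine integral_congr_ae (Eventually.of_forall fun r => ?_)
  simp only [dot3, kernel2, coordB, Matrix.cons_val]
  ring

/-- Orthogonality holds at every time in I, so the increment caused by the moving kernels is exactly
minus the increment caused by v, and Cramer's rule for difference quotients applies. The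
coefficients and fluxes are rewritten in terms of V, which brings out the powers of s. -/
lemma hasDerivWithinAt_modulation {m : ℕ} (hm : 3 ≤ m) {I : Set ℝ} (hI : I.OrdConnected)
    {v : ℝ → ℝ → R3} (hv : ∀ t ∈ I, IsSigmaProfile m (v t))
    (hu : IsWeakSchrodingerFlow I (fun t => equivariantMap m (v t))) {s α : ℝ → ℝ}
    (hs : ContinuousOn s I) (hs0 : ∀ t ∈ I, 0 < s t) (hα : ContinuousOn α I)
    (ho₁ : ∀ t ∈ I, pairing (normalized (s t) (α t) (v t)) (kernel1 m) = 0)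
    (ho₂ : ∀ t ∈ I, pairing (normalized (s t) (α t) (v t)) (kernel2 m) = 0)
    {t : ℝ} (ht : t ∈ I) {V : ℝ → R3} (hV : V = normalized (s t) (α t) (v t))
    {e₁ e₂ g₁ g₂ f₁ f₂ : ℝ} (he₁ : e₁ = pairing V (kernel1' m)) (he₂ : e₂ = pairing V (kernel2' m))
    (hg₁ : g₁ = pairing V fun r => rotGen *ᵥ kernel1 m r)
    (hg₂ : g₂ = pairing V fun r => rotGen *ᵥ kernel2 m r)
    (hf₁ : f₁ = flux m V (kernel1 m)) (hf₂ : f₂ = flux m V (kernel2 m))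
    (hdet : e₁ * g₂ - e₂ * g₁ ≠ 0) :
    HasDerivWithinAt s (-(s t * (((s t) ^ 2)⁻¹ * ((f₁ * g₂ - f₂ * g₁) / (e₁ * g₂ - e₂ * g₁))))) I t ∧
      HasDerivWithinAt α (((s t) ^ 2)⁻¹ * ((f₂ * e₁ - f₁ * e₂) / (e₁ * g₂ - e₂ * g₁))) I t := by
  have hst := hs0 t ht
  have hec := isEnergyContinuous_of_flow hv hu
  obtain ⟨a₁, b₁, h₁, ha₁, hb₁⟩ := (isKernel1 m).exists_increment hm hec hs hα ht hst
  obtain ⟨a₂, b₂, h₂, ha₂, hb₂⟩ := (isKernel2 m).exists_increment hm hec hs hα ht hst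
  obtain ⟨C₁, hC₁⟩ := (isKernel1 m).decays_moved (by omega) hst (α t)
  obtain ⟨C₂, hC₂⟩ := (isKernel2 m).decays_moved (by omega) hst (α t)
  have hP₁ := hasDerivWithinAt_pairing hm hI hv hu hC₁ ht
  have hP₂ := hasDerivWithinAt_pairing hm hI hv hu hC₂ ht
  rw [pairing_smul, pairing_moved _ _ hst, ← hV, ← he₁] at ha₁
  rw [pairing_smul, pairing_moved _ _ hst, ← hV, ← he₂] at ha₂
  rw [pairing_moved _ _ hst, ← hV, ← hg₁] at hb₁
  rw [pairing_moved _ _ hst, ← hV, ← hg₂] at hb₂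
  rw [flux_moved (isKernel1 m) _ hst, ← hV, ← hf₁] at hP₁
  rw [flux_moved (isKernel2 m) _ hst, ← hV, ← hf₂] at hP₂
  have hzero : ∀ {K : ℝ → R3}, (∀ t ∈ I, pairing (normalized (s t) (α t) (v t)) K = 0) →
      ∀ τ ∈ I, pairing (v τ) (moved K (s τ) (α τ)) = 0 := fun h τ hτ => by
    rw [pairing_moved _ _ (hs0 τ hτ), h τ hτ, mul_zero]
  have k₁ : ∀ᶠ τ in 𝓝[I] t, (s τ - s t) * a₁ τ + (α τ - α t) * b₁ τ =
      -(pairing (v τ) (moved (kernel1 m) (s t) (α t)) -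
        pairing (v t) (moved (kernel1 m) (s t) (α t))) := by
    filter_upwards [h₁, self_mem_nhdsWithin] with τ h hτ
    rw [h, hzero ho₁ τ hτ, hzero ho₁ t ht]
    ring
  have k₂ : ∀ᶠ τ in 𝓝[I] t, (s τ - s t) * a₂ τ + (α τ - α t) * b₂ τ =
      -(pairing (v τ) (moved (kernel2 m) (s t) (α t)) -
        pairing (v t) (moved (kernel2 m) (s t) (α t))) := by
    filter_upwards [h₂, self_mem_nhdsWithin] with τ h hτ
    rw [h, hzero ho₂ τ hτ, hzero ho₂ t ht]
    ring
  -- The pairings each carry s², and the dilation derivative carries -1/s, so the determinant is -s³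
  -- times the normalized one.
  have hd : -(1 / s t) * (s t ^ 2 * e₁) * (s t ^ 2 * g₂) -
      -(1 / s t) * (s t ^ 2 * e₂) * (s t ^ 2 * g₁) = -(s t ^ 3 * (e₁ * g₂ - e₂ * g₁)) := by
    field_simp
    ring
  have := hasDerivWithinAt_of_linear_system k₁ k₂ ha₁ ha₂ hb₁ hb₂ hP₁ hP₂ (by
    rw [hd]
    exact neg_ne_zero.2 (mul_ne_zero (by positivity) hdet))
  rw [hd] at this
  refine ⟨this.1.congr_deriv ?_, this.2.congr_deriv ?_⟩
  · field_simp
    ring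
  · field_simp
    ring

/-- Solution of a linear system close to `[[0, -κ], [-mκ, 0]]`. -/
lemma abs_cramer_le {μ κ e₁ e₂ g₁ g₂ f₁ f₂ : ℝ} (hμ : 1 ≤ μ) (hκ : 0 < κ)
    (he₁ : |e₁| ≤ μ * (κ / 4)) (he₂ : |e₂ + μ * κ| ≤ μ * (κ / 4)) (hg₁ : |g₁ + κ| ≤ κ / 4)
    (hg₂ : |g₂| ≤ κ / 4) :
    e₁ * g₂ - e₂ * g₁ ≠ 0 ∧
      |(f₁ * g₂ - f₂ * g₁) / (e₁ * g₂ - e₂ * g₁)| + |(f₂ * e₁ - f₁ * e₂) / (e₁ * g₂ - e₂ * g₁)| ≤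
        5 / κ * (|f₁| + |f₂|) := by
  have hμ0 : 0 < μ := by linarith
  have h1 : |e₁ * g₂| ≤ μ * (κ / 4) * (κ / 4) := by
    rw [abs_mul]
    exact mul_le_mul he₁ hg₂ (abs_nonneg _) (by positivity)
  obtain ⟨l2, u2⟩ := abs_le.1 he₂
  obtain ⟨l1, u1⟩ := abs_le.1 hg₁
  have a2 : |e₂| ≤ μ * (5 / 4 * κ) := by
    rw [abs_le]
    have : 0 < μ * κ := by positivity
    constructor <;> linarith
  have b1 : |g₁| ≤ 5 / 4 * κ := by
    rw [abs_le]
    constructor <;> linarith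
  have h2 : μ * (3 / 4 * κ) * (3 / 4 * κ) ≤ (-e₂) * (-g₁) := by
    refine mul_le_mul ?_ ?_ (by positivity) ?_
    · linarith
    · linarith
    · have : 0 < μ * κ := by positivity
      linarith
  -- The antidiagonal product is at least (3/4)² and the diagonal one at most (1/4)², in units of
  -- μκ²; the difference is 1/2.
  have hD : μ * κ ^ 2 / 2 ≤ -(e₁ * g₂ - e₂ * g₁) := by
    have := (abs_le.1 h1).2
    linarith
  have hD0 : 0 < μ * κ ^ 2 / 2 := by positivity
  have hne : e₁ * g₂ - e₂ * g₁ ≠ 0 := by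
    intro h
    rw [h] at hD
    linarith
  refine ⟨hne, ?_⟩
  have hDa : μ * κ ^ 2 / 2 ≤ |e₁ * g₂ - e₂ * g₁| := hD.trans (neg_le_abs _)
  rw [abs_div, abs_div, ← add_div, div_le_iff₀ (abs_pos.2 hne)]
  have n1 : |f₁ * g₂ - f₂ * g₁| ≤ 5 / 4 * κ * (|f₁| + |f₂|) := by
    refine (abs_sub _ _).trans ?_
    rw [abs_mul, abs_mul]
    have p1 : |f₁| * |g₂| ≤ |f₁| * (5 / 4 * κ) := by gcongr; linarith
    have p2 : |f₂| * |g₁| ≤ |f₂| * (5 / 4 * κ) := by gcongr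
    linarith
  have n2 : |f₂ * e₁ - f₁ * e₂| ≤ 5 / 4 * (μ * κ) * (|f₁| + |f₂|) := by
    refine (abs_sub _ _).trans ?_
    rw [abs_mul, abs_mul]
    have : 0 < μ * κ := by positivity
    have p1 : |f₂| * |e₁| ≤ |f₂| * (5 / 4 * (μ * κ)) := by gcongr; linarith
    have p2 : |f₁| * |e₂| ≤ |f₁| * (5 / 4 * (μ * κ)) := by gcongr; linarith
    linarith
  have hF : 0 ≤ |f₁| + |f₂| := by positivity
  calc |f₁ * g₂ - f₂ * g₁| + |f₂ * e₁ - f₁ * e₂|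
      ≤ 5 / 4 * κ * (|f₁| + |f₂|) + 5 / 4 * (μ * κ) * (|f₁| + |f₂|) := add_le_add n1 n2
    _ ≤ 5 / 4 * (μ * κ) * (|f₁| + |f₂|) + 5 / 4 * (μ * κ) * (|f₁| + |f₂|) := by
      gcongr
      nlinarith
    _ = 5 / κ * (|f₁| + |f₂|) * (μ * κ ^ 2 / 2) := by field_simp; ring
    _ ≤ _ := by gcongr

/-- The real and imaginary parts of the orthogonality condition. -/
lemma IsClose.pairing_eq_zero {m : ℕ} (hm : 3 ≤ m) {δ s α : ℝ} {v : ℝ → R3}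
    (hV : IsClose m δ (normalized s α v))
    (h : ∫ ρ in Ioi (0 : ℝ), zCoord m s α v ρ * (h1 m ρ : ℂ) * (ρ : ℂ) = 0) :
    pairing (normalized s α v) (kernel1 m) = 0 ∧ pairing (normalized s α v) (kernel2 m) = 0 := by
  set V := normalized s α v with hVd
  have i₁ := IsClose.integrableOn_coord_mul hm hV.locAC_coordJ hV.abs_coordJ_le
  have i₂ := IsClose.integrableOn_coord_mul hm (hV.locAC_coordB m) hV.abs_coordB_le
  have e : ∫ ρ in Ioi (0 : ℝ), zCoord m s α v ρ * (h1 m ρ : ℂ) * (ρ : ℂ) =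
      ((∫ ρ in Ioi (0 : ℝ), coordJ V ρ * h1 m ρ * ρ : ℝ) : ℂ) +
        ((∫ ρ in Ioi (0 : ℝ), coordB m V ρ * h1 m ρ * ρ : ℝ) : ℂ) * Complex.I := by
    rw [← integral_complex_ofReal, ← integral_complex_ofReal, ← integral_mul_const, ← integral_add]
    · refine integral_congr_ae (Eventually.of_forall fun r => ?_)
      simp only [zCoord_eq, ← hVd]
      apply Complex.ext <;> simp
    · exact i₁.ofReal
    · exact i₂.ofReal.mul_const _
  rw [e] at h
  have hre := congrArg Complex.re h
  have him := congrArg Complex.im h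
  rw [pairing_kernel1, pairing_kernel2]
  constructor
  · simpa using hre
  · simpa using him

end SchrodingerMap

/-! ### The modulation estimate. -/

open SchrodingerMap in
theorem corollary2p4 (m : ℕ) (hm : 3 < m) :
    ∃ δ : ℝ, 0 < δ ∧ ∃ C : ℝ, 0 < C ∧
      ∀ (I : Set ℝ), I.OrdConnected → I.Nontrivial →
      ∀ (v : ℝ → ℝ → SchrodingerMap.R3) (s α : ℝ → ℝ) (e : ℝ → ℝ → SchrodingerMap.R3),
        (∀ t ∈ I, SchrodingerMap.IsSigmaProfile m (v t)) →
        SchrodingerMap.IsWeakSchrodingerFlow I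
          (fun t => SchrodingerMap.equivariantMap m (v t)) →
        (∀ t ∈ I, SchrodingerMap.IsGaugeFrame (v t) (e t)) →
        ContinuousOn s I → (∀ t ∈ I, 0 < s t) → ContinuousOn α I →
        (∀ t ∈ I, ∫ ρ in Set.Ioi (0 : ℝ),
          SchrodingerMap.zCoord m (s t) (α t) (v t) ρ * (SchrodingerMap.h1 m ρ : ℂ) * (ρ : ℂ)
            = 0) →
        (∀ t ∈ I, SchrodingerMap.xNorm (SchrodingerMap.zCoord m (s t) (α t) (v t))
          ≤ ENNReal.ofReal δ) →
        DifferentiableOn ℝ s I ∧ DifferentiableOn ℝ α I ∧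
        ∀ t ∈ I,
          ENNReal.ofReal (|derivWithin s I t / s t| + |derivWithin α I t|)
            ≤ ENNReal.ofReal C *
              SchrodingerMap.sqNormDivR (SchrodingerMap.hasimoto m (v t) (e t)) := by
  have hm3 : 3 ≤ m := hm.le
  have hm1 : (1 : ℝ) ≤ m := by exact_mod_cast (by omega : 1 ≤ m)
  obtain ⟨δ₀, hδ₀, hδ₀', C₁, hC₁, hcoer⟩ := exists_integral_coord_le (m := m) hm
  have hκ := mass_pos (m := m) (by omega)
  set κ := mass m with hκd
  set c := ∫ r in Ioi (0 : ℝ), SchrodingerMap.h1 m r * r with hc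
  have hc0 : 0 < c := integral_Ioi_pos (integrableOn_h1_mul hm3) fun r hr =>
    mul_pos (h1_pos m hr) hr
  -- The first bound is for coercivity; the second gives 2δc ≤ κ/4, the closeness to the limiting
  -- matrix demanded by `abs_cramer_le`.
  set δ := min δ₀ (κ / (8 * c)) with hδd
  have hδ : 0 < δ := lt_min hδ₀ (by positivity)
  have hδh : δ ≤ 1 / 2 := (min_le_left _ _).trans hδ₀'
  have hδc : 2 * δ * c ≤ κ / 4 := by
    have : δ ≤ κ / (8 * c) := min_le_right _ _
    rw [le_div_iff₀ (by positivity)] at this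
    linarith
  -- The factor 5/κ inverts the system; each of the two fluxes is at most 15m(1 + 2C₁) times the
  -- integral of |W|²/r, where 2C₁ pays for replacing ξ by W.
  set C := 5 / κ * (30 * m * (1 + 2 * C₁)) with hC
  refine ⟨δ, hδ, C, by positivity, ?_⟩
  intro I hI hIn v s α e hv hu he hs hs0 hα horth hX
  have hclose : ∀ t ∈ I, IsClose m δ (normalized (s t) (α t) (v t)) := by
    intro t ht
    refine ((hv t ht).normalized (hs0 t ht) (α t)).isClose (by omega) hδ.le hδh ?_
    have := hX t ht
    rwa [show zCoord m (s t) (α t) (v t) = fun ρ => _ from funext fun ρ => zCoord_eq _ _ _ _ ρ]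
      at this
  have ho := fun t ht => (hclose t ht).pairing_eq_zero hm3 (horth t ht)
  have key : ∀ t ∈ I, ∃ s' α' : ℝ, HasDerivWithinAt s s' I t ∧ HasDerivWithinAt α α' I t ∧
      ENNReal.ofReal (|s' / s t| + |α'|) ≤
        ENNReal.ofReal C * sqNormDivR (hasimoto m (v t) (e t)) := by
    intro t ht
    have hst := hs0 t ht
    have hV := hclose t ht
    set V := normalized (s t) (α t) (v t) with hVd
    set e₁ := pairing V (kernel1' m) with he₁
    set e₂ := pairing V (kernel2' m) with he₂
    set g₁ := pairing V (fun r => rotGen *ᵥ kernel1 m r) with hg₁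
    set g₂ := pairing V (fun r => rotGen *ᵥ kernel2 m r) with hg₂
    set f₁ := flux m V (kernel1 m) with hf₁
    set f₂ := flux m V (kernel2 m) with hf₂
    have hδc0 : 0 < δ * c := by positivity
    obtain ⟨hdet, hbound⟩ := abs_cramer_le (f₁ := f₁) (f₂ := f₂) hm1 hκ
      (e₁ := e₁) (e₂ := e₂) (g₁ := g₁) (g₂ := g₂)
      ((hV.abs_pairing_kernel1' hm3).trans (by
        rw [mul_assoc]
        gcongr
        linarith))
      ((hV.abs_pairing_kernel2' hm3 hδh).trans (by
        rw [mul_assoc]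
        gcongr))
      ((hV.abs_pairing_rotGen_kernel1 hm3 hδh).trans hδc)
      ((hV.abs_pairing_rotGen_kernel2 hm3).trans (by linarith))
    obtain ⟨d₁, d₂⟩ := hasDerivWithinAt_modulation hm3 hI hv hu hs hs0 hα (fun τ hτ => (ho τ hτ).1)
      (fun τ hτ => (ho τ hτ).2) ht hVd he₁ he₂ hg₁ hg₂ hf₁ hf₂ hdet
    refine ⟨_, _, d₁, d₂, ?_⟩
    -- The derivatives have already been found without using q, so an infinite right side leaves
    -- nothing to prove.
    by_cases hfin : sqNormDivR (hasimoto m (v t) (e t)) = ∞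
    · rw [hfin, ENNReal.mul_top (by
        rw [ne_eq, ENNReal.ofReal_eq_zero, not_le]
        positivity)]
      exact le_top
    obtain ⟨hW, hq⟩ := sqNormDivR_eq (hv t ht) (he t ht) hst (α t) hfin
    rw [← hVd] at hW hq
    obtain ⟨hz, hzle⟩ := hcoer δ V (min_le_left _ _) hV
      ((pairing_kernel1 m V).symm.trans (ho t ht).1)
      ((pairing_kernel2 m V).symm.trans (ho t ht).2) hW
    set D := ∫ r in Ioi (0 : ℝ), deviation m V r ⬝ᵥ deviation m V r / r with hD
    have hF₁ : |f₁| ≤ 15 * m * ((1 + 2 * C₁) * D) := by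
      refine (hV.abs_flux_le hm3 hδh (isKernel1 m) (c := fun r => m * SchrodingerMap.h1 m r ^ 2)
        (fun r hr => ?_) (fun r hr => kernel1_cross_harm hr) hW hz).trans ?_
      · have k0 := h1_pos m hr
        have k1 := h1_le_one m hr.le
        rw [abs_of_nonneg (by positivity)]
        gcongr
        nlinarith
      · gcongr
        linarith
    have hF₂ : |f₂| ≤ 15 * m * ((1 + 2 * C₁) * D) := by
      refine (hV.abs_flux_le hm3 hδh (isKernel2 m) (c := fun _ => 0)
        (fun r hr => ?_) (fun r hr => kernel2_cross_harm hr) hW hz).trans ?_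
      · have k0 := h1_pos m hr
        rw [abs_zero]
        positivity
      · gcongr
        linarith
    rw [hq, ← ENNReal.ofReal_mul (by positivity)]
    refine ENNReal.ofReal_le_ofReal ?_
    have hs2 : 0 < ((s t) ^ 2)⁻¹ := by positivity
    have e1 : -(s t * (((s t) ^ 2)⁻¹ * ((f₁ * g₂ - f₂ * g₁) / (e₁ * g₂ - e₂ * g₁)))) / s t =
        -(((s t) ^ 2)⁻¹ * ((f₁ * g₂ - f₂ * g₁) / (e₁ * g₂ - e₂ * g₁))) := by
      rw [neg_div, mul_div_cancel_left₀ _ hst.ne']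
    rw [e1, abs_neg, abs_mul, abs_mul, abs_of_pos hs2, ← mul_add]
    calc ((s t) ^ 2)⁻¹ * (|(f₁ * g₂ - f₂ * g₁) / (e₁ * g₂ - e₂ * g₁)| +
          |(f₂ * e₁ - f₁ * e₂) / (e₁ * g₂ - e₂ * g₁)|)
        ≤ ((s t) ^ 2)⁻¹ * (5 / κ * (|f₁| + |f₂|)) := by gcongr
      _ ≤ ((s t) ^ 2)⁻¹ * (5 / κ * (15 * m * ((1 + 2 * C₁) * D) + 15 * m * ((1 + 2 * C₁) * D))) := by
        gcongr
      _ = C * (((s t) ^ 2)⁻¹ * D) := by rw [hC]; ring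
  -- Nondegeneracy of I makes `derivWithin` the genuine, possibly one-sided, derivative at every
  -- point of I.
  have hud : ∀ t ∈ I, UniqueDiffWithinAt ℝ I t := by
    refine uniqueDiffOn_convex hI.convex ?_
    obtain ⟨a, ha, b, hb, hab⟩ := hIn.exists_lt
    refine (nonempty_Ioo.2 hab).mono (interior_maximal ?_ isOpen_Ioo)
    exact Ioo_subset_Icc_self.trans (hI.out ha hb)
  refine ⟨fun t ht => ?_, fun t ht => ?_, fun t ht => ?_⟩
  · obtain ⟨s', α', h₁, h₂, h₃⟩ := key t ht
    exact h₁.differentiableWithinAt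
  · obtain ⟨s', α', h₁, h₂, h₃⟩ := key t ht
    exact h₂.differentiableWithinAt
  · obtain ⟨s', α', h₁, h₂, h₃⟩ := key t ht
    rwa [h₁.derivWithin (hud t ht), h₂.derivWithin (hud t ht)]
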